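/- Let $F$ be a compact connected oriented smooth surface, possibly with boundary, with a fixed parametrization of $\partial F$ by $r\ge 0$ circles, and let $\mathsf k$ be a nonzero commutative ring containing $\mathbb Q$. A diagram $D$ on $F$ is a regularly immersed proper $1$-manifold (closed curves and proper arcs) with finitely many transversal double points in the interior of $F$ and over/under information at each of them; in the parametrization it meets the $i$-th boundary circle in $j_i\ge 0$ points $e^{2\pi\sqrt{-1}\,\ell/j_i}$, $1\le \ell\le j_i$. Let $C$ be its set of crossings. Let $\mathfrak C^a(F)$ be the set of isotopy classes (rel $\partial F$) of embedded diagrams without inessential components, i.e. without closed components bounding a disk in $F$. For $S\subseteq T\subseteq C$ let $D_{T,S}$ be the diagram obtained from $D$ by $\infty$-smoothing the crossings in $S$ and $0$-smoothing those in $T\setminus S$ (the $0$-smoothing joins the two regions swept out by the overcrossing strand when it is rotated counterclockwise to the undercrossing strand, the $\infty$-smoothing joins the other two). Let $\mu(D,S)$ be the number of inessential components of $D_{C,S}$ and $[D,S]\in\mathfrak C^a(F)$ the class of its remaining components. Put $$\langle D\rangle=\sum_{S\subseteq C}(-t)^{|C\setminus S|-|S|}(-t^2-t^{-2})^{\mu(D,S)}[D,S]\in\mathsf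 k[t,t^{-1}]\mathfrak C^a(F),$$ and let $\langle D\rangle_k\in\mathsf k\,\mathfrak C^a(F)$ be the coefficient of $h^k$ after the substitution $t=e^h$. For $P=\sum a_{i,m}z^iw^m\in\mathsf k[z,w]$ let $\chi(P)$ be the linear operator on formal combinations of diagrams $$\chi(P)(D)=\sum_{S\subseteq T\subseteq C}(-1)^{|T|}a_{|S|,|T\setminus S|}\,D_{T,S},$$ let $\varphi_j(i)\in\mathbb Q$ be the coefficient of $h^{2j}$ in $(-e^{2h}-e^{-2h})^i$, and let $(\varphi_j)_*(D)=(-1)^{|C|}\sum_{S\subseteq C}\varphi_j(\mu(D,S))[D,S]$, extended linearly. Consider sequences of polynomials $P_k\in\mathbb Q[z,w]$, $k\ge 0$, such that $$\langle D\rangle_k=\sum_{j=0}^{\lfloor k/2\rfloor}(\varphi_j)_*\bigl(\chi(P_{k-2j})(D)\bigr)\quad\text{for all } k\ge 0 \text{ and all diagrams } D \text{ on } F.\qquad(*)$$ **Proposition.** (a) There is a sequence $(P_k)$ satisfying $(*)$ such that, for each $k$, $P_k$ has total degree $k$, is not homogeneous if $k>1$, and has homogeneous degree $k$ component $\sum_{i=0}^k(-1)^iz^iw^{k-i}$.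 (b) For every sequence $(P_k)$ satisfying $(*)$, $P_k$ is symmetric, $P_k(w,z)=P_k(z,w)$, if $k$ is even, and anti-symmetric, $P_k(w,z)=-P_k(z,w)$, if $k$ is odd. (c) If $\tau D$ denotes the diagram obtained from $D$ by changing all crossings, then $\langle\tau D\rangle_k=(-1)^k\langle D\rangle_k$ for all $k\ge 0$ and all diagrams $D$. -/

import Mathlib

open scoped Manifold ContDiff Topology
open Set

namespace KauffmanBracket

/-! ## Oriented surfaces with parametrized boundary -/

/-- The oriented Euclidean plane. -/
abbrev Plane : Type := EuclideanSpace ℝ (Fin 2)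

section Surface

variable (F : Type*) [TopologicalSpace F] [ChartedSpace (EuclideanHalfSpace 2) F]
  [IsManifold (𝓡∂ 2) ∞ F]

/-- An orientation of the smooth surface `F`: for each point `p` the sign says whether the
preferred chart at `p` is orientation preserving at `p`; the sign is locally constant up to the
sign of the Jacobian determinant of the coordinate changes. -/
structure SurfaceOrientation where
  sign : F → ℤˣ
  locallyConstant : ∀ p : F, ∀ᶠ q in 𝓝 p,
    0 < (((sign p * sign q : ℤˣ) : ℤ) : ℝ) *
      LinearMap.det (tangentCoordChange (𝓡∂ 2) p q q : Plane →ₗ[ℝ] Plane)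

/-- A parametrization of the boundary of `F` by `r` circles, i.e. a diffeomorphism from the
disjoint union of `r` copies of the unit circle onto `∂F`. -/
structure BoundaryParametrization where
  r : ℕ
  param : Fin r → Circle → F
  smooth : ∀ i, ContMDiff (𝓡 1) (𝓡∂ 2) ∞ (param i)
  immersive : ∀ i z, Function.Injective (mfderiv (𝓡 1) (𝓡∂ 2) (param i) z)
  injective : ∀ i j z w, param i z = param j w → i = j ∧ z = w
  range_eq : (⋃ i, Set.range (param i)) = (𝓡∂ 2).boundary F

end Surface

section Curves

variable {F : Type*} [TopologicalSpace F] [ChartedSpace (EuclideanHalfSpace 2) F]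

/-- Near `p` the set `S` is a properly embedded smooth curve: in some smooth chart of `F` around
`p`, with values in the half plane `{x 0 ≥ 0}`, it is the line `{x 1 = 0}`. At a boundary point
this says that `S` is an arc that ends at `p`, transversally to the boundary. -/
def LocallyLine (S : Set F) (p : F) : Prop :=
  ∃ φ ∈ IsManifold.maximalAtlas (𝓡∂ 2) ∞ F, p ∈ φ.source ∧
    ∀ q ∈ φ.source, q ∈ S ↔ (φ q).1 1 = 0

/-- `S` meets the `i`-th boundary circle in the `j i` points with parameters
`exp (2 π √-1 ℓ / j i)`, `1 ≤ ℓ ≤ j i`, for some numbers `j i ≥ 0`. -/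
def HasBoundaryPattern (b : BoundaryParametrization F) (S : Set F) : Prop :=
  ∃ j : Fin b.r → ℕ, ∀ i z, b.param i z ∈ S ↔
    ∃ ℓ ∈ Finset.Icc 1 (j i), z = Circle.exp (2 * Real.pi * (ℓ : ℝ) / (j i : ℝ))

/-- The connected components of a subset of `F`. -/
def components (S : Set F) : Set (Set F) :=
  {K | ∃ x ∈ S, K = connectedComponentIn S x}

/-- A closed curve in the interior of `F` is inessential if it bounds an embedded disk in `F`. -/
def IsInessential (K : Set F) : Prop :=
  Disjoint K ((𝓡∂ 2).boundary F) ∧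
    ∃ f : Plane → F, ContinuousOn f (Metric.closedBall 0 1) ∧
      InjOn f (Metric.closedBall 0 1) ∧ f '' Metric.sphere 0 1 = K

/-- The inessential components of `S`. -/
def inessentialComponents (S : Set F) : Set (Set F) :=
  {K ∈ components S | IsInessential K}

/-- The result of discarding all inessential components of `S`. -/
def essentialPart (S : Set F) : Set F :=
  S \ ⋃₀ inessentialComponents S

/-- The curve systems representing elements of `ℭᵃ(F)`: properly embedded smooth compact
1-manifolds with the prescribed boundary points and without inessential components. -/
structure CurveSystem (b : BoundaryParametrization F) where
  carrier : Set F
  isClosed : IsClosed carrier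
  locallyLine : ∀ p ∈ carrier, LocallyLine carrier p
  boundaryPattern : HasBoundaryPattern b carrier
  essential : ∀ K ∈ components carrier, ¬ IsInessential K

/-- Smooth ambient isotopy of subsets of `F`, fixing the boundary pointwise. -/
def Isotopic (S S' : Set F) : Prop :=
  ∃ H : ℝ → Diffeomorph (𝓡∂ 2) (𝓡∂ 2) F F ∞,
    ContMDiff (𝓘(ℝ).prod (𝓡∂ 2)) (𝓡∂ 2) ∞ (fun x : ℝ × F => H x.1 x.2) ∧
    (∀ p, H 0 p = p) ∧ (∀ t, ∀ p ∈ (𝓡∂ 2).boundary F, H t p = p) ∧ H 1 '' S = S'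

theorem Isotopic.refl (S : Set F) : Isotopic S S := by
  refine ⟨fun _ => Diffeomorph.refl _ _ _, ?_, fun _ => rfl, fun _ _ _ => rfl, by simp⟩
  exact contMDiff_snd

theorem Isotopic.symm {S S' : Set F} (h : Isotopic S S') : Isotopic S' S := by
  obtain ⟨H, hs, h0, hb, h1⟩ := h
  refine ⟨fun t => (H 1).symm.trans (H (1 - t)), ?_, ?_, ?_, ?_⟩
  · have : ContMDiff (𝓘(ℝ).prod (𝓡∂ 2)) (𝓘(ℝ).prod (𝓡∂ 2)) ∞
        (fun x : ℝ × F => ((1 - x.1, (H 1).symm x.2) : ℝ × F)) := by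
      apply ContMDiff.prodMk
      · exact (contMDiff_const.sub contMDiff_fst)
      · exact (H 1).symm.contMDiff.comp contMDiff_snd
    exact hs.comp this
  · intro p
    simp
  · intro t p hp
    have : (H 1).symm p = p := by
      have h := (H 1).symm_apply_apply p
      rwa [hb 1 p hp] at h
    simp [this, hb _ p hp]
  · rw [← h1]
    ext p
    simp [h0]

theorem Isotopic.trans {S S' S'' : Set F} (h : Isotopic S S') (h' : Isotopic S' S'') :
    Isotopic S S'' := by
  obtain ⟨H, hs, h0, hb, h1⟩ := h
  obtain ⟨G, gs, g0, gb, g1⟩ := h'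
  refine ⟨fun t => (H t).trans (G t), ?_, ?_, ?_, ?_⟩
  · have : ContMDiff (𝓘(ℝ).prod (𝓡∂ 2)) (𝓘(ℝ).prod (𝓡∂ 2)) ∞
        (fun x : ℝ × F => ((x.1, H x.1 x.2) : ℝ × F)) :=
      ContMDiff.prodMk contMDiff_fst hs
    exact gs.comp this
  · intro p
    simp [h0, g0]
  · intro t p hp
    simp [hb t p hp, gb t p hp]
  · rw [← g1, ← h1, image_image]
    rfl

instance curveSystemSetoid (b : BoundaryParametrization F) : Setoid (CurveSystem b) where
  r α β := Isotopic α.carrier β.carrier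
  iseqv := ⟨fun _ => Isotopic.refl _, Isotopic.symm, Isotopic.trans⟩

/-- The set `ℭᵃ(F)` of isotopy classes of curve systems. -/
def CurveClass (b : BoundaryParametrization F) : Type _ :=
  Quotient (curveSystemSetoid b)

/-! Discarding the inessential components of a properly embedded curve gives a curve system. -/

theorem LocallyLine.exists_preconnected {S : Set F} {p : F} (h : LocallyLine S p) :
    ∃ U : Set F, IsOpen U ∧ p ∈ U ∧ IsPreconnected (U ∩ S) := by
  obtain ⟨φ, -, hp, hS⟩ := h
  obtain ⟨V, hV, hVt⟩ := isOpen_induced_iff.1 φ.open_target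
  have hpV : (φ p).1 ∈ V := by
    have := φ.map_source hp
    rwa [← hVt] at this
  obtain ⟨ε, hε, hball'⟩ := Metric.isOpen_iff.1 hV _ hpV
  set B : Set (EuclideanHalfSpace 2) := Subtype.val ⁻¹' Metric.ball (φ p).1 ε with hB
  have hball : B ⊆ φ.target := by
    rw [← hVt]
    exact preimage_mono hball'
  refine ⟨φ.source ∩ φ ⁻¹' B, φ.isOpen_inter_preimage
    (Metric.isOpen_ball.preimage continuous_subtype_val), ⟨hp, Metric.mem_ball_self hε⟩, ?_⟩
  have key : φ.source ∩ φ ⁻¹' B ∩ S = φ.symm '' (B ∩ {y | y.1 1 = 0}) := by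
    ext q
    constructor
    · rintro ⟨⟨hq, hq'⟩, hqS⟩
      exact ⟨φ q, ⟨hq', (hS q hq).1 hqS⟩, φ.left_inv hq⟩
    · rintro ⟨y, ⟨hy, hy'⟩, rfl⟩
      have hyt := hball hy
      refine ⟨⟨φ.map_target hyt, ?_⟩, ?_⟩
      · rwa [mem_preimage, φ.right_inv hyt]
      · rw [hS _ (φ.map_target hyt), φ.right_inv hyt]
        exact hy'
  rw [key]
  refine IsPreconnected.image ?_ _ (φ.continuousOn_symm.mono fun y hy => hball hy.1)
  have hind : Topology.IsInducing (Subtype.val : EuclideanHalfSpace 2 → Plane) := ⟨rfl⟩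
  rw [← hind.isPreconnected_image]
  apply Convex.isPreconnected
  have : (Subtype.val '' (B ∩ {y : EuclideanHalfSpace 2 | y.1 1 = 0}) :
      Set Plane) = Metric.ball (φ p).1 ε ∩ ({y : Plane | 0 ≤ y 0} ∩ {y : Plane | y 1 = 0}) := by
    ext y
    constructor
    · rintro ⟨y, ⟨hy, hy'⟩, rfl⟩
      exact ⟨hy, y.2, hy'⟩
    · rintro ⟨hy, hy0, hy'⟩
      exact ⟨⟨y, hy0⟩, ⟨hy, hy'⟩, rfl⟩
  rw [this]
  refine (convex_ball _ _).inter (Convex.inter ?_ ?_)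
  · intro x hx y hy a b ha hb _
    simp only [mem_ofPred_eq, PiLp.add_apply, PiLp.smul_apply, smul_eq_mul] at *
    positivity
  · intro x hx y hy a b ha hb _
    simp only [mem_ofPred_eq, PiLp.add_apply, PiLp.smul_apply, smul_eq_mul] at *
    simp [hx, hy]

theorem LocallyLine.exists_subset_component {S : Set F} {p : F} (h : LocallyLine S p)
    (hp : p ∈ S) : ∃ U : Set F, IsOpen U ∧ p ∈ U ∧ U ∩ S ⊆ connectedComponentIn S p := by
  obtain ⟨U, hU, hpU, hc⟩ := h.exists_preconnected
  exact ⟨U, hU, hpU, hc.subset_connectedComponentIn ⟨hpU, hp⟩ inter_subset_right⟩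

theorem mem_essentialPart_iff {S : Set F} {p : F} :
    p ∈ essentialPart S ↔ p ∈ S ∧ ¬ IsInessential (connectedComponentIn S p) := by
  constructor
  · rintro ⟨hp, hn⟩
    exact ⟨hp, fun h => hn ⟨_, ⟨⟨p, hp, rfl⟩, h⟩, mem_connectedComponentIn hp⟩⟩
  · rintro ⟨hp, hn⟩
    refine ⟨hp, ?_⟩
    rintro ⟨K, ⟨⟨x, hx, rfl⟩, hK⟩, hpK⟩
    exact hn (connectedComponentIn_eq hpK ▸ hK)

theorem component_subset_essentialPart {S : Set F} {p : F} (hp : p ∈ essentialPart S) :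
    connectedComponentIn S p ⊆ essentialPart S := by
  intro q hq
  rw [mem_essentialPart_iff] at hp ⊢
  exact ⟨connectedComponentIn_subset S p hq, connectedComponentIn_eq hq ▸ hp.2⟩

theorem component_essentialPart {S : Set F} {p : F} (hp : p ∈ essentialPart S) :
    connectedComponentIn (essentialPart S) p = connectedComponentIn S p := by
  apply Subset.antisymm
  · exact connectedComponentIn_mono p sdiff_subset
  · exact isPreconnected_connectedComponentIn.subset_connectedComponentIn
      (mem_connectedComponentIn hp.1) (component_subset_essentialPart hp)

theorem LocallyLine.congr [IsManifold (𝓡∂ 2) ∞ F] {S S' U : Set F} {p : F}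
    (h : LocallyLine S p) (hU : IsOpen U) (hp : p ∈ U)
    (hS : ∀ q ∈ U, q ∈ S' ↔ q ∈ S) : LocallyLine S' p := by
  obtain ⟨φ, hφ, hpφ, hφS⟩ := h
  refine ⟨φ.restr U, restr_mem_maximalAtlas _ hφ hU, ?_, ?_⟩
  · rw [φ.restr_source' _ hU]
    exact ⟨hpφ, hp⟩
  · intro q hq
    rw [φ.restr_source' _ hU] at hq
    rw [hS q hq.2, hφS q hq.1]
    rfl

/-- The curve system obtained from a properly embedded curve by discarding its inessential
components. -/
def CurveSystem.ofCurve [IsManifold (𝓡∂ 2) ∞ F] (b : BoundaryParametrization F) (S : Set F)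
    (hc : IsClosed S) (hl : ∀ p ∈ S, LocallyLine S p) (hb : HasBoundaryPattern b S) :
    CurveSystem b where
  carrier := essentialPart S
  isClosed := by
    rw [← closure_subset_iff_isClosed]
    intro q hq
    have hqS : q ∈ S := hc.closure_subset_iff.2 sdiff_subset hq
    rw [mem_essentialPart_iff]
    refine ⟨hqS, fun hin => ?_⟩
    obtain ⟨U, hU, hqU, hsub⟩ := (hl q hqS).exists_subset_component hqS
    obtain ⟨x, hxU, hx⟩ := mem_closure_iff.1 hq U hU hqU
    rw [mem_essentialPart_iff] at hx
    exact hx.2 (connectedComponentIn_eq (hsub ⟨hxU, hx.1⟩) ▸ hin)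
  locallyLine := by
    intro p hp
    obtain ⟨U, hU, hpU, hsub⟩ := (hl p hp.1).exists_subset_component hp.1
    exact (hl p hp.1).congr hU hpU fun q hq =>
      ⟨fun h => h.1, fun h => component_subset_essentialPart hp (hsub ⟨hq, h⟩)⟩
  boundaryPattern := by
    obtain ⟨j, hj⟩ := hb
    refine ⟨j, fun i z => ?_⟩
    rw [← hj i z, mem_essentialPart_iff]
    refine ⟨fun h => h.1, fun h => ⟨h, fun hin => ?_⟩⟩
    refine disjoint_left.1 hin.1 (mem_connectedComponentIn h) ?_
    rw [← b.range_eq]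
    exact mem_iUnion.2 ⟨i, z, rfl⟩
  essential := by
    rintro K ⟨x, hx, rfl⟩
    rw [component_essentialPart hx]
    exact (mem_essentialPart_iff.1 hx).2

end Curves

/-! ## Crossings and their resolutions in the plane -/

/-- The standard crossing: the two lines `y = x` and `y = -x`. -/
def cross : Set Plane := {x | x 0 ^ 2 = x 1 ^ 2}

/-- A smooth function that is positive on `(-1, 1)` and zero elsewhere. -/
noncomputable def bump (s : ℝ) : ℝ := Real.smoothTransition (1 - s ^ 2)

/-- A pair of disjoint smooth arcs that agrees with the standard crossing away from the origin.
For `(i, j) = (0, 1)` these are the arcs `)(`, which connect the upper with the lower region of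
the crossing; for `(i, j) = (1, 0)` they connect the left with the right region. -/
def arcs (i j : Fin 2) : Set Plane := {x | x i ^ 2 = x j ^ 2 + bump (x j)}

/-- The standard crossing resolved: `ovr` tells whether the overcrossing strand is `y = x`
(otherwise it is `y = -x`), `infty` tells whether the marker is `∞` (otherwise it is `0`). The
`0`-resolution connects the two regions that the overcrossing strand sweeps out when it is
rotated counterclockwise to the undercrossing strand. -/
def resolution (ovr infty : Bool) : Set Plane :=
  if ovr = infty then arcs 1 0 else arcs 0 1

/-- A compact box; outside of it the crossing is not changed by the resolutions. -/
def box : Set Plane := {x | |x 0| ≤ 2 ∧ |x 1| ≤ 2}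

theorem isCompact_box : IsCompact box := by
  have : box = (EuclideanSpace.equiv (Fin 2) ℝ).toHomeomorph ⁻¹'
      (Set.univ.pi fun _ => Set.Icc (-2) 2) := by
    ext x
    simp only [box, mem_ofPred_eq, abs_le, mem_preimage, Set.mem_pi, Fin.forall_fin_two, mem_univ,
      forall_true_left, mem_Icc]
    rfl
  rw [this]
  exact (Homeomorph.isCompact_preimage _).2 (isCompact_univ_pi fun _ => isCompact_Icc)

theorem bump_nonneg (s : ℝ) : 0 ≤ bump s := Real.smoothTransition.nonneg _

theorem contDiff_bump : ContDiff ℝ ∞ bump :=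
  Real.smoothTransition.contDiff.comp (contDiff_const.sub (contDiff_id.pow 2))

theorem sq_add_bump_pos (s : ℝ) : 0 < s ^ 2 + bump s := by
  by_cases h : s = 0
  · have := Real.smoothTransition.pos_of_pos (x := 1 - s ^ 2) (by simp [h])
    unfold bump
    positivity
  · have := bump_nonneg s
    positivity

theorem arcs_eq_cross {i j : Fin 2} (hij : i ≠ j) {x : Plane} (hx : x ∉ box) :
    x ∈ arcs i j ↔ x ∈ cross := by
  have hb : x ∉ box ↔ ¬ (|x i| ≤ 2 ∧ |x j| ≤ 2) := by
    fin_cases i <;> fin_cases j <;> simp_all [box, and_comm]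
  have hc : x ∈ cross ↔ x i ^ 2 = x j ^ 2 := by
    fin_cases i <;> fin_cases j <;> simp_all [cross, eq_comm]
  rw [hb] at hx
  rw [hc]
  show x i ^ 2 = x j ^ 2 + bump (x j) ↔ _
  by_cases h1 : 1 ≤ x j ^ 2
  · have : bump (x j) = 0 := Real.smoothTransition.zero_of_nonpos (by linarith)
    rw [this, add_zero]
  · have hle : bump (x j) ≤ 1 := Real.smoothTransition.le_one _
    have hj : |x j| ≤ 2 := abs_le_of_sq_le_sq (by linarith) (by norm_num)
    have hi : ∀ h : x i ^ 2 ≤ 2, False := fun h =>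
      hx ⟨abs_le_of_sq_le_sq (by linarith) (by norm_num), hj⟩
    exact ⟨fun h => (hi (by linarith)).elim, fun h => (hi (by linarith)).elim⟩

theorem resolution_eq_cross (o m : Bool) {x : Plane} (hx : x ∉ box) :
    x ∈ resolution o m ↔ x ∈ cross := by
  unfold resolution
  split_ifs
  · exact arcs_eq_cross (by decide) hx
  · exact arcs_eq_cross (by decide) hx

theorem isClosed_resolution (o m : Bool) : IsClosed (resolution o m) := by
  have hb := contDiff_bump.continuous
  unfold resolution arcs
  split_ifs <;> exact isClosed_eq (by fun_prop) (by fun_prop)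

theorem exists_straightening {i j : Fin 2} (hij : i ≠ j) {x : Plane} (hx : x ∈ arcs i j) :
    ∃ Φ : OpenPartialHomeomorph Plane Plane, x ∈ Φ.source ∧ ContDiffOn ℝ ∞ Φ Φ.source ∧
      ContDiffOn ℝ ∞ Φ.symm Φ.target ∧
      ∀ y ∈ Φ.source, 0 < Φ y 0 ∧ (y ∈ arcs i j ↔ Φ y 1 = 0) := by
  obtain ⟨g, hg, hgpos, hgsq⟩ : ∃ g : ℝ → ℝ, ContDiff ℝ ∞ g ∧ (∀ t, 0 < g t) ∧
      ∀ t, g t ^ 2 = t ^ 2 + bump t :=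
    ⟨fun t => √(t ^ 2 + bump t),
      ((contDiff_id.pow 2).add contDiff_bump).sqrt fun t => (sq_add_bump_pos t).ne',
      fun t => Real.sqrt_pos.2 (sq_add_bump_pos t), fun t => Real.sq_sqrt (sq_add_bump_pos t).le⟩
  have hx' : x i ^ 2 = x j ^ 2 + bump (x j) := hx
  obtain ⟨s, hs, hsx⟩ : ∃ s : ℝ, s * s = 1 ∧ 0 < s * x i := by
    have h0 : x i ≠ 0 := fun h => by
      have := sq_add_bump_pos (x j)
      rw [← hx', h] at this
      norm_num at this
    rcases lt_or_gt_of_ne h0 with h | h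
    · exact ⟨-1, by norm_num, by linarith⟩
    · exact ⟨1, by norm_num, by linarith⟩
  set c : ℝ := x j - 1 with hc
  have hk : ∀ k : Fin 2, k = i ∨ k = j := by
    intro k
    fin_cases i <;> fin_cases j <;> fin_cases k <;> simp_all
  let Φ : OpenPartialHomeomorph Plane Plane :=
    { toFun := fun y => !₂[y j - c, s * y i - g (y j)]
      invFun := fun z => WithLp.toLp 2 fun k =>
        if k = i then s * (z 1 + g (z 0 + c)) else z 0 + c
      source := {y | 0 < s * y i ∧ c < y j}
      target := {z | 0 < z 0 ∧ 0 < z 1 + g (z 0 + c)}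
      map_source' := by
        rintro y ⟨h1, h2⟩
        simpa using ⟨h2, h1⟩
      map_target' := by
        rintro z ⟨h1, h2⟩
        simp only [mem_ofPred_eq, if_true, hij.symm, if_false, ← mul_assoc, hs, one_mul]
        exact ⟨h2, by linarith⟩
      left_inv' := by
        rintro y -
        ext k
        rcases hk k with rfl | rfl
        · simp [← mul_assoc, hs]
        · simp [hij.symm]
      right_inv' := by
        rintro z -
        ext k
        fin_cases k
        · simp [hij.symm]
        · simp [hij.symm, ← mul_assoc, hs]
      open_source := by
        have h1 : IsOpen {y : Plane | 0 < s * y i} := isOpen_lt (by fun_prop) (by fun_prop)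
        have h2 : IsOpen {y : Plane | c < y j} := isOpen_lt (by fun_prop) (by fun_prop)
        exact h1.inter h2
      open_target := by
        have := hg.continuous
        have h1 : IsOpen {z : Plane | 0 < z 0} := isOpen_lt (by fun_prop) (by fun_prop)
        have h2 : IsOpen {z : Plane | 0 < z 1 + g (z 0 + c)} :=
          isOpen_lt (by fun_prop) (by fun_prop)
        exact h1.inter h2
      continuousOn_toFun := by
        have := hg.continuous
        apply Continuous.continuousOn
        fun_prop
      continuousOn_invFun := by
        have := hg.continuous
        apply Continuous.continuousOn
        apply (PiLp.continuous_toLp 2 _).comp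
        refine continuous_pi fun k => ?_
        split_ifs <;> fun_prop }
  refine ⟨Φ, ⟨hsx, by linarith⟩, ?_, ?_, ?_⟩
  · apply ContDiff.contDiffOn
    rw [contDiff_euclidean]
    intro k
    fin_cases k
    · show ContDiff ℝ ∞ fun y : Plane => y j - c
      fun_prop
    · show ContDiff ℝ ∞ fun y : Plane => s * y i - g (y j)
      fun_prop
  · apply ContDiff.contDiffOn
    rw [contDiff_euclidean]
    intro k
    show ContDiff ℝ ∞ fun z : Plane => if k = i then s * (z 1 + g (z 0 + c)) else z 0 + c
    split_ifs <;> fun_prop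
  · rintro y ⟨h1, h2⟩
    refine ⟨?_, ?_⟩
    · show 0 < y j - c
      linarith
    · show y i ^ 2 = y j ^ 2 + bump (y j) ↔ s * y i - g (y j) = 0
      rw [← hgsq, sub_eq_zero]
      have h3 : y i ^ 2 = (s * y i) ^ 2 := by
        rw [mul_pow, sq s, hs, one_mul]
      rw [h3]
      exact pow_left_inj₀ h1.le (hgpos _).le (by norm_num)

theorem right_inv_halfPlane {x : Plane} (hx : 0 < x 0) : (𝓡∂ 2) ((𝓡∂ 2).symm x) = x := by
  apply (𝓡∂ 2).right_inv
  rw [range_modelWithCornersEuclideanHalfSpace]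
  exact le_of_lt (α := ℝ) hx

/-- The chart of the open half plane `{x 0 > 0}` in the closed one. -/
noncomputable def halfPlaneChart : OpenPartialHomeomorph Plane (EuclideanHalfSpace 2) where
  toFun := (𝓡∂ 2).symm
  invFun := Subtype.val
  source := {x | 0 < x 0}
  target := {y | 0 < y.1 0}
  map_source' := by
    intro x hx
    have : (𝓡∂ 2) ((𝓡∂ 2).symm x) = x := right_inv_halfPlane hx
    show 0 < ((𝓡∂ 2) ((𝓡∂ 2).symm x)) 0
    rw [this]
    exact hx
  map_target' := fun y hy => hy
  left_inv' := by
    intro x hx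
    exact right_inv_halfPlane hx
  right_inv' := fun y _ => (𝓡∂ 2).left_inv y
  open_source := isOpen_lt (by fun_prop) (by fun_prop)
  open_target := by
    have h : IsOpen {x : Plane | 0 < x 0} := isOpen_lt (by fun_prop) (by fun_prop)
    exact h.preimage continuous_subtype_val
  continuousOn_toFun := (𝓡∂ 2).continuous_symm.continuousOn
  continuousOn_invFun := continuous_subtype_val.continuousOn

/-! ## Diagrams -/

section Diagrams

variable {F : Type*} [TopologicalSpace F] [ChartedSpace (EuclideanHalfSpace 2) F]
  [IsManifold (𝓡∂ 2) ∞ F]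

/-- `e` is an orientation preserving diffeomorphism of the plane onto an open subset of the
interior of `F`. -/
structure IsOrientedDisk (o : SurfaceOrientation F) (e : OpenPartialHomeomorph Plane F) :
    Prop where
  source_eq : e.source = univ
  smooth : ContMDiff (𝓡 2) (𝓡∂ 2) ∞ e
  smooth_symm : ContMDiffOn (𝓡∂ 2) (𝓡 2) ∞ e.symm e.target
  target_subset : e.target ⊆ (𝓡∂ 2).interior F
  oriented : ∀ x : Plane, 0 < ((o.sign (e x) : ℤ) : ℝ) *
    ContinuousLinearMap.det (M := Plane) (R := ℝ) (mfderiv (𝓡 2) (𝓡∂ 2) e x)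

/-- A real diagram on `F`: a regularly immersed proper 1-manifold `carrier` with the prescribed
boundary points, whose only singularities are finitely many transversal double points, the
crossings. The diagram comes with an oriented coordinate disk `disk p` around each crossing `p`,
in which it is the standard crossing, and `ovr p` tells whether the overcrossing strand is the
line `y = x` (otherwise it is `y = -x`). The disks of different crossings are disjoint. The values
of `disk` and `ovr` at other points are irrelevant. -/
structure Diagram (o : SurfaceOrientation F) (b : BoundaryParametrization F) where
  carrier : Set F
  crossings : Finset F
  disk : F → OpenPartialHomeomorph Plane F
  ovr : F → Bool
  isClosed : IsClosed carrier
  boundaryPattern : HasBoundaryPattern b carrier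
  oriented_disk : ∀ p ∈ crossings, IsOrientedDisk o (disk p)
  disk_zero : ∀ p ∈ crossings, disk p 0 = p
  disk_preimage : ∀ p ∈ crossings, disk p ⁻¹' carrier = cross
  disjoint_disks : ∀ p ∈ crossings, ∀ q ∈ crossings, p ≠ q →
    Disjoint (disk p).target (disk q).target
  locallyLine : ∀ p ∈ carrier, p ∉ crossings → LocallyLine carrier p

theorem IsOrientedDisk.locallyLine {o : SurfaceOrientation F}
    {e : OpenPartialHomeomorph Plane F} (he : IsOrientedDisk o e) {S : Set F} {ov m : Bool}
    (hS : ∀ q ∈ e.target, q ∈ S ↔ e.symm q ∈ resolution ov m) {q : F} (hq : q ∈ e.target)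
    (hqS : q ∈ S) : LocallyLine S q := by
  obtain ⟨Φ, hxΦ, hΦ, hΦ', hΦS⟩ : ∃ Φ : OpenPartialHomeomorph Plane Plane,
      e.symm q ∈ Φ.source ∧ ContDiffOn ℝ ∞ Φ Φ.source ∧ ContDiffOn ℝ ∞ Φ.symm Φ.target ∧
      ∀ y ∈ Φ.source, 0 < Φ y 0 ∧ (y ∈ resolution ov m ↔ Φ y 1 = 0) := by
    have := (hS q hq).1 hqS
    revert this
    unfold resolution
    split_ifs
    · exact exists_straightening (by decide)
    · exact exists_straightening (by decide)
  have hr : ∀ x : Plane, 0 < x 0 → ((𝓡∂ 2).symm x).1 = x := fun x hx => right_inv_halfPlane hx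
  refine ⟨(e.symm.trans Φ).trans halfPlaneChart, ?_, ?_, ?_⟩
  · apply OpenPartialHomeomorph.mem_maximalAtlas_of_contMDiffOn
    · rw [OpenPartialHomeomorph.coe_trans, OpenPartialHomeomorph.coe_trans]
      refine ContMDiffOn.comp (I' := 𝓡 2) (t := {x | 0 < x 0})
        ((𝓡∂ 2).contMDiffOn_symm.mono ?_) (ContMDiffOn.comp (I' := 𝓡 2) (t := Φ.source)
          hΦ.contMDiffOn (he.smooth_symm.mono ?_) ?_) ?_
      · intro x hx
        rw [range_modelWithCornersEuclideanHalfSpace]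
        exact le_of_lt (α := ℝ) hx
      · intro x hx
        exact hx.1.1
      · intro x hx
        exact hx.1.2
      · intro x hx
        exact hx.2
    · have : (((e.symm.trans Φ).trans halfPlaneChart).symm : EuclideanHalfSpace 2 → F) =
          (e ∘ Φ.symm) ∘ (𝓡∂ 2) := rfl
      rw [this]
      refine ContMDiffOn.comp (I' := 𝓡 2) (t := Φ.target)
        (he.smooth.comp_contMDiffOn hΦ'.contMDiffOn) (𝓡∂ 2).contMDiff.contMDiffOn ?_
      intro x hx
      exact hx.2.1
  · refine ⟨⟨hq, hxΦ⟩, (hΦS _ hxΦ).1⟩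
  · rintro y ⟨⟨hy1, hy2⟩, hy3⟩
    have hy2' : e.symm y ∈ Φ.source := hy2
    have hy3' : 0 < Φ (e.symm y) 0 := hy3
    rw [hS y hy1, (hΦS _ hy2').2]
    show _ ↔ ((𝓡∂ 2).symm (Φ (e.symm y))).1 1 = 0
    rw [hr _ hy3']

namespace Diagram

variable {o : SurfaceOrientation F} {b : BoundaryParametrization F}

open scoped Classical in
/-- The underlying set of the diagram that results from `D` by smoothing the crossings in `T`;
the crossings in `S` have the marker `∞` and all others the marker `0`. -/
def smoothCarrier (D : Diagram o b) (T S : Finset F) : Set F :=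
  (D.carrier \ ⋃ p ∈ D.crossings ∩ T, (D.disk p).target) ∪
    ⋃ p ∈ D.crossings ∩ T, D.disk p '' resolution (D.ovr p) (decide (p ∈ S))

theorem mem_target (D : Diagram o b) {p : F} (hp : p ∈ D.crossings) (x : Plane) :
    D.disk p x ∈ (D.disk p).target :=
  (D.disk p).map_source (by rw [(D.oriented_disk p hp).source_eq]; exact mem_univ _)

theorem mem_carrier_iff (D : Diagram o b) {p : F} (hp : p ∈ D.crossings) {q : F}
    (hq : q ∈ (D.disk p).target) : q ∈ D.carrier ↔ (D.disk p).symm q ∈ cross := by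
  rw [← D.disk_preimage p hp, mem_preimage, (D.disk p).right_inv hq]

theorem eq_of_mem_target (D : Diagram o b) {p p' : F} (hp : p ∈ D.crossings)
    (hp' : p' ∈ D.crossings) {q : F} (hq : q ∈ (D.disk p).target)
    (hq' : q ∈ (D.disk p').target) : p = p' := by
  by_contra h
  exact disjoint_left.1 (D.disjoint_disks p hp p' hp' h) hq hq'

open scoped Classical in
theorem mem_smoothCarrier_of_mem_target (D : Diagram o b) (T S : Finset F) {p q : F}
    (hp : p ∈ D.crossings) (hpT : p ∈ T) (hq : q ∈ (D.disk p).target) :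
    q ∈ D.smoothCarrier T S ↔
      (D.disk p).symm q ∈ resolution (D.ovr p) (decide (p ∈ S)) := by
  constructor
  · rintro (⟨-, h⟩ | h)
    · exact (h (mem_biUnion (Finset.mem_coe.2 (Finset.mem_inter.2 ⟨hp, hpT⟩)) hq)).elim
    · simp only [mem_iUnion, Finset.mem_inter] at h
      obtain ⟨p', ⟨hp', -⟩, x, hx, rfl⟩ := h
      obtain rfl := D.eq_of_mem_target hp hp' hq (D.mem_target hp' x)
      rwa [(D.disk p).left_inv (by rw [(D.oriented_disk p hp).source_eq]; exact mem_univ _)]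
  · intro h
    refine Or.inr (mem_biUnion (Finset.mem_coe.2 (Finset.mem_inter.2 ⟨hp, hpT⟩)) ?_)
    exact ⟨_, h, (D.disk p).right_inv hq⟩

open scoped Classical in
theorem mem_smoothCarrier_of_notMem (D : Diagram o b) (T S : Finset F) {q : F}
    (hq : ∀ p ∈ D.crossings, p ∈ T → q ∉ D.disk p '' box) :
    q ∈ D.smoothCarrier T S ↔ q ∈ D.carrier := by
  by_cases h : ∃ p ∈ D.crossings, p ∈ T ∧ q ∈ (D.disk p).target
  · obtain ⟨p, hp, hpT, hqp⟩ := h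
    rw [D.mem_smoothCarrier_of_mem_target T S hp hpT hqp, D.mem_carrier_iff hp hqp]
    exact resolution_eq_cross _ _ fun hb => hq p hp hpT ⟨_, hb, (D.disk p).right_inv hqp⟩
  · push Not at h
    constructor
    · rintro (h' | h')
      · exact h'.1
      · simp only [mem_iUnion, Finset.mem_inter] at h'
        obtain ⟨p, ⟨hp, hpT⟩, x, -, rfl⟩ := h'
        exact (h p hp hpT (D.mem_target hp x)).elim
    · intro h'
      refine Or.inl ⟨h', ?_⟩
      simp only [mem_iUnion, Finset.mem_inter, not_exists]
      rintro p ⟨hp, hpT⟩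
      exact h p hp hpT

open scoped Classical in
theorem isOpen_outside [T2Space F] (D : Diagram o b) (T : Finset F) :
    IsOpen {q : F | ∀ p ∈ D.crossings, p ∈ T → q ∉ D.disk p '' box} := by
  have : {q : F | ∀ p ∈ D.crossings, p ∈ T → q ∉ D.disk p '' box} =
      ⋂ p ∈ D.crossings ∩ T, (D.disk p '' box)ᶜ := by
    ext q
    simp
  rw [this]
  refine isOpen_biInter_finset fun p hp => ?_
  have hc : Continuous (D.disk p) :=
    (D.oriented_disk p (Finset.mem_inter.1 hp).1).smooth.continuous
  exact (isCompact_box.image hc).isClosed.isOpen_compl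

theorem mem_target_of_mem_box (D : Diagram o b) {p q : F} (hp : p ∈ D.crossings)
    (hq : q ∈ D.disk p '' box) : q ∈ (D.disk p).target := by
  obtain ⟨x, -, rfl⟩ := hq
  exact D.mem_target hp x

open scoped Classical in
/-- The diagram that results from `D` by smoothing the crossings in `T`; the crossings in `S`
have the marker `∞` and all others the marker `0`. The remaining crossings are those not in
`T`. -/
noncomputable def smooth [T2Space F] (D : Diagram o b) (T S : Finset F) : Diagram o b where
  carrier := D.smoothCarrier T S
  crossings := D.crossings \ T
  disk := D.disk
  ovr := D.ovr
  isClosed := by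
    rw [← isOpen_compl_iff, isOpen_iff_mem_nhds]
    intro q hq
    by_cases h : ∀ p ∈ D.crossings, p ∈ T → q ∉ D.disk p '' box
    · have hq' : q ∈ D.carrierᶜ := fun h' => hq ((D.mem_smoothCarrier_of_notMem T S h).2 h')
      filter_upwards [(D.isOpen_outside T).mem_nhds h, D.isClosed.isOpen_compl.mem_nhds hq']
        with y hy hy' hy''
      exact hy' ((D.mem_smoothCarrier_of_notMem T S hy).1 hy'')
    · push Not at h
      obtain ⟨p, hp, hpT, hb⟩ := h
      have hqp := D.mem_target_of_mem_box hp hb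
      have hq' : (D.disk p).symm q ∈ (resolution (D.ovr p) (decide (p ∈ S)))ᶜ :=
        fun h' => hq ((D.mem_smoothCarrier_of_mem_target T S hp hpT hqp).2 h')
      filter_upwards [(D.disk p).open_target.mem_nhds hqp,
        ((D.disk p).continuousAt_symm hqp) ((isClosed_resolution _ _).isOpen_compl.mem_nhds hq')]
        with y hy hy' hy''
      exact hy' ((D.mem_smoothCarrier_of_mem_target T S hp hpT hy).1 hy'')
  boundaryPattern := by
    obtain ⟨j, hj⟩ := D.boundaryPattern
    refine ⟨j, fun i z => ?_⟩
    rw [← hj i z]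
    refine D.mem_smoothCarrier_of_notMem T S fun p hp _ hb => ?_
    refine disjoint_left.1 (ModelWithCorners.disjoint_interior_boundary (I := 𝓡∂ 2) (M := F))
      ((D.oriented_disk p hp).target_subset (D.mem_target_of_mem_box hp hb)) ?_
    rw [← b.range_eq]
    exact mem_iUnion.2 ⟨i, z, rfl⟩
  oriented_disk p hp := D.oriented_disk p (Finset.mem_sdiff.1 hp).1
  disk_zero p hp := D.disk_zero p (Finset.mem_sdiff.1 hp).1
  disk_preimage p hp := by
    rw [Finset.mem_sdiff] at hp
    rw [← D.disk_preimage p hp.1]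
    ext x
    refine D.mem_smoothCarrier_of_notMem T S fun p' hp' hpT' hb => ?_
    have := D.eq_of_mem_target hp.1 hp' (D.mem_target hp.1 x) (D.mem_target_of_mem_box hp' hb)
    exact hp.2 (this ▸ hpT')
  disjoint_disks p hp q hq :=
    D.disjoint_disks p (Finset.mem_sdiff.1 hp).1 q (Finset.mem_sdiff.1 hq).1
  locallyLine q hq hqC := by
    by_cases h : ∃ p ∈ D.crossings, p ∈ T ∧ q ∈ (D.disk p).target
    · obtain ⟨p, hp, hpT, hqp⟩ := h
      exact (D.oriented_disk p hp).locallyLine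
        (fun y hy => D.mem_smoothCarrier_of_mem_target T S hp hpT hy) hqp hq
    · push Not at h
      have ho : ∀ p ∈ D.crossings, p ∈ T → q ∉ D.disk p '' box :=
        fun p hp hpT hb => h p hp hpT (D.mem_target_of_mem_box hp hb)
      have hqD := (D.mem_smoothCarrier_of_notMem T S ho).1 hq
      have hqC' : q ∉ D.crossings := by
        intro hq'
        by_cases hqT : q ∈ T
        · refine h q hq' hqT ?_
          have := D.mem_target hq' 0
          rwa [D.disk_zero q hq'] at this
        · exact hqC (Finset.mem_sdiff.2 ⟨hq', hqT⟩)
      exact (D.locallyLine q hqD hqC').congr (D.isOpen_outside T) ho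
        fun y hy => D.mem_smoothCarrier_of_notMem T S hy

/-- The diagram `τ D` that results from changing all crossings. -/
def crossingChange (D : Diagram o b) : Diagram o b :=
  { D with ovr := fun p => !D.ovr p }

variable [T2Space F]

/-- The closed 1-manifold that results from `D` by smoothing all crossings according to the
Kauffman state with the set `S` of `∞`-markers. -/
noncomputable def stateCurve (D : Diagram o b) (S : Finset F) : Diagram o b :=
  D.smooth D.crossings S

/-- The number `μ` of inessential components in the smoothing of `D` by a Kauffman state. -/
noncomputable def mu (D : Diagram o b) (S : Finset F) : ℕ :=
  (inessentialComponents (D.stateCurve S).carrier).ncard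

/-- The isotopy class of the curve system of the essential components in the smoothing of `D` by
a Kauffman state. -/
noncomputable def stateClass (D : Diagram o b) (S : Finset F) : CurveClass b :=
  Quotient.mk _ (CurveSystem.ofCurve b (D.stateCurve S).carrier (D.stateCurve S).isClosed
    (fun p hp => (D.stateCurve S).locallyLine p hp (by simp [stateCurve, smooth]))
    (D.stateCurve S).boundaryPattern)

end Diagram

end Diagrams

/-! ## The bracket, resolution operators and projections -/

section Algebra

variable (𝕜 : Type*) [CommRing 𝕜]

/-- The unit `t` of `𝕜[t, t⁻¹]`. -/
noncomputable def tUnit : (LaurentPolynomial 𝕜)ˣ where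
  val := LaurentPolynomial.T 1
  inv := LaurentPolynomial.T (-1)
  val_inv := by rw [← LaurentPolynomial.T_add]; simp
  inv_val := by rw [← LaurentPolynomial.T_add]; simp

/-- The value `-t² - t⁻²` of a trivial component. -/
noncomputable def loopValue : LaurentPolynomial 𝕜 :=
  -LaurentPolynomial.T 2 - LaurentPolynomial.T (-2)

/-- The ring homomorphism `𝕜[t, t⁻¹] → 𝕜[[h]]` that maps `t` to `e^h`. -/
noncomputable def hExpansion [Algebra ℚ 𝕜] : LaurentPolynomial 𝕜 →+* PowerSeries 𝕜 :=
  LaurentPolynomial.eval₂ PowerSeries.C (PowerSeries.isUnit_exp 𝕜).unit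

/-- `φ_j(i)` is the coefficient of `h^(2j)` in `(-t² - t⁻²)^i` for `t = e^h`. -/
noncomputable def loopCoeff (j i : ℕ) : ℚ :=
  PowerSeries.coeff (2 * j) (hExpansion ℚ (loopValue ℚ ^ i))

variable {F : Type*} [TopologicalSpace F] [ChartedSpace (EuclideanHalfSpace 2) F]
  [IsManifold (𝓡∂ 2) ∞ F] [T2Space F]
  {o : SurfaceOrientation F} {b : BoundaryParametrization F}

open scoped Classical in
/-- The Kauffman bracket `⟨D⟩ ∈ 𝕜[t, t⁻¹] ℭᵃ(F)`: the sum over all Kauffman states `σ`, given by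
their sets `S` of crossings with an `∞`-marker, of
`(-t)^(ζ(σ) - ι(σ)) (-t² - t⁻²)^μ(σ) D(σ)`. -/
noncomputable def bracket (D : Diagram o b) : CurveClass b →₀ LaurentPolynomial 𝕜 :=
  ∑ S ∈ D.crossings.powerset, Finsupp.single (D.stateClass S)
    ((((-tUnit 𝕜) ^ (((D.crossings \ S).card : ℤ) - (S.card : ℤ)) :
      (LaurentPolynomial 𝕜)ˣ) : LaurentPolynomial 𝕜) * loopValue 𝕜 ^ D.mu S)

/-- The coefficient `⟨D⟩_k ∈ 𝕜 ℭᵃ(F)` of `h^k` in `⟨D⟩` for `t = e^h`. -/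
noncomputable def bracketCoeff [Algebra ℚ 𝕜] (k : ℕ) (D : Diagram o b) : CurveClass b →₀ 𝕜 :=
  (bracket 𝕜 D).mapRange (fun f => PowerSeries.coeff k (hExpansion 𝕜 f)) (by simp)

variable {𝕜}

open scoped Classical in
/-- The operator `χ_P` on the free module on real diagrams, for `P = P(z, w)` with `z = X 0` and
`w = X 1`. The sum is over all states on subsets `T` of the set of crossings, a state being
given by the subset `S` of `T` of crossings with an `∞`-marker, and the contribution of the state
is `(-1)^|T| a [D(σ)]`, where `a` is the coefficient in `P` of `z^ι(σ) w^ζ(σ)`. Thus the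
homogeneous component of `P` of degree `k` is applied to the `k`-element subsets `T`. -/
noncomputable def chi (P : MvPolynomial (Fin 2) 𝕜) :
    (Diagram o b →₀ 𝕜) →ₗ[𝕜] (Diagram o b →₀ 𝕜) :=
  Finsupp.linearCombination 𝕜 fun D : Diagram o b =>
    ∑ T ∈ D.crossings.powerset, ∑ S ∈ T.powerset,
      Finsupp.single (D.smooth T S) ((-1) ^ T.card *
        P.coeff (Finsupp.single 0 S.card + Finsupp.single 1 (T \ S).card))

/-- The projection `φ_*` from the free module on real diagrams to `𝕜 ℭᵃ(F)`:
`φ_*(D) = (-1)^|C| ∑ φ(μ(σ)) D(σ)`, the sum over all Kauffman states of `D`. -/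
noncomputable def projection (φ : ℕ → 𝕜) :
    (Diagram o b →₀ 𝕜) →ₗ[𝕜] (CurveClass b →₀ 𝕜) :=
  Finsupp.linearCombination 𝕜 fun D : Diagram o b =>
    ∑ S ∈ D.crossings.powerset, Finsupp.single (D.stateClass S)
      ((-1) ^ D.crossings.card * φ (D.mu S))

variable (𝕜 o b)

/-- The rational polynomials `P_k` expand the bracket deformation on `F`:
`⟨D⟩_k = ∑_{j ≤ k / 2} (φ_j)_* (χ(P_{k - 2j})(D))` for all `k` and all real diagrams `D`. -/
def ExpandsBracket [Algebra ℚ 𝕜] (P : ℕ → MvPolynomial (Fin 2) ℚ) : Prop :=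
  ∀ (k : ℕ) (D : Diagram o b), bracketCoeff 𝕜 k D =
    ∑ j ∈ Finset.range (k / 2 + 1), projection (fun i => algebraMap ℚ 𝕜 (loopCoeff j i))
      (chi (MvPolynomial.map (algebraMap ℚ 𝕜) (P (k - 2 * j))) (Finsupp.single D 1))

end Algebra

end KauffmanBracket

namespace KauffmanBracket

/-! ## Power series expansions -/

section Expansion

/-! For t = e^h, a Kauffman state with i markers ∞ and n markers 0 contributes (-1)^(n+i) e^((n-i)h)
(-e^(2h)-e^(-2h))^μ times its curve class. The last factor is even in h, with coefficients φ_j(μ).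
So ⟨D⟩_k is the sum over j and over all states of (-1)^|C| φ_j(μ) times the coefficient of h^(k-2j)
in e^((n-i)h) (`bracketCoeff_eq`).

Smoothing first T and then the remaining crossings is the same as smoothing all at once, so
(φ_j)_*(χ(P)(D)) is a sum over states U of D as well. For fixed U, the sets T ∩ U and T \ U run
independently over the subsets of U and of C \ U. Hence the state enters with the factor ∑
binom(i,s) binom(n,u) a_{s,u}, which is `newton P i n` (`projection_chi`). Thus (*) holds if `newton
(P k) i n` is the coefficient of h^k in e^((n-i)h). The binomial theorem, applied to e^(-h) = 1 +
(e^(-h) - 1) and e^h = 1 + (e^h - 1), shows what to take for a_{s,u}: the coefficient of h^k in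
(e^(-h)-1)^s (e^h-1)^u. This series begins with (-1)^s h^(s+u), whence the degree and the top
component; the coefficient 1/k! of w excludes homogeneity for k > 1. Exchanging z and w amounts to h
↦ -h, which gives the symmetry of these polynomials.

Part (b) follows once this sequence is known to be the only one
(`eq_bracketPolynomial_of_expandsBracket`). By induction on k, only the terms with j = 0 survive in
the difference of two expansions, and φ_0(μ) = (-2)^μ. Test diagrams are c figure eights in a disk
with arbitrary over/under information. All components of their states are inessential, and each
figure eight becomes one or two circles, with factor -2 or 4. The matrix with rows (-2, 4) and (4,
-2) is invertible, so the `newton` values of the difference vanish at all (i, n) with i + n = c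
(`eq_zero_of_sum_powerset_eq_zero`). These values determine a polynomial.

For (c), changing all crossings replaces the state U by its complement, that is, exchanges i and n.

The geometric half of the file constructs the test diagrams from the lemniscate y² = x² - x⁴, with
explicit coordinates around its crossing, inside an oriented disk found in a chart of F
(`exists_curls`, `exists_isOrientedDisk`). -/

open PowerSeries in
theorem coeff_evalNegHom {R : Type*} [CommRing R] (k : ℕ) (f : PowerSeries R) :
    coeff k (evalNegHom f) = (-1) ^ k * coeff k f := by
  simp [evalNegHom, coeff_rescale]

variable (𝕜 : Type*) [CommRing 𝕜] [Algebra ℚ 𝕜]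

/-- The power series of `e^(-h)`. -/
noncomputable def expNeg : PowerSeries 𝕜 := PowerSeries.evalNegHom (PowerSeries.exp 𝕜)

theorem exp_mul_expNeg : PowerSeries.exp 𝕜 * expNeg 𝕜 = 1 :=
  PowerSeries.exp_mul_exp_neg_eq_one

theorem evalNegHom_expNeg : PowerSeries.evalNegHom (expNeg 𝕜) = PowerSeries.exp 𝕜 := by
  ext k
  rw [expNeg, coeff_evalNegHom, coeff_evalNegHom, ← mul_assoc, ← mul_pow]
  simp

theorem map_expNeg : PowerSeries.map (algebraMap ℚ 𝕜) (expNeg ℚ) = expNeg 𝕜 := by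
  ext k
  rw [expNeg, expNeg, PowerSeries.coeff_map, coeff_evalNegHom, coeff_evalNegHom,
    PowerSeries.coeff_exp, PowerSeries.coeff_exp]
  simp

theorem hExpansion_T_natCast (n : ℕ) :
    hExpansion 𝕜 (LaurentPolynomial.T n) = PowerSeries.exp 𝕜 ^ n := by
  rw [hExpansion, LaurentPolynomial.eval₂_T_n]
  rfl

theorem hExpansion_T_neg_natCast (n : ℕ) :
    hExpansion 𝕜 (LaurentPolynomial.T (-n)) = expNeg 𝕜 ^ n := by
  have h : hExpansion 𝕜 (LaurentPolynomial.T (-n)) * PowerSeries.exp 𝕜 ^ n = 1 := by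
    rw [← hExpansion_T_natCast, ← map_mul, ← LaurentPolynomial.T_add]
    simp
  have h' : PowerSeries.exp 𝕜 ^ n * expNeg 𝕜 ^ n = 1 := by
    rw [← mul_pow, exp_mul_expNeg, one_pow]
  exact left_inv_eq_right_inv h h'

theorem hExpansion_loopValue :
    hExpansion 𝕜 (loopValue 𝕜) = -PowerSeries.exp 𝕜 ^ 2 - expNeg 𝕜 ^ 2 := by
  rw [loopValue, map_sub, map_neg, ← hExpansion_T_natCast, ← hExpansion_T_neg_natCast]
  rfl

/-- The expansions are defined over ℚ, which lets the comparison of coefficients take place in ℚ. -/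
theorem hExpansion_loopValue_pow (i : ℕ) : hExpansion 𝕜 (loopValue 𝕜 ^ i) =
    PowerSeries.map (algebraMap ℚ 𝕜) (hExpansion ℚ (loopValue ℚ ^ i)) := by
  rw [map_pow, map_pow, hExpansion_loopValue, hExpansion_loopValue, map_pow, map_sub, map_neg,
    map_pow, map_pow, map_expNeg, PowerSeries.map_exp]

theorem evalNegHom_hExpansion_loopValue_pow (i : ℕ) :
    PowerSeries.evalNegHom (hExpansion 𝕜 (loopValue 𝕜 ^ i)) = hExpansion 𝕜 (loopValue 𝕜 ^ i) := by
  rw [map_pow, map_pow, hExpansion_loopValue, map_sub, map_neg, map_pow, map_pow,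
    evalNegHom_expNeg, ← expNeg]
  congr 1
  ring

/-- The series is fixed by h ↦ -h, so an odd coefficient equals its own negative. This is why only
the indices k - 2j occur in (*). -/
theorem coeff_hExpansion_loopValue_pow_of_odd (i : ℕ) {k : ℕ} (hk : Odd k) :
    PowerSeries.coeff k (hExpansion ℚ (loopValue ℚ ^ i)) = 0 := by
  have h := coeff_evalNegHom k (hExpansion ℚ (loopValue ℚ ^ i))
  rw [evalNegHom_hExpansion_loopValue_pow, hk.neg_one_pow] at h
  linarith

theorem loopCoeff_zero (i : ℕ) : loopCoeff 0 i = (-2) ^ i := by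
  rw [loopCoeff, map_pow, hExpansion_loopValue]
  simp [expNeg, PowerSeries.evalNegHom, PowerSeries.rescale]
  norm_num

/-- For a state on all crossings the sign (-1)^(n+i) is (-1)^|C|, independent of the state; it
matches the sign in the projections. -/
theorem hExpansion_tUnit_zpow (n i : ℕ) :
    hExpansion 𝕜 (((-tUnit 𝕜) ^ ((n : ℤ) - (i : ℤ)) : (LaurentPolynomial 𝕜)ˣ) :
      LaurentPolynomial 𝕜) = (-1) ^ (n + i) * (PowerSeries.exp 𝕜 ^ n * expNeg 𝕜 ^ i) := by
  have h1 : (hExpansion 𝕜 (((-tUnit 𝕜) ^ ((n : ℤ) - (i : ℤ)) : (LaurentPolynomial 𝕜)ˣ) :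
      LaurentPolynomial 𝕜)) * (-PowerSeries.exp 𝕜) ^ i = (-PowerSeries.exp 𝕜) ^ n := by
    have ht : -PowerSeries.exp 𝕜 = hExpansion 𝕜 ((-tUnit 𝕜 : (LaurentPolynomial 𝕜)ˣ) :
        LaurentPolynomial 𝕜) := by
      rw [Units.val_neg, map_neg, neg_inj, ← pow_one (PowerSeries.exp 𝕜),
        ← hExpansion_T_natCast]
      rfl
    rw [ht, ← map_pow, ← map_pow, ← map_mul, ← Units.val_pow_eq_pow_val,
      ← Units.val_pow_eq_pow_val, ← Units.val_mul, ← zpow_natCast, ← zpow_add, sub_add_cancel,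
      zpow_natCast]
  have h2 : (-PowerSeries.exp 𝕜) ^ i * (-expNeg 𝕜) ^ i = 1 := by
    rw [← mul_pow, neg_mul_neg, exp_mul_expNeg, one_pow]
  calc _ = _ * ((-PowerSeries.exp 𝕜) ^ i * (-expNeg 𝕜) ^ i) := by rw [h2, mul_one]
    _ = _ := by
      rw [← mul_assoc, h1, neg_pow, neg_pow (expNeg 𝕜)]
      ring

/-- The coefficient of `h^k` in `e^((n - i) h)`. -/
noncomputable def expCoeff (k i n : ℕ) : ℚ :=
  PowerSeries.coeff k (PowerSeries.exp ℚ ^ n * expNeg ℚ ^ i)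

/-- The substitution h ↦ -h exchanges the two exponentials. Both (b) and (c) come down to this. -/
theorem expCoeff_swap (k i n : ℕ) : expCoeff k n i = (-1) ^ k * expCoeff k i n := by
  have h : PowerSeries.evalNegHom (PowerSeries.exp ℚ ^ n * expNeg ℚ ^ i) =
      PowerSeries.exp ℚ ^ i * expNeg ℚ ^ n := by
    rw [map_mul, map_pow, map_pow, evalNegHom_expNeg, ← expNeg, mul_comm]
  rw [expCoeff, expCoeff, ← coeff_evalNegHom, h]

theorem sum_antidiagonal_of_odd_eq_zero {M : Type*} [AddCommMonoid M] (k : ℕ) (f : ℕ → ℕ → M)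
    (hf : ∀ a b, Odd b → f a b = 0) : ∑ p ∈ Finset.HasAntidiagonal.antidiagonal k, f p.1 p.2 =
      ∑ j ∈ Finset.range (k / 2 + 1), f (k - 2 * j) (2 * j) := by
  symm
  refine Finset.sum_bij_ne_zero (fun j _ _ => (k - 2 * j, 2 * j)) ?_ ?_ ?_ ?_
  · intro j hj _
    rw [Finset.mem_range] at hj
    rw [Finset.HasAntidiagonal.mem_antidiagonal]
    dsimp only
    omega
  · intro j _ _ j' _ _ h
    simpa using (Prod.ext_iff.1 h).2
  · rintro ⟨a, c⟩ hp h0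
    rw [Finset.HasAntidiagonal.mem_antidiagonal] at hp
    rcases Nat.even_or_odd' c with ⟨j, rfl | rfl⟩
    · have : k - 2 * j = a := by simp at hp; omega
      refine ⟨j, Finset.mem_range.2 (by simp at hp; omega), ?_, ?_⟩
      · rwa [this]
      · rw [this]
    · exact (h0 (hf _ _ ⟨j, rfl⟩)).elim
  · intro j _ _
    rfl

theorem coeff_hExpansion_state (k n i m : ℕ) :
    PowerSeries.coeff k (hExpansion 𝕜 ((((-tUnit 𝕜) ^ ((n : ℤ) - (i : ℤ)) :
      (LaurentPolynomial 𝕜)ˣ) : LaurentPolynomial 𝕜) * loopValue 𝕜 ^ m)) =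
    ∑ j ∈ Finset.range (k / 2 + 1), (-1) ^ (n + i) *
      (algebraMap ℚ 𝕜 (loopCoeff j m) * algebraMap ℚ 𝕜 (expCoeff (k - 2 * j) i n)) := by
  have hexp : PowerSeries.exp 𝕜 ^ n * expNeg 𝕜 ^ i =
      PowerSeries.map (algebraMap ℚ 𝕜) (PowerSeries.exp ℚ ^ n * expNeg ℚ ^ i) := by
    rw [map_mul, map_pow, map_pow, map_expNeg, PowerSeries.map_exp]
  have hsign : ((-1) ^ (n + i) : PowerSeries 𝕜) = PowerSeries.C ((-1) ^ (n + i)) := by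
    simp
  rw [map_mul, hExpansion_tUnit_zpow, hExpansion_loopValue_pow, hexp, mul_assoc, ← map_mul, hsign,
    PowerSeries.coeff_C_mul, PowerSeries.coeff_map, PowerSeries.coeff_mul,
    sum_antidiagonal_of_odd_eq_zero k
      (fun a c => PowerSeries.coeff a (PowerSeries.exp ℚ ^ n * expNeg ℚ ^ i) *
        PowerSeries.coeff c (hExpansion ℚ (loopValue ℚ ^ m))), map_sum, Finset.mul_sum]
  · refine Finset.sum_congr rfl fun j _ => ?_
    rw [← map_mul, mul_comm (loopCoeff j m)]
    rfl
  · intro a c hc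
    rw [coeff_hExpansion_loopValue_pow_of_odd m hc, mul_zero]

end Expansion

/-! ## Polynomials in two variables in the binomial basis -/

section Newton

variable {R : Type*} [CommRing R]

/-- The exponent of the monomial `z^s w^u`. -/
noncomputable def bidegree (s u : ℕ) : Fin 2 →₀ ℕ := Finsupp.single 0 s + Finsupp.single 1 u

@[simp] theorem bidegree_zero (s u : ℕ) : bidegree s u 0 = s := by simp [bidegree]

@[simp] theorem bidegree_one (s u : ℕ) : bidegree s u 1 = u := by simp [bidegree]

theorem bidegree_eta (d : Fin 2 →₀ ℕ) : bidegree (d 0) (d 1) = d := by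
  ext i
  fin_cases i <;> simp

theorem bidegree_inj {s u s' u' : ℕ} : bidegree s u = bidegree s' u' ↔ s = s' ∧ u = u' := by
  constructor
  · intro h
    exact ⟨by simpa using DFunLike.congr_fun h 0, by simpa using DFunLike.congr_fun h 1⟩
  · rintro ⟨rfl, rfl⟩
    rfl

theorem degree_bidegree (s u : ℕ) : (bidegree s u).degree = s + u := by
  simp [bidegree]

/-- The value at `(i, n)` of the polynomial function that has the coefficients of `P` in the
basis of the products of binomial coefficients. -/
noncomputable def newton (P : MvPolynomial (Fin 2) R) (i n : ℕ) : R :=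
  ∑ s ∈ Finset.range (i + 1), ∑ u ∈ Finset.range (n + 1),
    (i.choose s : R) * (n.choose u : R) * P.coeff (bidegree s u)

theorem newton_map {R' : Type*} [CommRing R'] (f : R →+* R') (P : MvPolynomial (Fin 2) R)
    (i n : ℕ) : newton (MvPolynomial.map f P) i n = f (newton P i n) := by
  simp [newton, MvPolynomial.coeff_map]

/-- The system is unitriangular: the value at (s, u) is the coefficient at (s, u) plus multiples of
coefficients of smaller total degree. No division is needed, so any commutative ring will do. -/
theorem eq_zero_of_newton_eq_zero {P : MvPolynomial (Fin 2) R} (h : ∀ i n, newton P i n = 0) :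
    P = 0 := by
  have key : ∀ N s u, s + u = N → P.coeff (bidegree s u) = 0 := by
    intro N
    induction N using Nat.strong_induction_on with
    | _ N ih =>
      intro s u hsu
      have hs := h s u
      rw [newton, Finset.sum_eq_single s, Finset.sum_eq_single u] at hs
      · simpa using hs
      · intro u' hu' hne
        rw [Finset.mem_range] at hu'
        rw [ih (s + u') (by omega) s u' rfl, mul_zero]
      · intro hu
        simp at hu
      · intro s' hs' hne
        refine Finset.sum_eq_zero fun u' hu' => ?_
        rw [Finset.mem_range] at hs' hu'
        rw [ih (s' + u') (by omega) s' u' rfl, mul_zero]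
      · intro hs
        simp at hs
  ext d
  rw [← bidegree_eta d, key _ _ _ rfl, MvPolynomial.coeff_zero]

theorem newton_sub (P Q : MvPolynomial (Fin 2) R) (i n : ℕ) :
    newton (P - Q) i n = newton P i n - newton Q i n := by
  simp [newton, mul_sub]

theorem eq_of_newton_eq {P Q : MvPolynomial (Fin 2) R} (h : ∀ i n, newton P i n = newton Q i n) :
    P = Q :=
  sub_eq_zero.1 (eq_zero_of_newton_eq_zero fun i n => by rw [newton_sub, h, sub_self])

theorem coeff_rename_swap (P : MvPolynomial (Fin 2) R) (s u : ℕ) :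
    (MvPolynomial.rename (Equiv.swap 0 1) P).coeff (bidegree s u) = P.coeff (bidegree u s) := by
  have : bidegree s u = (bidegree u s).mapDomain (Equiv.swap (0 : Fin 2) 1) := by
    simp [bidegree, Finsupp.mapDomain_add, Finsupp.mapDomain_single, add_comm]
  rw [this, MvPolynomial.coeff_rename_mapDomain _ (Equiv.injective _)]

theorem newton_rename_swap (P : MvPolynomial (Fin 2) R) (i n : ℕ) :
    newton (MvPolynomial.rename (Equiv.swap 0 1) P) i n = newton P n i := by
  simp only [newton, coeff_rename_swap]
  rw [Finset.sum_comm]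
  refine Finset.sum_congr rfl fun s _ => Finset.sum_congr rfl fun u _ => ?_
  ring

/-- The summand depends only on cardinalities, so the binomial coefficients count the equal terms.
-/
theorem sum_sum_powerset_card {α : Type*} (A B : Finset α) (P : MvPolynomial (Fin 2) R) :
    ∑ S ∈ A.powerset, ∑ S' ∈ B.powerset, P.coeff (bidegree S.card S'.card) =
      newton P A.card B.card := by
  rw [newton, Finset.sum_powerset_apply_card
    (fun s => ∑ S' ∈ B.powerset, P.coeff (bidegree s S'.card))]
  refine Finset.sum_congr rfl fun s _ => ?_
  rw [Finset.sum_powerset_apply_card (fun u => P.coeff (bidegree s u)), Finset.smul_sum]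
  refine Finset.sum_congr rfl fun u _ => ?_
  rw [nsmul_eq_mul, nsmul_eq_mul, mul_assoc]

end Newton

/-! ## The polynomials that expand the bracket -/

section BracketPolynomial

open PowerSeries (X coeff)

/-- The coefficient of `h^k` in `(e^(-h) - 1)^s (e^h - 1)^u`. -/
noncomputable def bracketPolynomialCoeff (k s u : ℕ) : ℚ :=
  coeff k ((expNeg ℚ - 1) ^ s * (PowerSeries.exp ℚ - 1) ^ u)

theorem exists_expNeg_sub_one : ∃ f : PowerSeries ℚ, expNeg ℚ - 1 = X * f ∧
    PowerSeries.constantCoeff f = -1 := by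
  obtain ⟨f, hf⟩ := PowerSeries.X_dvd_iff.2
    (show PowerSeries.constantCoeff (expNeg ℚ - 1) = 0 by
      rw [map_sub, ← PowerSeries.coeff_zero_eq_constantCoeff_apply, expNeg, coeff_evalNegHom]
      simp)
  refine ⟨f, hf, ?_⟩
  have h := congrArg (coeff 1) hf
  rw [expNeg, map_sub, coeff_evalNegHom, PowerSeries.coeff_exp, ← zero_add 1,
    PowerSeries.coeff_succ_X_mul] at h
  rw [← PowerSeries.coeff_zero_eq_constantCoeff_apply, ← h]
  simp [PowerSeries.coeff_one]

theorem exists_exp_sub_one : ∃ f : PowerSeries ℚ, PowerSeries.exp ℚ - 1 = X * f ∧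
    PowerSeries.constantCoeff f = 1 := by
  obtain ⟨f, hf⟩ := PowerSeries.X_dvd_iff.2
    (show PowerSeries.constantCoeff (PowerSeries.exp ℚ - 1) = 0 by simp)
  refine ⟨f, hf, ?_⟩
  have h := congrArg (coeff 1) hf
  rw [map_sub, PowerSeries.coeff_exp, ← zero_add 1, PowerSeries.coeff_succ_X_mul] at h
  rw [← PowerSeries.coeff_zero_eq_constantCoeff_apply, ← h]
  simp [PowerSeries.coeff_one]

/-- Both factors vanish to first order at h = 0, with leading coefficients -1 and 1. -/
theorem exists_bracketPolynomialCoeff_eq (s u : ℕ) : ∃ f : PowerSeries ℚ,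
    (expNeg ℚ - 1) ^ s * (PowerSeries.exp ℚ - 1) ^ u = X ^ (s + u) * f ∧
      PowerSeries.constantCoeff f = (-1) ^ s := by
  obtain ⟨f, hf, hf1⟩ := exists_expNeg_sub_one
  obtain ⟨g, hg, hg1⟩ := exists_exp_sub_one
  refine ⟨f ^ s * g ^ u, ?_, by simp [hf1, hg1]⟩
  rw [hf, hg]
  ring

theorem bracketPolynomialCoeff_of_lt {k s u : ℕ} (h : k < s + u) :
    bracketPolynomialCoeff k s u = 0 := by
  obtain ⟨f, hf, -⟩ := exists_bracketPolynomialCoeff_eq s u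
  rw [bracketPolynomialCoeff, hf, PowerSeries.coeff_X_pow_mul', if_neg (by omega)]

theorem bracketPolynomialCoeff_of_eq {k s u : ℕ} (h : s + u = k) :
    bracketPolynomialCoeff k s u = (-1) ^ s := by
  obtain ⟨f, hf, hf1⟩ := exists_bracketPolynomialCoeff_eq s u
  rw [bracketPolynomialCoeff, hf, h, PowerSeries.coeff_X_pow_mul', if_pos le_rfl, Nat.sub_self,
    PowerSeries.coeff_zero_eq_constantCoeff_apply, hf1]

/-- The coefficient of w is 1/k!: subtracting 1 from e^h only affects the constant term. -/
theorem bracketPolynomialCoeff_zero_one {k : ℕ} (hk : 1 < k) :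
    bracketPolynomialCoeff k 0 1 ≠ 0 := by
  rw [bracketPolynomialCoeff, pow_zero, one_mul, pow_one, map_sub, PowerSeries.coeff_exp,
    PowerSeries.coeff_one, if_neg (by omega), sub_zero]
  simp [Nat.factorial_ne_zero]

/-- The canonical polynomials that expand the bracket. -/
noncomputable def bracketPolynomial (k : ℕ) : MvPolynomial (Fin 2) ℚ :=
  ∑ s ∈ Finset.range (k + 1), ∑ u ∈ Finset.range (k + 1),
    MvPolynomial.monomial (bidegree s u) (bracketPolynomialCoeff k s u)

/-- No bound on s and u is needed: the square of exponents in the definition contains the triangle s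
+ u ≤ k, and beyond the triangle the series has order greater than k. -/
theorem coeff_bracketPolynomial (k s u : ℕ) :
    (bracketPolynomial k).coeff (bidegree s u) = bracketPolynomialCoeff k s u := by
  simp only [bracketPolynomial, MvPolynomial.coeff_sum, MvPolynomial.coeff_monomial, bidegree_inj]
  by_cases h : s + u ≤ k
  · rw [Finset.sum_eq_single s, Finset.sum_eq_single u]
    · simp
    · intro u' _ hu'
      rw [if_neg (by tauto)]
    · intro hu
      simp at hu
      omega
    · intro s' _ hs'
      exact Finset.sum_eq_zero fun u' _ => if_neg (by tauto)
    · intro hs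
      simp at hs
      omega
  · rw [bracketPolynomialCoeff_of_lt (by omega)]
    refine Finset.sum_eq_zero fun s' _ => Finset.sum_eq_zero fun u' _ => ?_
    split_ifs with h'
    · rw [h'.1, h'.2, bracketPolynomialCoeff_of_lt (by omega)]
    · rfl

/-- Binomial expansion of e^(-ih) and e^(nh) around 1. This identity is the source of the definition
of the polynomials. -/
theorem newton_bracketPolynomial (k i n : ℕ) :
    newton (bracketPolynomial k) i n = expCoeff k i n := by
  have h1 : expNeg ℚ ^ i = ∑ s ∈ Finset.range (i + 1), (i.choose s : ℚ) • (expNeg ℚ - 1) ^ s := by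
    conv_lhs => rw [← sub_add_cancel (expNeg ℚ) 1, add_pow]
    refine Finset.sum_congr rfl fun s _ => ?_
    rw [one_pow, mul_one, mul_comm, ← nsmul_eq_mul, Nat.cast_smul_eq_nsmul]
  have h2 : PowerSeries.exp ℚ ^ n =
      ∑ u ∈ Finset.range (n + 1), (n.choose u : ℚ) • (PowerSeries.exp ℚ - 1) ^ u := by
    conv_lhs => rw [← sub_add_cancel (PowerSeries.exp ℚ) 1, add_pow]
    refine Finset.sum_congr rfl fun s _ => ?_
    rw [one_pow, mul_one, mul_comm, ← nsmul_eq_mul, Nat.cast_smul_eq_nsmul]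
  rw [expCoeff, mul_comm, h1, h2, Finset.sum_mul_sum, map_sum, newton]
  refine Finset.sum_congr rfl fun s _ => ?_
  rw [map_sum]
  refine Finset.sum_congr rfl fun u _ => ?_
  rw [coeff_bracketPolynomial, smul_mul_smul_comm, PowerSeries.coeff_smul]
  rfl

/-- Compared through `newton`, where the exchange of variables becomes the exchange of i and n. -/
theorem rename_swap_bracketPolynomial (k : ℕ) :
    MvPolynomial.rename (Equiv.swap 0 1) (bracketPolynomial k) =
      (-1 : ℚ) ^ k • bracketPolynomial k := by
  refine eq_of_newton_eq fun i n => ?_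
  have : newton ((-1 : ℚ) ^ k • bracketPolynomial k) i n =
      (-1) ^ k * newton (bracketPolynomial k) i n := by
    simp only [newton, Finset.mul_sum, MvPolynomial.coeff_smul, smul_eq_mul]
    refine Finset.sum_congr rfl fun s _ => Finset.sum_congr rfl fun u _ => ?_
    ring
  rw [this, newton_rename_swap, newton_bracketPolynomial, newton_bracketPolynomial, expCoeff_swap]

theorem totalDegree_bracketPolynomial (k : ℕ) : (bracketPolynomial k).totalDegree = k := by
  apply le_antisymm
  · rw [MvPolynomial.totalDegree, Finset.sup_le_iff]
    intro d hd
    rw [MvPolynomial.mem_support_iff, ← bidegree_eta d, coeff_bracketPolynomial] at hd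
    by_contra h
    refine hd (bracketPolynomialCoeff_of_lt ?_)
    rw [Finsupp.sum_fintype _ _ fun _ => rfl, Fin.sum_univ_two] at h
    omega
  -- The monomial w^k has coefficient (-1)^0 = 1.
  · have : bidegree 0 k ∈ (bracketPolynomial k).support := by
      rw [MvPolynomial.mem_support_iff, coeff_bracketPolynomial,
        bracketPolynomialCoeff_of_eq (by omega)]
      simp
    have h := MvPolynomial.le_totalDegree this
    rw [Finsupp.sum_fintype _ _ fun _ => rfl, Fin.sum_univ_two] at h
    simpa using h

theorem not_isHomogeneous_bracketPolynomial {k : ℕ} (hk : 1 < k) :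
    ¬ ∃ n, (bracketPolynomial k).IsHomogeneous n := by
  rintro ⟨n, hn⟩
  -- Both w and w^k occur, and their degrees differ.
  have h1 := hn (d := bidegree 0 1) (by
    rw [coeff_bracketPolynomial]
    exact bracketPolynomialCoeff_zero_one hk)
  have h2 := hn (d := bidegree 0 k) (by
    rw [coeff_bracketPolynomial, bracketPolynomialCoeff_of_eq (by omega)]
    simp)
  simp only [Finsupp.weight_apply, Finsupp.sum_fintype, Fin.sum_univ_two, implies_true,
    bidegree_zero, bidegree_one, Pi.one_apply, smul_eq_mul, mul_one] at h1 h2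
  omega

theorem homogeneousComponent_bracketPolynomial (k : ℕ) :
    MvPolynomial.homogeneousComponent k (bracketPolynomial k) =
      ∑ i ∈ Finset.range (k + 1),
        (-1) ^ i * MvPolynomial.X 0 ^ i * MvPolynomial.X 1 ^ (k - i) := by
  have hmon : ∀ i, ((-1) ^ i * MvPolynomial.X 0 ^ i * MvPolynomial.X 1 ^ (k - i) :
      MvPolynomial (Fin 2) ℚ) = MvPolynomial.monomial (bidegree i (k - i)) ((-1) ^ i) := by
    intro i
    rw [bidegree, MvPolynomial.X_pow_eq_monomial, MvPolynomial.X_pow_eq_monomial, mul_assoc,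
      MvPolynomial.monomial_mul, show ((-1) ^ i : MvPolynomial (Fin 2) ℚ) =
        MvPolynomial.C ((-1) ^ i) by simp, MvPolynomial.C_mul_monomial]
    simp
  simp only [hmon]
  ext d
  rw [← bidegree_eta d]
  generalize d 0 = s
  generalize d 1 = u
  simp only [MvPolynomial.coeff_homogeneousComponent, degree_bidegree, MvPolynomial.coeff_sum,
    MvPolynomial.coeff_monomial, bidegree_inj, coeff_bracketPolynomial]
  split_ifs with h
  · rw [bracketPolynomialCoeff_of_eq h, Finset.sum_eq_single s]
    · rw [if_pos ⟨rfl, by omega⟩]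
    · intro i _ hi
      rw [if_neg (by tauto)]
    · intro hs
      simp at hs
      omega
  · refine (Finset.sum_eq_zero fun i hi => if_neg ?_).symm
    rw [Finset.mem_range] at hi
    omega

end BracketPolynomial

/-! ## Sums over Kauffman states -/

section States

theorem resolution_not (o m : Bool) : resolution (!o) m = resolution o (!m) := by
  cases o <;> cases m <;> rfl

-- A state S on T together with a state S' on C \ T is the same as the single state U = S ∪ S' on C.
-- It is applied both to iterated smoothings and, with U in the role of T, to count the sets T.
open scoped Classical in
theorem sum_powerset_powerset_sdiff {α M : Type*} [AddCommMonoid M] {C T : Finset α}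
    (hT : T ⊆ C) (f : Finset α → Finset α → M) :
    ∑ S ∈ T.powerset, ∑ S' ∈ (C \ T).powerset, f S S' =
      ∑ U ∈ C.powerset, f (T ∩ U) (U \ T) := by
  rw [← Finset.sum_product']
  refine Finset.sum_bij' (fun p _ => p.1 ∪ p.2) (fun U _ => (T ∩ U, U \ T)) ?_ ?_ ?_ ?_ ?_
  · rintro ⟨S, S'⟩ h
    simp only [Finset.mem_product, Finset.mem_powerset] at h ⊢
    exact Finset.union_subset (h.1.trans hT) (h.2.trans Finset.sdiff_subset)
  · intro U hU
    simp only [Finset.mem_product, Finset.mem_powerset] at hU ⊢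
    exact ⟨Finset.inter_subset_left, Finset.sdiff_subset_sdiff hU subset_rfl⟩
  · rintro ⟨S, S'⟩ h
    simp only [Finset.mem_product, Finset.mem_powerset] at h
    ext x
    · have h1 := @h.1 x
      have h2 := @h.2 x
      simp only [Finset.mem_inter, Finset.mem_union, Finset.mem_sdiff] at *
      tauto
    · have h1 := @h.1 x
      have h2 := @h.2 x
      simp only [Finset.mem_union, Finset.mem_sdiff] at *
      tauto
  · intro U hU
    ext x
    simp only [Finset.mem_inter, Finset.mem_union, Finset.mem_sdiff]
    tauto
  · rintro ⟨S, S'⟩ h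
    simp only [Finset.mem_product, Finset.mem_powerset] at h
    congr 1
    · ext x
      have h1 := @h.1 x
      have h2 := @h.2 x
      simp only [Finset.mem_inter, Finset.mem_union, Finset.mem_sdiff] at *
      tauto
    · ext x
      have h1 := @h.1 x
      have h2 := @h.2 x
      simp only [Finset.mem_union, Finset.mem_sdiff] at *
      tauto

theorem powerset_map {α β : Type*} (f : α ↪ β) (C : Finset α) :
    (C.map f).powerset = C.powerset.map (Finset.mapEmbedding f).toEmbedding := by
  ext S
  simp only [Finset.mem_powerset, Finset.subset_map_iff, Finset.mem_map]
  exact exists_congr fun T => and_congr_right fun _ => eq_comm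

variable {F : Type*} [TopologicalSpace F] [ChartedSpace (EuclideanHalfSpace 2) F]
  [IsManifold (𝓡∂ 2) ∞ F] [T2Space F]
  {o : SurfaceOrientation F} {b : BoundaryParametrization F}

namespace Diagram

/-- Only the essential parts have to agree. The figure eights need this generality: their state
curves differ but all have empty essential part. -/
theorem stateClass_congr {D D' : Diagram o b} {S S' : Finset F}
    (h : essentialPart (D.stateCurve S).carrier = essentialPart (D'.stateCurve S').carrier) :
    D.stateClass S = D'.stateClass S' := by
  apply Quotient.sound
  show Isotopic (essentialPart _) (essentialPart _)
  rw [h]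
  exact Isotopic.refl _

open scoped Classical in
theorem mem_stateCurve_iff (D : Diagram o b) (S : Finset F) {p q : F} (hp : p ∈ D.crossings)
    (hq : q ∈ (D.disk p).target) : q ∈ (D.stateCurve S).carrier ↔
      (D.disk p).symm q ∈ resolution (D.ovr p) (decide (p ∈ S)) :=
  D.mem_smoothCarrier_of_mem_target D.crossings S hp hp hq

theorem mem_stateCurve_iff_of_notMem (D : Diagram o b) (S : Finset F) {q : F}
    (hq : ∀ p ∈ D.crossings, q ∉ (D.disk p).target) :
    q ∈ (D.stateCurve S).carrier ↔ q ∈ D.carrier :=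
  D.mem_smoothCarrier_of_notMem D.crossings S fun p hp _ hb =>
    hq p hp (D.mem_target_of_mem_box hp hb)

-- A partial smoothing keeps the disks and the over/under data, and the disks are disjoint. So
-- smoothing in two stages gives the same set, not merely an isotopic one.
open scoped Classical in
theorem carrier_stateCurve_smooth (D : Diagram o b) (T U : Finset F) :
    ((D.smooth T (T ∩ U)).stateCurve (U \ T)).carrier =
      (D.stateCurve U).carrier := by
  ext q
  by_cases h : ∃ p ∈ D.crossings, q ∈ (D.disk p).target
  · obtain ⟨p, hp, hq⟩ := h
    rw [D.mem_stateCurve_iff U hp hq]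
    by_cases hpT : p ∈ T
    · rw [mem_stateCurve_iff_of_notMem]
      · have := D.mem_smoothCarrier_of_mem_target T (T ∩ U) hp hpT hq
        simp only [Finset.mem_inter, hpT, true_and] at this
        exact this
      · intro p' hp' hq'
        have hp'' := Finset.mem_sdiff.1 hp'
        exact hp''.2 (D.eq_of_mem_target hp hp''.1 hq hq' ▸ hpT)
    · rw [mem_stateCurve_iff (D.smooth T (T ∩ U)) (U \ T) (p := p)
        (Finset.mem_sdiff.2 ⟨hp, hpT⟩) hq]
      simp only [Finset.mem_sdiff, hpT, not_false_eq_true, and_true]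
      rfl
  · push Not at h
    rw [D.mem_stateCurve_iff_of_notMem U h, mem_stateCurve_iff_of_notMem]
    · exact D.mem_smoothCarrier_of_notMem T _ fun p hp _ hb =>
        h p hp (D.mem_target_of_mem_box hp hb)
    · exact fun p hp => h p (Finset.mem_sdiff.1 hp).1

-- Exchanging over and under at a crossing exchanges its two resolutions, hence the two markers.
open scoped Classical in
theorem carrier_stateCurve_crossingChange (D : Diagram o b) (S : Finset F) :
    (D.crossingChange.stateCurve S).carrier = (D.stateCurve (D.crossings \ S)).carrier := by
  ext q
  by_cases h : ∃ p ∈ D.crossings, q ∈ (D.disk p).target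
  · obtain ⟨p, hp, hq⟩ := h
    rw [D.mem_stateCurve_iff _ hp hq, D.crossingChange.mem_stateCurve_iff (p := p) S hp hq]
    have : decide (p ∈ D.crossings \ S) = !decide (p ∈ S) := by
      simp [hp]
    rw [this, ← resolution_not]
    rfl
  · push Not at h
    rw [D.mem_stateCurve_iff_of_notMem _ h, mem_stateCurve_iff_of_notMem]
    · rfl
    · exact h

end Diagram

variable {𝕜 : Type*} [CommRing 𝕜]

-- The double sum of partial smoothings followed by completions collapses to a sum over the states
-- of D, because the completed smoothing depends only on the combined state U. What remains is to
-- sum the coefficients of P over T.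
open scoped Classical in
theorem projection_chi (P : MvPolynomial (Fin 2) 𝕜) (φ : ℕ → 𝕜) (D : Diagram o b) :
    projection φ (chi P (Finsupp.single D 1)) =
      ∑ U ∈ D.crossings.powerset, Finsupp.single (D.stateClass U)
        ((-1) ^ D.crossings.card * (φ (D.mu U) * newton P U.card (D.crossings \ U).card)) := by
  have h1 : ∀ T ∈ D.crossings.powerset, ∑ S ∈ T.powerset, projection φ
      (Finsupp.single (D.smooth T S) ((-1) ^ T.card * P.coeff (bidegree S.card (T \ S).card))) =
      ∑ U ∈ D.crossings.powerset, Finsupp.single (D.stateClass U)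
        ((-1) ^ D.crossings.card * (φ (D.mu U) *
          P.coeff (bidegree (U ∩ T).card (T \ U).card))) := by
    intro T hT
    rw [Finset.mem_powerset] at hT
    have h2 : ∀ S, projection φ (Finsupp.single (D.smooth T S)
        ((-1) ^ T.card * P.coeff (bidegree S.card (T \ S).card))) =
        ∑ S' ∈ (D.crossings \ T).powerset, Finsupp.single ((D.smooth T S).stateClass S')
          ((-1) ^ D.crossings.card * (φ ((D.smooth T S).mu S') *
            P.coeff (bidegree S.card (T \ S).card))) := by
      intro S
      rw [projection, Finsupp.linearCombination_single, Finset.smul_sum]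
      refine Finset.sum_congr rfl fun S' _ => ?_
      -- The signs (-1)^|T| of `chi` and (-1)^|C \ T| of the projection combine to (-1)^|C|.
      rw [Finsupp.smul_single, smul_eq_mul, ← Finset.card_sdiff_add_card_eq_card hT, pow_add]
      congr 1
      have : (D.smooth T S).crossings = D.crossings \ T := rfl
      rw [this]
      ring
    rw [Finset.sum_congr rfl fun S _ => h2 S, sum_powerset_powerset_sdiff hT]
    refine Finset.sum_congr rfl fun U _ => ?_
    have hc := D.carrier_stateCurve_smooth T U
    rw [Diagram.stateClass_congr (D' := D) (S' := U) (by rw [hc]), Diagram.mu, hc,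
      Finset.sdiff_inter_self_left, Finset.inter_comm]
    rfl
  have h3 : projection φ (chi P (Finsupp.single D 1)) = ∑ T ∈ D.crossings.powerset,
      ∑ S ∈ T.powerset, projection φ (Finsupp.single (D.smooth T S)
        ((-1) ^ T.card * P.coeff (bidegree S.card (T \ S).card))) := by
    rw [chi, Finsupp.linearCombination_single, one_smul, map_sum]
    refine Finset.sum_congr rfl fun T _ => ?_
    rw [map_sum]
    rfl
  -- With U fixed, T is cut into U ∩ T and T \ U, which vary independently.
  rw [h3, Finset.sum_congr rfl h1, Finset.sum_comm]
  refine Finset.sum_congr rfl fun U hU => ?_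
  rw [← sum_sum_powerset_card U (D.crossings \ U) P,
    sum_powerset_powerset_sdiff (Finset.mem_powerset.1 hU)
      (fun S S' => P.coeff (bidegree S.card S'.card)), Finset.mul_sum, Finset.mul_sum,
    ← Finsupp.singleAddHom_apply, map_sum]
  rfl

variable [Algebra ℚ 𝕜]

-- This brings the bracket into the shape of `projection_chi`, so that (*) can be checked state by
-- state, with `expCoeff` in the place of `newton`.
open scoped Classical in
theorem bracketCoeff_eq (k : ℕ) (D : Diagram o b) : bracketCoeff 𝕜 k D =
    ∑ j ∈ Finset.range (k / 2 + 1), ∑ U ∈ D.crossings.powerset, Finsupp.single (D.stateClass U)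
      ((-1) ^ D.crossings.card * (algebraMap ℚ 𝕜 (loopCoeff j (D.mu U)) *
        algebraMap ℚ 𝕜 (expCoeff (k - 2 * j) U.card (D.crossings \ U).card))) := by
  rw [Finset.sum_comm]
  ext q
  rw [bracketCoeff, Finsupp.mapRange_apply, bracket, Finsupp.finsetSum_apply,
    Finsupp.finsetSum_apply, map_sum, map_sum]
  refine Finset.sum_congr rfl fun U hU => ?_
  rw [Finsupp.finsetSum_apply]
  simp only [Finsupp.single_apply]
  split_ifs
  · rw [coeff_hExpansion_state, Finset.card_sdiff_add_card_eq_card (Finset.mem_powerset.1 hU)]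
  · simp

variable (𝕜 o b) in
theorem expandsBracket_bracketPolynomial : ExpandsBracket 𝕜 o b bracketPolynomial := by
  classical
  intro k D
  rw [bracketCoeff_eq]
  refine Finset.sum_congr rfl fun j _ => ?_
  rw [projection_chi]
  refine Finset.sum_congr rfl fun U _ => ?_
  rw [newton_map, newton_bracketPolynomial]

theorem bracketCoeff_crossingChange (k : ℕ) (D : Diagram o b) :
    bracketCoeff 𝕜 k D.crossingChange = (-1 : 𝕜) ^ k • bracketCoeff 𝕜 k D := by
  classical
  rw [bracketCoeff_eq, bracketCoeff_eq, Finset.smul_sum]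
  refine Finset.sum_congr rfl fun j hj => ?_
  rw [Finset.smul_sum]
  have hcr : D.crossingChange.crossings = D.crossings := rfl
  -- The state U of the changed diagram has the same curve as the complementary state of D.
  refine Finset.sum_bij' (fun U _ => D.crossings \ U) (fun U _ => D.crossings \ U) ?_ ?_ ?_ ?_ ?_
  · simp
  · simp [hcr]
  · intro U hU
    exact Finset.sdiff_sdiff_eq_self (Finset.mem_powerset.1 hU)
  · intro U hU
    exact Finset.sdiff_sdiff_eq_self (Finset.mem_powerset.1 hU)
  · intro U hU
    have hc := D.carrier_stateCurve_crossingChange U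
    rw [Diagram.stateClass_congr (D' := D) (S' := D.crossings \ U) (by rw [hc]), hcr,
      Diagram.mu, hc, Finset.sdiff_sdiff_eq_self (s := D.crossings) (Finset.mem_powerset.1 hU),
      expCoeff_swap _ _ (D.crossings \ U).card, Finsupp.smul_single, smul_eq_mul, map_mul,
      ← Diagram.mu]
    congr 1
    -- The sign does not depend on j, because the loop factor only contributes even powers of h.
    have hk : ((-1 : ℚ) ^ (k - 2 * j)) = (-1) ^ k := by
      rw [Finset.mem_range] at hj
      rw [← Nat.sub_add_cancel (show 2 * j ≤ k by omega), pow_add _ _ (2 * j), pow_mul]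
      simp
    rw [hk, map_pow, map_neg, map_one]
    have h1 : ((-1 : 𝕜) ^ k * (-1) ^ k) = 1 := by
      rw [← mul_pow]
      simp
    linear_combination (-(-1) ^ D.crossings.card *
      (algebraMap ℚ 𝕜 (loopCoeff j (D.mu (D.crossings \ U))) *
        algebraMap ℚ 𝕜 (expCoeff (k - 2 * j) U.card (D.crossings \ U).card))) * h1

/-- The weights form a tensor power of the matrix with rows (-2, 4) and (4, -2), whose determinant
is -12. Induction on C inverts one tensor factor at a time. -/
theorem eq_zero_of_sum_powerset_eq_zero (C : Finset ℕ) (f : ℕ → ℚ)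
    (h : ∀ ε : ℕ → Bool, ∑ S ∈ C.powerset,
      (∏ i ∈ C, if ε i = decide (i ∈ S) then -2 else 4) * f S.card = 0) :
    ∀ i ≤ C.card, f i = 0 := by
  induction C using Finset.induction_on generalizing f with
  | empty =>
    intro i hi
    simpa [Nat.le_zero.1 hi] using h fun _ => true
  | insert a C ha ih =>
    -- Fixing ε a = e and summing over whether a belongs to S leaves a sum over subsets of C of the
    -- same form, for a combination of f i and f (i + 1). The cases e = true and e = false then give
    -- two independent equations.
    have key : ∀ e : Bool, ∀ i ≤ C.card, (if e = false then (-2 : ℚ) else 4) * f i +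
        (if e = true then -2 else 4) * f (i + 1) = 0 := by
      intro e
      apply ih (fun i => (if e = false then (-2 : ℚ) else 4) * f i +
        (if e = true then -2 else 4) * f (i + 1))
      intro ε
      have hε := h (Function.update ε a e)
      rw [Finset.sum_powerset_insert ha, ← Finset.sum_add_distrib] at hε
      rw [← hε]
      refine Finset.sum_congr rfl fun S hS => ?_
      have haS : a ∉ S := fun h' => ha (Finset.mem_powerset.1 hS h')
      have hne : ∀ i ∈ C, i ≠ a := fun i hi h' => ha (h' ▸ hi)
      rw [Finset.prod_insert ha, Finset.prod_insert ha, Finset.card_insert_of_notMem haS]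
      have h1 : ∏ i ∈ C, (if Function.update ε a e i = decide (i ∈ S) then (-2 : ℚ) else 4) =
          ∏ i ∈ C, if ε i = decide (i ∈ S) then -2 else 4 :=
        Finset.prod_congr rfl fun i hi => by rw [Function.update_of_ne (hne i hi)]
      have h2 : ∏ i ∈ C, (if Function.update ε a e i = decide (i ∈ insert a S) then (-2 : ℚ)
          else 4) = ∏ i ∈ C, if ε i = decide (i ∈ S) then -2 else 4 :=
        Finset.prod_congr rfl fun i hi => by
          rw [Function.update_of_ne (hne i hi)]
          simp [Finset.mem_insert, hne i hi]
      rw [h1, h2]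
      simp only [Function.update_self, haS, decide_false, Finset.mem_insert_self, decide_true]
      ring
    intro i hi
    rw [Finset.card_insert_of_notMem ha] at hi
    rcases Nat.lt_or_ge C.card i with hlt | hle
    · obtain rfl : i = C.card + 1 := by omega
      have h1 := key true C.card le_rfl
      have h2 := key false C.card le_rfl
      simp at h1 h2
      linarith
    · have h1 := key true i hle
      have h2 := key false i hle
      simp at h1 h2
      linarith

/-- The polynomials that expand the bracket are unique, as there are enough diagrams all of whose
states consist of inessential components. -/
theorem eq_bracketPolynomial_of_expandsBracket [Nontrivial 𝕜]
    (hcurls : ∀ (c : ℕ) (ε : ℕ → Bool), ∃ (D : Diagram o b) (q : CurveClass b) (p : ℕ ↪ F),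
      D.crossings = (Finset.range c).map p ∧ (∀ S, D.stateClass S = q) ∧
      ∀ S : Finset ℕ, (-2 : ℚ) ^ D.mu (S.map p) =
        ∏ i ∈ Finset.range c, if ε i = decide (i ∈ S) then -2 else 4)
    {P : ℕ → MvPolynomial (Fin 2) ℚ} (hP : ExpandsBracket 𝕜 o b P) (k : ℕ) :
    P k = bracketPolynomial k := by
  classical
  induction k using Nat.strong_induction_on with
  | _ k ih =>
    rw [← sub_eq_zero]
    set Q := P k - bracketPolynomial k with hQ
    -- Diagrams with c crossings detect exactly the values on the line i + n = c.
    have key : ∀ c i, i ≤ c → newton Q i (c - i) = 0 := by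
      intro c
      have h0 := eq_zero_of_sum_powerset_eq_zero (Finset.range c) (fun i => newton Q i (c - i)) ?_
      · simpa using h0
      intro ε
      obtain ⟨D, q, p, hD, hq, hμ⟩ := hcurls c ε
      have h1 := hP k D
      rw [expandsBracket_bracketPolynomial o b 𝕜 k D, Finset.sum_range_succ',
        Finset.sum_range_succ' (n := k / 2)] at h1
      -- The terms with j ≥ 1 only involve polynomials of smaller index, already known to agree.
      have hcong : ∑ j ∈ Finset.range (k / 2), projection
          (fun i => algebraMap ℚ 𝕜 (loopCoeff (j + 1) i)) (chi (MvPolynomial.map (algebraMap ℚ 𝕜)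
            (P (k - 2 * (j + 1)))) (Finsupp.single D 1)) =
          ∑ j ∈ Finset.range (k / 2), projection
          (fun i => algebraMap ℚ 𝕜 (loopCoeff (j + 1) i)) (chi (MvPolynomial.map (algebraMap ℚ 𝕜)
            (bracketPolynomial (k - 2 * (j + 1)))) (Finsupp.single D 1)) := by
        refine Finset.sum_congr rfl fun j hj => ?_
        rw [Finset.mem_range] at hj
        rw [ih (k - 2 * (j + 1)) (by omega)]
      rw [hcong, add_right_inj, mul_zero, Nat.sub_zero, projection_chi, projection_chi] at h1
      -- All states have the same class q, so its coefficient carries the whole equation.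
      have h2 := DFunLike.congr_fun h1 q
      simp only [hq, Finsupp.finsetSum_apply, Finsupp.single_eq_same, newton_map, ← map_mul]
        at h2
      have h3 : ((-1 : 𝕜) ^ D.crossings.card) = algebraMap ℚ 𝕜 ((-1) ^ D.crossings.card) := by
        simp
      simp only [h3, ← map_mul, ← map_sum] at h2
      -- As 𝕜 is nontrivial, the field ℚ embeds into it.
      have h4 := (algebraMap ℚ 𝕜).injective h2
      rw [← Finset.mul_sum, ← Finset.mul_sum] at h4
      have h5 := mul_left_cancel₀ (pow_ne_zero _ (by norm_num)) h4
      rw [← sub_eq_zero, ← Finset.sum_sub_distrib] at h5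
      have h6 : ∑ U ∈ D.crossings.powerset,
          (-2 : ℚ) ^ D.mu U * newton Q U.card (c - U.card) = 0 := by
        rw [← neg_eq_zero, ← h5, ← Finset.sum_neg_distrib]
        refine Finset.sum_congr rfl fun U hU => ?_
        have hc : (D.crossings \ U).card = c - U.card := by
          rw [Finset.card_sdiff_of_subset (Finset.mem_powerset.1 hU), hD]
          simp
        rw [loopCoeff_zero, hQ, newton_sub, hc]
        ring
      rw [hD, powerset_map, Finset.sum_map] at h6
      rw [← h6]
      refine Finset.sum_congr rfl fun S _ => ?_
      rw [← hμ S]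
      simp
    refine eq_zero_of_newton_eq_zero fun i n => ?_
    have := key (i + n) i (by omega)
    rwa [Nat.add_sub_cancel_left] at this

end States

/-! ## Boxes in the plane -/

section Boxes

theorem abs_mul_arctan_lt {β : ℝ} (hβ : 0 < β) (u : ℝ) :
    |β * Real.arctan u| < β * (Real.pi / 2) := by
  rw [abs_mul, abs_of_pos hβ]
  gcongr
  exact abs_lt.2 ⟨Real.neg_pi_div_two_lt_arctan u, Real.arctan_lt_pi_div_two u⟩

theorem arcsin_sin_mul_arctan {β : ℝ} (hβ : 0 < β) (hβ1 : β ≤ 1) (u : ℝ) :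
    Real.arcsin (Real.sin (β * Real.arctan u)) = β * Real.arctan u := by
  have h := abs_lt.1 (abs_mul_arctan_lt hβ u)
  have hpi := Real.pi_pos
  apply Real.arcsin_sin <;> nlinarith

theorem mem_Ioo_of_abs_arcsin_lt {z : ℝ} (h : |Real.arcsin z| < Real.pi / 2) :
    z ∈ Ioo (-1 : ℝ) 1 := by
  rw [abs_lt, Real.neg_pi_div_two_lt_arcsin, Real.arcsin_lt_pi_div_two] at h
  exact h

/-- A diffeomorphism from the line onto an open interval with center `c`. -/
noncomputable def swing (c r β : ℝ) (hr : r ≠ 0) (hβ : 0 < β) (hβ1 : β ≤ 1) :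
    OpenPartialHomeomorph ℝ ℝ where
  -- For β = 1 the image is the interval of radius |r|. The value β = 1/2 serves the half-angle
  -- formula in `curlX_sq_sub`, and a negative r reverses the line.
  toFun u := c + r * Real.sin (β * Real.arctan u)
  invFun x := Real.tan (Real.arcsin ((x - c) / r) / β)
  source := univ
  target := {x | |Real.arcsin ((x - c) / r)| < β * (Real.pi / 2)}
  map_source' := by
    intro u _
    simp only [mem_ofPred_eq, add_sub_cancel_left, mul_div_cancel_left₀ _ hr]
    rw [arcsin_sin_mul_arctan hβ hβ1]
    exact abs_mul_arctan_lt hβ u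
  map_target' := fun _ _ => mem_univ _
  left_inv' := by
    intro u _
    simp only [add_sub_cancel_left, mul_div_cancel_left₀ _ hr]
    rw [arcsin_sin_mul_arctan hβ hβ1, mul_div_cancel_left₀ _ hβ.ne', Real.tan_arctan]
  right_inv' := by
    intro x hx
    have hx' : |Real.arcsin ((x - c) / r)| < β * (Real.pi / 2) := hx
    have h1 := mem_Ioo_of_abs_arcsin_lt (hx'.trans_le (by have := Real.pi_pos; nlinarith))
    rw [abs_lt] at hx'
    have h2 : Real.arctan (Real.tan (Real.arcsin ((x - c) / r) / β)) =
        Real.arcsin ((x - c) / r) / β := by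
      apply Real.arctan_tan
      · rw [lt_div_iff₀ hβ]
        linarith
      · rw [div_lt_iff₀ hβ]
        linarith
    rw [h2, mul_div_cancel₀ _ hβ.ne', Real.sin_arcsin h1.1.le h1.2.le, mul_div_cancel₀ _ hr]
    ring
  open_source := isOpen_univ
  open_target := by
    have := Real.continuous_arcsin
    exact isOpen_lt (by fun_prop) (by fun_prop)
  continuousOn_toFun := by
    have := Real.continuous_arctan
    apply Continuous.continuousOn
    fun_prop
  continuousOn_invFun := by
    intro x hx
    have hx' : |Real.arcsin ((x - c) / r)| < β * (Real.pi / 2) := hx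
    rw [abs_lt] at hx'
    have h : Real.cos (Real.arcsin ((x - c) / r) / β) ≠ 0 := by
      apply (Real.cos_pos_of_mem_Ioo ⟨_, _⟩).ne'
      · rw [lt_div_iff₀ hβ]
        linarith
      · rw [div_lt_iff₀ hβ]
        linarith
    have hc := Real.continuous_arcsin
    exact (ContinuousAt.comp (f := fun x => Real.arcsin ((x - c) / r) / β)
      (Real.continuousAt_tan.2 h) (by fun_prop)).continuousWithinAt

variable {c r β : ℝ} {hr : r ≠ 0} {hβ : 0 < β} {hβ1 : β ≤ 1}

theorem swing_apply (u : ℝ) :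
    swing c r β hr hβ hβ1 u = c + r * Real.sin (β * Real.arctan u) := rfl

theorem contDiff_swing : ContDiff ℝ ∞ (swing c r β hr hβ hβ1) := by
  have : ContDiff ℝ ∞ Real.arctan := Real.contDiff_arctan
  show ContDiff ℝ ∞ fun u => c + r * Real.sin (β * Real.arctan u)
  fun_prop

theorem contDiffOn_swing_symm :
    ContDiffOn ℝ ∞ (swing c r β hr hβ hβ1).symm (swing c r β hr hβ hβ1).target := by
  intro x hx
  have hx' : |Real.arcsin ((x - c) / r)| < β * (Real.pi / 2) := hx
  have h1 := mem_Ioo_of_abs_arcsin_lt (hx'.trans_le (by have := Real.pi_pos; nlinarith))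
  rw [abs_lt] at hx'
  have h : Real.cos (Real.arcsin ((x - c) / r) / β) ≠ 0 := by
    apply (Real.cos_pos_of_mem_Ioo ⟨_, _⟩).ne'
    · rw [lt_div_iff₀ hβ]
      linarith
    · rw [div_lt_iff₀ hβ]
      linarith
  have h2 : ContDiffAt ℝ ∞ (fun x => Real.arcsin ((x - c) / r)) x :=
    ContDiffAt.comp (f := fun x => (x - c) / r) x (Real.contDiffAt_arcsin h1.1.ne' h1.2.ne)
      (by fun_prop)
  exact (ContDiffAt.comp (f := fun x => Real.arcsin ((x - c) / r) / β) x
    (Real.contDiffAt_tan.2 h) (h2.div_const β)).contDiffWithinAt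

/-- The derivative has the sign of r; this is all that orientations require. -/
theorem exists_hasDerivAt_swing (u : ℝ) :
    ∃ a, 0 < a ∧ HasDerivAt (swing c r β hr hβ hβ1) (r * a) u := by
  refine ⟨Real.cos (β * Real.arctan u) * (β * (1 / (1 + u ^ 2))), ?_, ?_⟩
  · have h := abs_lt.1 (abs_mul_arctan_lt hβ u)
    have hpi := Real.pi_pos
    have := Real.cos_pos_of_mem_Ioo (x := β * Real.arctan u) ⟨by nlinarith, by nlinarith⟩
    positivity
  · exact (((Real.hasDerivAt_arctan u).const_mul β).sin.const_mul r).const_add c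

theorem mem_swing_target_of_one {x : ℝ} (hβ : (0 : ℝ) < 1) (hβ1 : (1 : ℝ) ≤ 1) :
    x ∈ (swing c r 1 hr hβ hβ1).target ↔ (x - c) ^ 2 < r ^ 2 := by
  have h1 : x ∈ (swing c r 1 hr hβ hβ1).target ↔
      |Real.arcsin ((x - c) / r)| < 1 * (Real.pi / 2) := Iff.rfl
  rw [h1, one_mul, abs_lt, Real.neg_pi_div_two_lt_arcsin, Real.arcsin_lt_pi_div_two, ← abs_lt,
    ← sq_lt_one_iff_abs_lt_one, div_pow, div_lt_one (by positivity)]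

theorem mem_swing_target_of_half {x : ℝ} (hβ : (0 : ℝ) < 1 / 2) (hβ1 : (1 / 2 : ℝ) ≤ 1) :
    x ∈ (swing c 1 (1 / 2) one_ne_zero hβ hβ1).target ↔ (x - c) ^ 2 < 1 / 2 := by
  have h1 : x ∈ (swing c 1 (1 / 2) one_ne_zero hβ hβ1).target ↔
      |Real.arcsin ((x - c) / 1)| < 1 / 2 * (Real.pi / 2) := Iff.rfl
  have hpi := Real.pi_pos
  have h2 : Real.sin (1 / 2 * (Real.pi / 2)) = √2 / 2 := by
    rw [← Real.sin_pi_div_four]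
    congr 1
    ring
  rw [h1, div_one, abs_lt, Real.arcsin_lt_iff_lt_sin' ⟨by linarith, by linarith⟩,
    Real.lt_arcsin_iff_sin_lt' ⟨by linarith, by linarith⟩, Real.sin_neg, h2, ← abs_lt,
    ← sq_lt_sq₀ (abs_nonneg _) (by positivity), sq_abs, div_pow, Real.sq_sqrt (by norm_num)]
  norm_num

/-- The product of two maps of the line. -/
noncomputable def boxMap (f g : OpenPartialHomeomorph ℝ ℝ) :
    OpenPartialHomeomorph Plane Plane where
  toFun x := !₂[f (x 0), g (x 1)]
  invFun x := !₂[f.symm (x 0), g.symm (x 1)]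
  source := {x | x 0 ∈ f.source ∧ x 1 ∈ g.source}
  target := {x | x 0 ∈ f.target ∧ x 1 ∈ g.target}
  map_source' := fun x hx => ⟨f.map_source hx.1, g.map_source hx.2⟩
  map_target' := fun x hx => ⟨f.map_target hx.1, g.map_target hx.2⟩
  left_inv' := by
    intro x hx
    ext i
    fin_cases i
    · exact f.left_inv hx.1
    · exact g.left_inv hx.2
  right_inv' := by
    intro x hx
    ext i
    fin_cases i
    · exact f.right_inv hx.1
    · exact g.right_inv hx.2
  open_source := by
    have h1 : Continuous fun x : Plane => x 0 := by fun_prop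
    have h2 : Continuous fun x : Plane => x 1 := by fun_prop
    exact (f.open_source.preimage h1).inter (g.open_source.preimage h2)
  open_target := by
    have h1 : Continuous fun x : Plane => x 0 := by fun_prop
    have h2 : Continuous fun x : Plane => x 1 := by fun_prop
    exact (f.open_target.preimage h1).inter (g.open_target.preimage h2)
  continuousOn_toFun := by
    apply (PiLp.continuous_toLp 2 _).comp_continuousOn
    refine continuousOn_pi.2 fun i => ?_
    fin_cases i
    · exact f.continuousOn.comp (by fun_prop) fun x hx => hx.1
    · exact g.continuousOn.comp (by fun_prop) fun x hx => hx.2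
  continuousOn_invFun := by
    apply (PiLp.continuous_toLp 2 _).comp_continuousOn
    refine continuousOn_pi.2 fun i => ?_
    fin_cases i
    · exact f.continuousOn_symm.comp (by fun_prop) fun x hx => hx.1
    · exact g.continuousOn_symm.comp (by fun_prop) fun x hx => hx.2

variable {f g : OpenPartialHomeomorph ℝ ℝ}

theorem mem_boxMap_target {x : Plane} :
    x ∈ (boxMap f g).target ↔ x 0 ∈ f.target ∧ x 1 ∈ g.target := Iff.rfl

theorem contDiff_boxMap (hf : ContDiff ℝ ∞ f) (hg : ContDiff ℝ ∞ g) :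
    ContDiff ℝ ∞ (boxMap f g) := by
  rw [contDiff_euclidean]
  intro i
  fin_cases i
  · exact hf.comp (by fun_prop)
  · exact hg.comp (by fun_prop)

theorem contDiffOn_boxMap_symm (hf : ContDiffOn ℝ ∞ f.symm f.target)
    (hg : ContDiffOn ℝ ∞ g.symm g.target) :
    ContDiffOn ℝ ∞ (boxMap f g).symm (boxMap f g).target := by
  rw [contDiffOn_euclidean]
  intro i
  fin_cases i
  · exact hf.comp (by fun_prop) fun x hx => hx.1
  · exact hg.comp (by fun_prop) fun x hx => hx.2

theorem det_fderiv_boxMap {x : Plane} {a a' : ℝ} (hf : HasDerivAt f a (x 0))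
    (hg : HasDerivAt g a' (x 1)) : (fderiv ℝ (boxMap f g) x).det = a * a' := by
  have h : DifferentiableAt ℝ (boxMap f g) x := by
    rw [differentiableAt_euclidean]
    intro i
    fin_cases i
    · exact hf.differentiableAt.comp x (f := fun x : Plane => x 0) (by fun_prop)
    · exact hg.differentiableAt.comp x (f := fun x : Plane => x 1) (by fun_prop)
  have h0 : ∀ v, fderiv ℝ (boxMap f g) x v 0 = a * v 0 := by
    intro v
    have h1 : HasFDerivAt (fun y => boxMap f g y 0)
        ((EuclideanSpace.proj (0 : Fin 2)).comp (fderiv ℝ (boxMap f g) x)) x :=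
      (EuclideanSpace.proj (𝕜 := ℝ) (0 : Fin 2)).hasFDerivAt.comp x h.hasFDerivAt
    have h2 : HasFDerivAt (fun y => boxMap f g y 0)
        (a • (EuclideanSpace.proj (0 : Fin 2) : Plane →L[ℝ] ℝ)) x :=
      hf.comp_hasFDerivAt x (EuclideanSpace.proj (𝕜 := ℝ) (0 : Fin 2)).hasFDerivAt
    exact DFunLike.congr_fun (h1.unique h2) v
  have h1 : ∀ v, fderiv ℝ (boxMap f g) x v 1 = a' * v 1 := by
    intro v
    have h1 : HasFDerivAt (fun y => boxMap f g y 1)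
        ((EuclideanSpace.proj (1 : Fin 2)).comp (fderiv ℝ (boxMap f g) x)) x :=
      (EuclideanSpace.proj (𝕜 := ℝ) (1 : Fin 2)).hasFDerivAt.comp x h.hasFDerivAt
    have h2 : HasFDerivAt (fun y => boxMap f g y 1)
        (a' • (EuclideanSpace.proj (1 : Fin 2) : Plane →L[ℝ] ℝ)) x :=
      hg.comp_hasFDerivAt x (EuclideanSpace.proj (𝕜 := ℝ) (1 : Fin 2)).hasFDerivAt
    exact DFunLike.congr_fun (h1.unique h2) v
  rw [ContinuousLinearMap.det, ← LinearMap.det_toMatrix (EuclideanSpace.basisFun (Fin 2) ℝ).toBasis,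
    Matrix.det_fin_two]
  simp [LinearMap.toMatrix_apply, h0, h1]

end Boxes

/-! ## Closed curves that bound disks in the plane -/

section PlaneCurves

/-- A closed curve in the plane that bounds an embedded disk. -/
def BoundsDisk (K : Set Plane) : Prop :=
  ∃ f : Plane → Plane, ContinuousOn f (Metric.closedBall 0 1) ∧
    InjOn f (Metric.closedBall 0 1) ∧ f '' Metric.sphere 0 1 = K

theorem norm_sq_plane {i j : Fin 2} (hij : i ≠ j) (z : Plane) : ‖z‖ ^ 2 = z i ^ 2 + z j ^ 2 := by
  rw [EuclideanSpace.norm_sq_eq]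
  fin_cases i <;> fin_cases j <;> simp_all [add_comm]

theorem mem_closedBall_plane {i j : Fin 2} (hij : i ≠ j) (z : Plane) :
    z ∈ Metric.closedBall (0 : Plane) 1 ↔ z i ^ 2 + z j ^ 2 ≤ 1 := by
  rw [mem_closedBall_zero_iff, ← norm_sq_plane hij, sq_le_one_iff₀ (norm_nonneg z)]

theorem mem_sphere_plane {i j : Fin 2} (hij : i ≠ j) (z : Plane) :
    z ∈ Metric.sphere (0 : Plane) 1 ↔ z i ^ 2 + z j ^ 2 = 1 := by
  rw [mem_sphere_zero_iff_norm, ← norm_sq_plane hij,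
    pow_eq_one_iff_of_nonneg (norm_nonneg z) two_ne_zero]

theorem plane_ext {i j : Fin 2} (hij : i ≠ j) {x y : Plane} (hi : x i = y i) (hj : x j = y j) :
    x = y := by
  ext k
  have : k = i ∨ k = j := by
    fin_cases i <;> fin_cases j <;> fin_cases k <;> simp_all
  rcases this with rfl | rfl
  · exact hi
  · exact hj

/-- The region between the two graphs is a disk: the chord of the unit disk on which the j-th
coordinate has a fixed value is mapped affinely onto the corresponding segment from `lo` to `hi`.
The chord has half-length √(1 - z_j²), and m and w are midpoint and half-length of the segment. -/
theorem boundsDisk_of_graphs {i j : Fin 2} (hij : i ≠ j) {d : ℝ} (hd : 0 < d) {lo hi : ℝ → ℝ}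
    (hlo : Continuous lo) (hhi : Continuous hi) (hlt : ∀ y, |y| < d → lo y < hi y)
    (heq : ∀ y, |y| = d → lo y = hi y) :
    BoundsDisk {x | |x j| ≤ d ∧ (x i = lo (x j) ∨ x i = hi (x j))} := by
  set w : ℝ → ℝ := fun y => (hi y - lo y) / 2 with hw
  set m : ℝ → ℝ := fun y => (hi y + lo y) / 2 with hm
  have hwc : Continuous w := by fun_prop
  have hmc : Continuous m := by fun_prop
  set F : Plane → Plane := fun z => WithLp.toLp 2 fun k =>
    if k = i then m (d * z j) + w (d * z j) * (z i / √(1 - z j ^ 2)) else d * z j with hF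
  have hFi : ∀ z, F z i = m (d * z j) + w (d * z j) * (z i / √(1 - z j ^ 2)) := by
    intro z
    simp [hF]
  have hFj : ∀ z, F z j = d * z j := by
    intro z
    simp [hF, hij.symm]
  have habs : ∀ z : Plane, |d * z j| = d * |z j| := fun z => by rw [abs_mul, abs_of_pos hd]
  have hw0 : ∀ z : Plane, z j ^ 2 = 1 → w (d * z j) = 0 := by
    intro z hz
    have h1 : |z j| = 1 := by
      rwa [← sq_abs, pow_eq_one_iff_of_nonneg (abs_nonneg _) two_ne_zero] at hz
    have := heq (d * z j) (by rw [habs, h1, mul_one])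
    simp [hw, this]
  have hwpos : ∀ z : Plane, z j ^ 2 < 1 → 0 < w (d * z j) := by
    intro z hz
    have h1 : |z j| < 1 := (sq_lt_one_iff_abs_lt_one _).1 hz
    have := hlt (d * z j) (by rw [habs]; nlinarith)
    simp only [hw]
    linarith
  refine ⟨F, ?_, ?_, ?_⟩
  · apply (PiLp.continuous_toLp 2 _).comp_continuousOn
    refine continuousOn_pi.2 fun k => ?_
    split_ifs
    · refine ContinuousOn.add (by fun_prop) ?_
      intro z hz
      rw [mem_closedBall_plane hij] at hz
      rcases lt_or_ge (z j ^ 2) 1 with h | h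
      · have : √(1 - z j ^ 2) ≠ 0 := (Real.sqrt_pos.2 (by linarith)).ne'
        apply ContinuousAt.continuousWithinAt
        fun_prop (disch := assumption)
      -- At the poles the quotient is 0 / 0 = 0. It is bounded by 1 in absolute value on the whole
      -- disk, while w tends to 0, so the product is continuous there.
      · have hz1 : z j ^ 2 = 1 := by nlinarith [sq_nonneg (z i)]
        have h0 : w (d * z j) * (z i / √(1 - z j ^ 2)) = 0 := by rw [hw0 z hz1, zero_mul]
        rw [ContinuousWithinAt, h0]
        have hlim : Filter.Tendsto (fun z : Plane => |w (d * z j)|)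
            (𝓝[Metric.closedBall 0 1] z) (𝓝 0) := by
          have hc : Continuous fun z : Plane => |w (d * z j)| := by fun_prop
          have := hc.continuousWithinAt (s := Metric.closedBall 0 1) (x := z)
          rw [ContinuousWithinAt, hw0 z hz1, abs_zero] at this
          exact this
        refine squeeze_zero_norm' ?_ hlim
        filter_upwards [self_mem_nhdsWithin] with y hy
        rw [mem_closedBall_plane hij] at hy
        rw [Real.norm_eq_abs, abs_mul]
        refine mul_le_of_le_one_right (abs_nonneg _) ?_
        rw [abs_div, abs_of_nonneg (Real.sqrt_nonneg _)]
        refine div_le_one_of_le₀ ?_ (Real.sqrt_nonneg _)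
        exact Real.abs_le_sqrt (by linarith)
    · fun_prop
  · intro y hy z hz h
    rw [mem_closedBall_plane hij] at hy hz
    have hj : y j = z j := by
      have := congrArg (fun x : Plane => x j) h
      simp only [hFj] at this
      exact mul_left_cancel₀ hd.ne' this
    refine plane_ext hij ?_ hj
    have h1 := congrArg (fun x : Plane => x i) h
    simp only [hFi, hj, add_right_inj] at h1
    rcases lt_or_ge (z j ^ 2) 1 with h' | h'
    · have h2 := mul_left_cancel₀ (hwpos z h').ne' h1
      have : √(1 - z j ^ 2) ≠ 0 := (Real.sqrt_pos.2 (by linarith)).ne'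
      field_simp at h2
      exact h2
    · rw [hj] at hy
      have hy0 : y i ^ 2 = 0 := by nlinarith [sq_nonneg (y i)]
      have hz0 : z i ^ 2 = 0 := by nlinarith [sq_nonneg (z i)]
      rw [pow_eq_zero_iff two_ne_zero] at hy0 hz0
      rw [hy0, hz0]
  · ext x
    constructor
    · rintro ⟨z, hz, rfl⟩
      rw [mem_sphere_plane hij] at hz
      have hz1 : z j ^ 2 ≤ 1 := by nlinarith [sq_nonneg (z i)]
      refine ⟨?_, ?_⟩
      · rw [hFj, habs]
        exact mul_le_of_le_one_right hd.le ((sq_le_one_iff_abs_le_one _).1 hz1)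
      · rw [hFi, hFj]
        rcases hz1.lt_or_eq with h | h
        · have hzi : z i ^ 2 = 1 - z j ^ 2 := by linarith
          have hpos : 0 < √(1 - z j ^ 2) := Real.sqrt_pos.2 (by linarith)
          rw [← hzi, Real.sqrt_sq_eq_abs] at hpos ⊢
          rcases lt_or_gt_of_ne (abs_pos.1 hpos) with h0 | h0
          · left
            rw [abs_of_neg h0, div_neg, div_self h0.ne]
            simp only [hm, hw]
            ring
          · right
            rw [abs_of_pos h0, div_self h0.ne']
            simp only [hm, hw]
            ring
        · left
          have h0 := hw0 z h
          rw [h0]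
          simp only [hm, hw] at h0 ⊢
          linarith
    · rintro ⟨hx, hx'⟩
      -- The sign s selects an endpoint of the chord: -1 for the graph of `lo`, 1 for that of `hi`.
      have key : ∀ s : ℝ, s ^ 2 = 1 → x i = m (x j) + s * w (x j) →
          x ∈ F '' Metric.sphere 0 1 := by
        intro s hs hxs
        have hq : (x j / d) ^ 2 ≤ 1 := by
          rw [sq_le_one_iff_abs_le_one, abs_div, abs_of_pos hd]
          exact div_le_one_of_le₀ hx hd.le
        set z : Plane := WithLp.toLp 2 fun k => if k = i then s * √(1 - (x j / d) ^ 2) else x j / d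
          with hz
        have hzi : z i = s * √(1 - (x j / d) ^ 2) := by simp [hz]
        have hzj : z j = x j / d := by simp [hz, hij.symm]
        have hdz : d * z j = x j := by rw [hzj, mul_div_cancel₀ _ hd.ne']
        refine ⟨z, ?_, plane_ext hij ?_ ?_⟩
        · rw [mem_sphere_plane hij, hzi, hzj, mul_pow, hs, Real.sq_sqrt (by linarith)]
          ring
        · rw [hFi, hdz, hxs, hzi, hzj]
          rcases hq.lt_or_eq with h | h
          · have : √(1 - (x j / d) ^ 2) ≠ 0 := (Real.sqrt_pos.2 (by linarith)).ne'
            rw [mul_div_assoc, div_self this]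
            ring
          · have := hw0 z (by rw [hzj, h])
            rw [hdz] at this
            rw [this]
            ring
        · rw [hFj, hdz]
      rcases hx' with h | h
      · refine key (-1) (by norm_num) ?_
        rw [h]
        simp only [hm, hw]
        ring
      · refine key 1 (by norm_num) ?_
        rw [h]
        simp only [hm, hw]
        ring

/-! ### The figure eight and its smoothings -/

/-- The lemniscate, a figure eight with its crossing at the origin. -/
def figureEight : Set Plane := {x | x 1 ^ 2 = x 0 ^ 2 - x 0 ^ 4}

/-- A disk with center `c`, which covers the crossing of a figure eight that is centered at `c`. -/
noncomputable def curlDisk (c : Plane) : OpenPartialHomeomorph Plane Plane :=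
  boxMap (swing (c 0) 1 (1 / 2) one_ne_zero (by norm_num) (by norm_num))
    (swing (c 1) (1 / 2) 1 (by norm_num) one_pos le_rfl)

/-- The horizontal coordinate in `curlDisk 0`. -/
noncomputable def curlX (u : ℝ) : ℝ := Real.sin (1 / 2 * Real.arctan u)

/-- The vertical coordinate in `curlDisk 0`. -/
noncomputable def curlY (v : ℝ) : ℝ := 1 / 2 * Real.sin (Real.arctan v)

theorem curlDisk_zero (c x : Plane) : curlDisk c x 0 = c 0 + curlX (x 0) := by
  show c 0 + 1 * _ = _
  rw [one_mul]
  rfl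

theorem curlDisk_one (c x : Plane) : curlDisk c x 1 = c 1 + curlY (x 1) := by
  show c 1 + 1 / 2 * Real.sin (1 * _) = _
  rw [one_mul]
  rfl

theorem mem_curlDisk_target {c x : Plane} :
    x ∈ (curlDisk c).target ↔ (x 0 - c 0) ^ 2 < 1 / 2 ∧ (x 1 - c 1) ^ 2 < 1 / 4 := by
  rw [curlDisk, mem_boxMap_target, mem_swing_target_of_half, mem_swing_target_of_one]
  norm_num

theorem curlDisk_source (c : Plane) : (curlDisk c).source = univ := by
  ext x
  exact ⟨fun _ => mem_univ _, fun _ => ⟨mem_univ _, mem_univ _⟩⟩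

theorem contDiff_curlDisk (c : Plane) : ContDiff ℝ ∞ (curlDisk c) :=
  contDiff_boxMap contDiff_swing contDiff_swing

theorem contDiffOn_curlDisk_symm (c : Plane) :
    ContDiffOn ℝ ∞ (curlDisk c).symm (curlDisk c).target :=
  contDiffOn_boxMap_symm contDiffOn_swing_symm contDiffOn_swing_symm

theorem det_fderiv_curlDisk_pos (c x : Plane) : 0 < (fderiv ℝ (curlDisk c) x).det := by
  obtain ⟨a, ha, ha'⟩ := exists_hasDerivAt_swing (c := c 0) (hr := one_ne_zero)
    (β := 1 / 2) (hβ := by norm_num) (hβ1 := by norm_num) (x 0)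
  obtain ⟨d, hd, hd'⟩ := exists_hasDerivAt_swing (c := c 1) (r := 1 / 2) (hr := by norm_num)
    (hβ := one_pos) (hβ1 := le_rfl) (x 1)
  rw [curlDisk, det_fderiv_boxMap ha' hd']
  positivity

theorem curlY_sq (v : ℝ) : curlY v ^ 2 = 1 / 4 * (v ^ 2 / (1 + v ^ 2)) := by
  rw [curlY, Real.sin_arctan, mul_pow, div_pow v, Real.sq_sqrt (by positivity)]
  norm_num

/-- With x = sin(θ/2), x² - x⁴ = sin²(θ/2) cos²(θ/2) = sin²θ / 4. This is the reason for the factors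
1/2 in both coordinates. -/
theorem curlX_sq_sub (u : ℝ) : curlX u ^ 2 - curlX u ^ 4 = curlY u ^ 2 := by
  have h : Real.sin (Real.arctan u) =
      2 * Real.sin (1 / 2 * Real.arctan u) * Real.cos (1 / 2 * Real.arctan u) := by
    rw [← Real.sin_two_mul]
    congr 1
    ring
  have h1 := Real.sin_sq_add_cos_sq (1 / 2 * Real.arctan u)
  rw [curlX, curlY, h]
  have h2 : Real.cos (1 / 2 * Real.arctan u) ^ 2 = 1 - Real.sin (1 / 2 * Real.arctan u) ^ 2 := by
    linarith
  linear_combination -Real.sin (1 / 2 * Real.arctan u) ^ 2 * h2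

theorem curlY_sq_le_iff {u v : ℝ} : curlY u ^ 2 ≤ curlY v ^ 2 ↔ u ^ 2 ≤ v ^ 2 := by
  rw [curlY_sq, curlY_sq, mul_le_mul_iff_right₀ (by norm_num),
    div_le_div_iff₀ (by positivity) (by positivity)]
  constructor <;> intro h <;> nlinarith

theorem curlY_sq_eq_iff {u v : ℝ} : curlY u ^ 2 = curlY v ^ 2 ↔ u ^ 2 = v ^ 2 := by
  rw [le_antisymm_iff, le_antisymm_iff, curlY_sq_le_iff, curlY_sq_le_iff]

theorem curlY_sq_lt (v : ℝ) : curlY v ^ 2 < 1 / 4 := by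
  rw [curlY_sq]
  have : v ^ 2 / (1 + v ^ 2) < 1 := by
    rw [div_lt_one (by positivity)]
    linarith
  linarith

theorem curlX_sq_lt (u : ℝ) : curlX u ^ 2 < 1 / 2 := by
  have h : curlDisk 0 !₂[u, 0] ∈ (curlDisk 0).target :=
    (curlDisk 0).map_source (by rw [curlDisk_source]; exact mem_univ _)
  rw [mem_curlDisk_target, curlDisk_zero] at h
  simpa using h.1

theorem curlX_neg (u : ℝ) : curlX (-u) = -curlX u := by
  simp [curlX, Real.arctan_neg]

theorem curlY_neg (u : ℝ) : curlY (-u) = -curlY u := by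
  simp [curlY, Real.arctan_neg]

theorem curlY_pos {v : ℝ} (hv : 0 < v) : 0 < curlY v := by
  rw [curlY, Real.sin_arctan]
  positivity

theorem curlX_pos {u : ℝ} (hu : 0 < u) : 0 < curlX u := by
  have h := Real.arctan_pos.2 hu
  have h' := Real.arctan_lt_pi_div_two u
  exact Real.sin_pos_of_pos_of_lt_pi (by linarith) (by linarith)

theorem continuous_curlX : Continuous curlX := by
  have := Real.continuous_arctan
  unfold curlX
  fun_prop

theorem continuous_curlY : Continuous curlY := by
  have := Real.continuous_arctan
  unfold curlY
  fun_prop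

/-- The quadratic equation X - X² = Y² for X = x², where X < 1/2 picks the smaller root. -/
theorem curlX_sq_of_curlY_sq (u : ℝ) : curlX u ^ 2 = 1 / 2 - √(1 / 4 - curlY u ^ 2) := by
  rw [← curlX_sq_sub, show 1 / 4 - (curlX u ^ 2 - curlX u ^ 4) = (1 / 2 - curlX u ^ 2) ^ 2 by ring,
    Real.sqrt_sq (by linarith [curlX_sq_lt u])]
  ring

theorem curlX_sq_le_of_sq_le {u v : ℝ} (h : u ^ 2 ≤ v ^ 2) : curlX u ^ 2 ≤ curlX v ^ 2 := by
  rw [curlX_sq_of_curlY_sq, curlX_sq_of_curlY_sq]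
  have := curlY_sq_le_iff.2 h
  have := Real.sqrt_le_sqrt (show 1 / 4 - curlY v ^ 2 ≤ 1 / 4 - curlY u ^ 2 by linarith)
  linarith

/-- In these coordinates the lemniscate is exactly the standard crossing, as `disk_preimage`
demands: its equation becomes an equality of squares of `curlY`. -/
theorem curlDisk_mem_figureEight_iff (x : Plane) : curlDisk 0 x ∈ figureEight ↔ x ∈ cross := by
  show curlDisk 0 x 1 ^ 2 = curlDisk 0 x 0 ^ 2 - curlDisk 0 x 0 ^ 4 ↔ x 0 ^ 2 = x 1 ^ 2
  rw [curlDisk_zero, curlDisk_one]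
  simp only [PiLp.zero_apply, zero_add]
  rw [curlX_sq_sub, curlY_sq_eq_iff, eq_comm]

/-- The smoothings of the figure eight: one closed curve, or two of them. -/
noncomputable def smoothedFigureEight (m : Bool) : Set Plane :=
  (figureEight \ (curlDisk 0).target) ∪ curlDisk 0 '' if m then arcs 1 0 else arcs 0 1

/-- The positive square root of `s² + bump s`. -/
noncomputable def bumpRoot (s : ℝ) : ℝ := √(s ^ 2 + bump s)

theorem bumpRoot_sq (s : ℝ) : bumpRoot s ^ 2 = s ^ 2 + bump s :=
  Real.sq_sqrt (sq_add_bump_pos s).le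

theorem bumpRoot_pos (s : ℝ) : 0 < bumpRoot s := Real.sqrt_pos.2 (sq_add_bump_pos s)

theorem continuous_bumpRoot : Continuous bumpRoot := by
  have := contDiff_bump.continuous
  unfold bumpRoot
  fun_prop

theorem sq_le_bumpRoot_sq (s : ℝ) : s ^ 2 ≤ bumpRoot s ^ 2 := by
  rw [bumpRoot_sq]
  linarith [bump_nonneg s]

theorem mem_arcs_iff {i j : Fin 2} {x : Plane} :
    x ∈ arcs i j ↔ x i = -bumpRoot (x j) ∨ x i = bumpRoot (x j) := by
  show x i ^ 2 = x j ^ 2 + bump (x j) ↔ _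
  rw [← bumpRoot_sq, sq_eq_sq_iff_eq_or_eq_neg, or_comm]

theorem mem_curlDisk_image_iff {A : Set Plane} {x : Plane} :
    x ∈ curlDisk 0 '' A ↔ (x 0 ^ 2 < 1 / 2 ∧ x 1 ^ 2 < 1 / 4) ∧ (curlDisk 0).symm x ∈ A := by
  have ht : (x 0 ^ 2 < 1 / 2 ∧ x 1 ^ 2 < 1 / 4) ↔ x ∈ (curlDisk 0).target := by
    simp [mem_curlDisk_target]
  rw [ht]
  constructor
  · rintro ⟨y, hy, rfl⟩
    have hs : y ∈ (curlDisk 0).source := by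
      rw [curlDisk_source]
      exact mem_univ _
    exact ⟨(curlDisk 0).map_source hs, by rwa [(curlDisk 0).left_inv hs]⟩
  · rintro ⟨h, h'⟩
    exact ⟨_, h', (curlDisk 0).right_inv h⟩

/-- The inverse of `curlX`. -/
noncomputable def curlU (x : ℝ) : ℝ := Real.tan (Real.arcsin ((x - 0) / 1) / (1 / 2))

/-- The inverse of `curlY`. -/
noncomputable def curlV (y : ℝ) : ℝ := Real.tan (Real.arcsin ((y - 0) / (1 / 2)) / 1)

theorem curlX_curlU {x : ℝ} (hx : x ^ 2 < 1 / 2) : curlX (curlU x) = x := by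
  have h := (swing 0 1 (1 / 2) one_ne_zero (by norm_num) (by norm_num)).right_inv
    ((mem_swing_target_of_half (c := 0) (by norm_num) (by norm_num)).2 (by simpa using hx))
  rw [swing_apply, zero_add, one_mul] at h
  exact h

theorem curlY_curlV {y : ℝ} (hy : y ^ 2 < 1 / 4) : curlY (curlV y) = y := by
  have h := (swing 0 (1 / 2) 1 (by norm_num) one_pos le_rfl).right_inv
    ((mem_swing_target_of_one (c := 0) (r := 1 / 2) (x := y) one_pos le_rfl).2
      (by norm_num; linarith))
  rw [swing_apply, zero_add, one_mul] at h
  exact h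

theorem curlU_curlX (u : ℝ) : curlU (curlX u) = u := by
  have h := (swing 0 1 (1 / 2) one_ne_zero (by norm_num) (by norm_num)).left_inv (mem_univ u)
  rw [swing_apply, zero_add, one_mul] at h
  exact h

theorem curlV_curlY (v : ℝ) : curlV (curlY v) = v := by
  have h := (swing 0 (1 / 2) 1 (by norm_num) one_pos le_rfl).left_inv (mem_univ v)
  rw [swing_apply, zero_add, one_mul] at h
  exact h

theorem continuousAt_curlU {x : ℝ} (hx : x ^ 2 < 1 / 2) : ContinuousAt curlU x :=
  (swing 0 1 (1 / 2) one_ne_zero (by norm_num) (by norm_num)).continuousAt_symm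
    ((mem_swing_target_of_half (by norm_num) (by norm_num)).2 (by simpa using hx))

theorem continuousAt_curlV {y : ℝ} (hy : y ^ 2 < 1 / 4) : ContinuousAt curlV y :=
  (swing 0 (1 / 2) 1 (by norm_num) one_pos le_rfl).continuousAt_symm
    ((mem_swing_target_of_one (c := 0) (r := 1 / 2) (x := y) one_pos le_rfl).2
      (by norm_num; linarith))

/-- Continuity at the edge x² = a of the coordinate disk: there the bounds `lo` and M meet, so the
behaviour of f near the edge need not be known. -/
theorem continuous_ite_of_squeeze {f g lo : ℝ → ℝ} {a M : ℝ}
    (hf : ∀ x, x ^ 2 < a → ContinuousAt f x) (hg : Continuous g) (hlo : Continuous lo)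
    (h1 : ∀ x, x ^ 2 < a → lo x ≤ f x) (h2 : ∀ x, x ^ 2 < a → f x ≤ M)
    (h3 : ∀ x, a ≤ x ^ 2 → lo x ≤ g x) (h4 : ∀ x, a ≤ x ^ 2 → g x ≤ M)
    (h5 : ∀ x, x ^ 2 = a → lo x = M) :
    Continuous fun x => if x ^ 2 < a then f x else g x := by
  have hsq : Continuous fun x : ℝ => x ^ 2 := by fun_prop
  rw [continuous_iff_continuousAt]
  intro x
  rcases lt_trichotomy (x ^ 2) a with h | h | h
  · refine (hf x h).congr ?_
    filter_upwards [(isOpen_lt hsq continuous_const).mem_nhds h] with y hy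
    exact (if_pos hy).symm
  · have hx : (if x ^ 2 < a then f x else g x) = M := by
      rw [if_neg h.not_lt]
      exact le_antisymm (h4 x h.ge) (h5 x h ▸ h3 x h.ge)
    rw [ContinuousAt, hx]
    have hlim : Filter.Tendsto lo (𝓝 x) (𝓝 M) := h5 x h ▸ hlo.continuousAt
    refine tendsto_of_tendsto_of_tendsto_of_le_of_le hlim tendsto_const_nhds ?_ ?_
    · intro y
      dsimp only
      split_ifs with hy
      · exact h1 y hy
      · exact h3 y (not_lt.1 hy)
    · intro y
      dsimp only
      split_ifs with hy
      · exact h2 y hy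
      · exact h4 y (not_lt.1 hy)
  · refine hg.continuousAt.congr ?_
    filter_upwards [(isOpen_lt continuous_const hsq).mem_nhds h] with y hy
    exact (if_neg (not_lt.2 (le_of_lt hy))).symm

/-- The upper half of the connected smoothing of the figure eight. -/
noncomputable def loopTop (x : ℝ) : ℝ :=
  if x ^ 2 < 1 / 2 then curlY (bumpRoot (curlU x)) else |x| * √(1 - x ^ 2)

theorem continuous_loopTop : Continuous loopTop := by
  have hsq : ∀ x : ℝ, |x| * √(1 - x ^ 2) ≤ 1 / 2 := by
    intro x
    rcases le_total (x ^ 2) 1 with h | h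
    · have h1 := Real.sq_sqrt (show 0 ≤ 1 - x ^ 2 by linarith)
      have h2 := sq_abs x
      nlinarith [sq_nonneg (|x| - √(1 - x ^ 2))]
    -- Beyond x² = 1 the square root takes the default value 0.
    · rw [Real.sqrt_eq_zero_of_nonpos (by linarith)]
      norm_num
  -- The smoothed arc runs between the lemniscate and its maximal height 1/2, which is attained at
  -- x² = 1/2, at the corners of the disk.
  refine continuous_ite_of_squeeze (lo := fun x => |x| * √(1 - x ^ 2)) (M := 1 / 2) ?_
    (by fun_prop) (by fun_prop) ?_ ?_ (fun x _ => le_rfl) (fun x _ => hsq x) ?_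
  · intro x hx
    exact (continuous_curlY.comp continuous_bumpRoot).continuousAt.comp (continuousAt_curlU hx)
  · intro x hx
    have h1 := curlY_sq_le_iff.2 (sq_le_bumpRoot_sq (curlU x))
    rw [← curlX_sq_sub, curlX_curlU hx] at h1
    refine le_of_sq_le_sq ?_ (curlY_pos (bumpRoot_pos _)).le
    rw [mul_pow, sq_abs, Real.sq_sqrt (by linarith)]
    linarith
  · intro x _
    have := curlY_sq_lt (bumpRoot (curlU x))
    nlinarith [curlY_pos (bumpRoot_pos (curlU x))]
  · intro x hx
    rw [← Real.sqrt_sq_eq_abs, ← Real.sqrt_mul (sq_nonneg x), hx]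
    rw [show (1 / 2 * (1 - 1 / 2) : ℝ) = (1 / 2) ^ 2 by norm_num, Real.sqrt_sq (by norm_num)]

theorem smoothedFigureEight_true : smoothedFigureEight true =
    {x | |x 0| ≤ 1 ∧ (x 1 = -loopTop (x 0) ∨ x 1 = loopTop (x 0))} := by
  ext x
  rw [smoothedFigureEight, if_pos rfl, mem_union, mem_curlDisk_image_iff, mem_sdiff,
    mem_curlDisk_target, mem_arcs_iff]
  have hsymm1 : (curlDisk 0).symm x 1 = curlV (x 1) := rfl
  have hsymm0 : (curlDisk 0).symm x 0 = curlU (x 0) := rfl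
  have hfe : x ∈ figureEight ↔ x 1 ^ 2 = x 0 ^ 2 - x 0 ^ 4 := Iff.rfl
  simp only [hsymm0, hsymm1, hfe, PiLp.zero_apply, sub_zero, mem_ofPred_eq]
  by_cases h : x 0 ^ 2 < 1 / 2
  · have h0 : |x 0| ≤ 1 := (sq_le_one_iff_abs_le_one _).1 (by linarith)
    -- Where x² < 1/2, the lemniscate has y² = 1/4 - (x² - 1/2)² < 1/4, so it lies entirely in the
    -- disk.
    have h1 : ¬ (x 1 ^ 2 = x 0 ^ 2 - x 0 ^ 4 ∧ ¬ (x 0 ^ 2 < 1 / 2 ∧ x 1 ^ 2 < 1 / 4)) := by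
      rintro ⟨h1, h2⟩
      exact h2 ⟨h, by nlinarith [sq_nonneg (x 0 ^ 2 - 1 / 2)]⟩
    have hg : loopTop (x 0) = curlY (bumpRoot (curlU (x 0))) := if_pos h
    rw [hg]
    constructor
    · rintro (h2 | ⟨⟨-, h2⟩, h3⟩)
      · exact (h1 h2).elim
      · refine ⟨h0, ?_⟩
        rw [← curlY_curlV h2, ← curlY_neg]
        exact h3.imp (congrArg curlY) (congrArg curlY)
    · rintro ⟨-, h2⟩
      refine Or.inr ⟨⟨h, ?_⟩, ?_⟩
      · rcases h2 with h2 | h2 <;> rw [h2]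
        · rw [neg_sq]
          exact curlY_sq_lt _
        · exact curlY_sq_lt _
      · rcases h2 with h2 | h2 <;> rw [h2]
        · rw [← curlY_neg, curlV_curlY]
          exact Or.inl rfl
        · rw [curlV_curlY]
          exact Or.inr rfl
  · have hg : loopTop (x 0) = |x 0| * √(1 - x 0 ^ 2) := if_neg h
    simp only [h, false_and, not_false_eq_true, and_true, or_false, hg]
    constructor
    · intro h1
      have h2 : x 0 ^ 2 ≤ 1 := by nlinarith [sq_nonneg (x 1), not_lt.1 h]
      refine ⟨(sq_le_one_iff_abs_le_one _).1 h2, ?_⟩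
      rw [or_comm, ← sq_eq_sq_iff_eq_or_eq_neg, mul_pow, Real.sq_sqrt (by linarith), sq_abs, h1]
      ring
    · rintro ⟨h1, h2⟩
      have h3 := (sq_le_one_iff_abs_le_one _).2 h1
      rw [or_comm, ← sq_eq_sq_iff_eq_or_eq_neg, mul_pow, Real.sq_sqrt (by linarith), sq_abs] at h2
      rw [h2]
      ring

theorem boundsDisk_smoothedFigureEight_true : BoundsDisk (smoothedFigureEight true) := by
  rw [smoothedFigureEight_true]
  refine boundsDisk_of_graphs (i := 1) (j := 0) (by decide) one_pos continuous_loopTop.neg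
    continuous_loopTop ?_ ?_
  · intro y hy
    have hy' := (sq_lt_one_iff_abs_lt_one _).2 hy
    have : 0 < loopTop y := by
      unfold loopTop
      split_ifs with h
      · exact curlY_pos (bumpRoot_pos _)
      · have h1 : 0 < |y| := abs_pos.2 fun h0 => by norm_num [h0] at h
        have h2 : 0 < √(1 - y ^ 2) := Real.sqrt_pos.2 (by linarith)
        positivity
    exact (neg_neg_of_pos this).trans this
  · intro y hy
    have h1 : y ^ 2 = 1 := by rw [← sq_abs, hy, one_pow]
    have : loopTop y = 0 := by
      unfold loopTop
      rw [h1]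
      norm_num
    rw [Pi.neg_apply, this, neg_zero]

/-- The inner side of the right component of the disconnected smoothing of the figure eight. -/
noncomputable def loopInner (y : ℝ) : ℝ :=
  if y ^ 2 < 1 / 4 then curlX (bumpRoot (curlV y)) else √(1 / 2)

/-- The outer side of the right component of the disconnected smoothing of the figure eight. -/
noncomputable def loopOuter (y : ℝ) : ℝ := √(1 / 2 + √(1 / 4 - y ^ 2))

theorem continuous_loopOuter : Continuous loopOuter := by
  unfold loopOuter
  fun_prop

theorem loopOuter_sq (y : ℝ) : loopOuter y ^ 2 = 1 / 2 + √(1 / 4 - y ^ 2) :=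
  Real.sq_sqrt (by positivity)

theorem curlX_bumpRoot_lt (s : ℝ) : curlX (bumpRoot s) < √(1 / 2) :=
  Real.lt_sqrt_of_sq_lt (curlX_sq_lt _)

/-- The arc lies between the inner branch x² = 1/2 - √(1/4 - y²) of the lemniscate and the line x =
√(1/2), which meet at y² = 1/4. The constant beyond only serves continuity on the whole line. -/
theorem continuous_loopInner : Continuous loopInner := by
  refine continuous_ite_of_squeeze (lo := fun y => √(1 / 2 - √(1 / 4 - y ^ 2))) (M := √(1 / 2)) ?_
    (by fun_prop) (by fun_prop) ?_ ?_ ?_ (fun x _ => le_rfl) ?_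
  · intro y hy
    exact (continuous_curlX.comp continuous_bumpRoot).continuousAt.comp (continuousAt_curlV hy)
  · intro y hy
    have h1 := curlX_sq_le_of_sq_le (sq_le_bumpRoot_sq (curlV y))
    rw [curlX_sq_of_curlY_sq (curlV y), curlY_curlV hy] at h1
    exact Real.sqrt_le_iff.2 ⟨(curlX_pos (bumpRoot_pos _)).le, h1⟩
  · intro y _
    exact (curlX_bumpRoot_lt _).le
  · intro y _
    exact Real.sqrt_le_sqrt (by linarith [Real.sqrt_nonneg (1 / 4 - y ^ 2)])
  · intro y hy
    rw [hy]
    simp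

theorem loopInner_pos (y : ℝ) : 0 < loopInner y := by
  unfold loopInner
  split_ifs
  · exact curlX_pos (bumpRoot_pos _)
  · exact Real.sqrt_pos.2 (by norm_num)

theorem loopOuter_pos (y : ℝ) : 0 < loopOuter y := Real.sqrt_pos.2 (by positivity)

/-- The right (`s = 1`) or left (`s = -1`) component of the disconnected smoothing of the figure
eight. -/
def sideLoop (s : ℝ) : Set Plane :=
  {x | |x 1| ≤ 1 / 2 ∧ (s * x 0 = loopInner (x 1) ∨ s * x 0 = loopOuter (x 1))}

/-- Solved for x², the lemniscate has two branches 1/2 ± √(1/4 - y²). The outer one avoids the disk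
and is kept; the inner one is replaced by the arcs, except at y² = 1/4, where the two branches meet.
-/
theorem smoothedFigureEight_false :
    smoothedFigureEight false = sideLoop 1 ∪ sideLoop (-1) := by
  have hhalf : √(1 / 2 : ℝ) ^ 2 = 1 / 2 := Real.sq_sqrt (by norm_num)
  ext x
  have hside : x ∈ sideLoop 1 ∪ sideLoop (-1) ↔ |x 1| ≤ 1 / 2 ∧
      (x 0 ^ 2 = loopInner (x 1) ^ 2 ∨ x 0 ^ 2 = loopOuter (x 1) ^ 2) := by
    simp only [sideLoop, mem_union, mem_ofPred_eq, sq_eq_sq_iff_eq_or_eq_neg, one_mul, neg_mul,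
      neg_eq_iff_eq_neg]
    tauto
  rw [hside, smoothedFigureEight, if_neg (by decide), mem_union, mem_curlDisk_image_iff, mem_sdiff,
    mem_curlDisk_target, mem_arcs_iff, loopOuter_sq]
  have hsymm1 : (curlDisk 0).symm x 1 = curlV (x 1) := rfl
  have hsymm0 : (curlDisk 0).symm x 0 = curlU (x 0) := rfl
  have hfe : x ∈ figureEight ↔ x 1 ^ 2 = x 0 ^ 2 - x 0 ^ 4 := Iff.rfl
  have habs : |x 1| ≤ 1 / 2 ↔ x 1 ^ 2 ≤ 1 / 4 := by
    rw [← sq_le_sq₀ (abs_nonneg _) (by norm_num), sq_abs]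
    norm_num
  simp only [hsymm0, hsymm1, hfe, PiLp.zero_apply, sub_zero, habs]
  constructor
  · rintro (⟨h1, h2⟩ | ⟨⟨h1, h2⟩, h3⟩)
    · have h3 : x 1 ^ 2 ≤ 1 / 4 := by nlinarith [sq_nonneg (x 0 ^ 2 - 1 / 2)]
      have h4 : 1 / 2 ≤ x 0 ^ 2 := by
        by_contra h
        refine h2 ⟨not_le.1 h, lt_of_le_of_ne h3 fun h5 => h ?_⟩
        nlinarith [sq_nonneg (x 0 ^ 2 - 1 / 2)]
      refine ⟨h3, Or.inr ?_⟩
      rw [h1, show 1 / 4 - (x 0 ^ 2 - x 0 ^ 4) = (x 0 ^ 2 - 1 / 2) ^ 2 by ring,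
        Real.sqrt_sq (by linarith)]
      ring
    · refine ⟨h2.le, Or.inl ?_⟩
      have hg : loopInner (x 1) = curlX (bumpRoot (curlV (x 1))) := if_pos h2
      rw [hg, ← curlX_curlU h1]
      rcases h3 with h3 | h3 <;> rw [h3]
      rw [curlX_neg, neg_sq]
  · rintro ⟨h1, h2⟩
    have houter : x 0 ^ 2 = 1 / 2 + √(1 / 4 - x 1 ^ 2) → x 1 ^ 2 = x 0 ^ 2 - x 0 ^ 4 ∧
        ¬ (x 0 ^ 2 < 1 / 2 ∧ x 1 ^ 2 < 1 / 4) := by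
      intro h3
      have h4 := Real.sq_sqrt (show 0 ≤ 1 / 4 - x 1 ^ 2 by linarith)
      have h5 : √(1 / 4 - x 1 ^ 2) = x 0 ^ 2 - 1 / 2 := by linarith
      rw [h5] at h4
      refine ⟨by linarith [h4], ?_⟩
      rintro ⟨h6, -⟩
      linarith [Real.sqrt_nonneg (1 / 4 - x 1 ^ 2)]
    rcases h2 with h2 | h2
    · by_cases h3 : x 1 ^ 2 < 1 / 4
      · have hg : loopInner (x 1) = curlX (bumpRoot (curlV (x 1))) := if_pos h3
        rw [hg] at h2
        refine Or.inr ⟨⟨?_, h3⟩, ?_⟩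
        · rw [h2]
          exact curlX_sq_lt _
        · rcases sq_eq_sq_iff_eq_or_eq_neg.1 h2 with h4 | h4
          · rw [h4, curlU_curlX]
            exact Or.inr rfl
          · rw [h4, ← curlX_neg, curlU_curlX]
            exact Or.inl rfl
      · have hg : loopInner (x 1) = √(1 / 2) := if_neg h3
        have h4 : x 1 ^ 2 = 1 / 4 := le_antisymm h1 (not_lt.1 h3)
        refine Or.inl (houter ?_)
        rw [h2, hg, hhalf, h4]
        simp
    · exact Or.inl (houter h2)

theorem loopInner_lt_loopOuter {y : ℝ} (hy : |y| < 1 / 2) : loopInner y < loopOuter y := by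
  have hy' : y ^ 2 < 1 / 4 := by
    rw [← sq_abs]
    nlinarith [abs_nonneg y]
  have hg : loopInner y = curlX (bumpRoot (curlV y)) := if_pos hy'
  rw [hg]
  refine (curlX_bumpRoot_lt _).trans_le (Real.sqrt_le_sqrt ?_)
  linarith [Real.sqrt_nonneg (1 / 4 - y ^ 2)]

theorem loopInner_eq_loopOuter {y : ℝ} (hy : |y| = 1 / 2) : loopInner y = loopOuter y := by
  have hy' : y ^ 2 = 1 / 4 := by
    rw [← sq_abs, hy]
    norm_num
  rw [loopInner, loopOuter, hy']
  norm_num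

theorem boundsDisk_sideLoop_one : BoundsDisk (sideLoop 1) := by
  have := boundsDisk_of_graphs (i := 0) (j := 1) (by decide) (d := 1 / 2) (by norm_num)
    continuous_loopInner continuous_loopOuter (fun y => loopInner_lt_loopOuter)
    (fun y => loopInner_eq_loopOuter)
  simpa only [sideLoop, one_mul] using this

theorem boundsDisk_sideLoop_neg_one : BoundsDisk (sideLoop (-1)) := by
  have := boundsDisk_of_graphs (i := 0) (j := 1) (by decide) (d := 1 / 2) (by norm_num)
    continuous_loopOuter.neg continuous_loopInner.neg
    (fun y hy => neg_lt_neg (loopInner_lt_loopOuter hy))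
    (fun y hy => congrArg Neg.neg (loopInner_eq_loopOuter hy).symm)
  simp only [Pi.neg_apply, or_comm (a := _ = -loopOuter _)] at this
  simpa only [sideLoop, neg_mul, one_mul, neg_eq_iff_eq_neg] using this

theorem disjoint_sideLoop : Disjoint (sideLoop 1) (sideLoop (-1)) := by
  rw [disjoint_left]
  rintro x ⟨-, h⟩ ⟨-, h'⟩
  have := loopInner_pos (x 1)
  have := loopOuter_pos (x 1)
  rcases h with h | h <;> rcases h' with h' | h' <;> linarith

theorem abs_le_one_of_mem_smoothedFigureEight {m : Bool} {x : Plane}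
    (hx : x ∈ smoothedFigureEight m) : |x 0| ≤ 1 := by
  rw [← sq_le_one_iff_abs_le_one]
  rcases hx with ⟨hx, -⟩ | hx
  · have hx' : x 1 ^ 2 = x 0 ^ 2 - x 0 ^ 4 := hx
    by_contra h
    nlinarith [sq_nonneg (x 1), not_le.1 h]
  · rw [mem_curlDisk_image_iff] at hx
    linarith [hx.1.1]

end PlaneCurves

/-! ## Graphs are properly embedded curves -/

section Straightening

/-- The shear by g flattens the graph. Positivity of the first coordinate is included because the
charts of F take values in the half plane. -/
theorem exists_straightening_of_graph {i j : Fin 2} (hij : i ≠ j) {S U : Set Plane}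
    (hU : IsOpen U) {x : Plane} (hx : x ∈ U) {g : ℝ → ℝ} {I : Set ℝ} (hI : IsOpen I)
    (hg : ContDiffOn ℝ ∞ g I) (hS : ∀ y ∈ U, y j ∈ I ∧ (y ∈ S ↔ y i = g (y j))) :
    ∃ Φ : OpenPartialHomeomorph Plane Plane, x ∈ Φ.source ∧ ContDiffOn ℝ ∞ Φ Φ.source ∧
      ContDiffOn ℝ ∞ Φ.symm Φ.target ∧
      ∀ y ∈ Φ.source, 0 < Φ y 0 ∧ (y ∈ S ↔ Φ y 1 = 0) := by
  -- With this shift the first new coordinate of x is 1.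
  set c : ℝ := x j - 1 with hc
  have hk : ∀ k : Fin 2, k = i ∨ k = j := by
    intro k
    fin_cases i <;> fin_cases j <;> fin_cases k <;> simp_all
  have hto : ContDiffOn ℝ ∞ (fun y : Plane => (!₂[y j - c, y i - g (y j)] : Plane))
      {y | y j ∈ I ∧ c < y j} := by
    have h1 : ContDiffOn ℝ ∞ (fun y : Plane => g (y j)) {y | y j ∈ I ∧ c < y j} :=
      hg.comp (f := fun y : Plane => y j) (by fun_prop) fun y hy => hy.1
    rw [contDiffOn_euclidean]
    intro k
    fin_cases k
    · show ContDiffOn ℝ ∞ (fun y : Plane => y j - c) _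
      fun_prop
    · show ContDiffOn ℝ ∞ (fun y : Plane => y i - g (y j)) _
      exact ContDiffOn.sub (by fun_prop) h1
  have hinv : ContDiffOn ℝ ∞ (fun z : Plane => (WithLp.toLp 2 fun k =>
      if k = i then z 1 + g (z 0 + c) else z 0 + c : Plane)) {z | z 0 + c ∈ I ∧ 0 < z 0} := by
    have h1 : ContDiffOn ℝ ∞ (fun z : Plane => g (z 0 + c)) {z | z 0 + c ∈ I ∧ 0 < z 0} :=
      hg.comp (f := fun z : Plane => z 0 + c) (by fun_prop) fun y hy => hy.1
    rw [contDiffOn_euclidean]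
    intro k
    show ContDiffOn ℝ ∞ (fun z : Plane => if k = i then z 1 + g (z 0 + c) else z 0 + c) _
    split_ifs
    · exact ContDiffOn.add (by fun_prop) h1
    · fun_prop
  let Φ : OpenPartialHomeomorph Plane Plane :=
    { toFun := fun y => !₂[y j - c, y i - g (y j)]
      invFun := fun z => WithLp.toLp 2 fun k => if k = i then z 1 + g (z 0 + c) else z 0 + c
      source := {y | y j ∈ I ∧ c < y j}
      target := {z | z 0 + c ∈ I ∧ 0 < z 0}
      map_source' := by
        rintro y ⟨h1, h2⟩
        simpa using ⟨h1, h2⟩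
      map_target' := by
        rintro z ⟨h1, h2⟩
        simp only [mem_ofPred_eq, hij.symm, if_false]
        exact ⟨h1, by linarith⟩
      left_inv' := by
        rintro y -
        ext k
        rcases hk k with rfl | rfl
        · simp
        · simp [hij.symm]
      right_inv' := by
        rintro z -
        ext k
        fin_cases k
        · simp [hij.symm]
        · simp [hij.symm]
      open_source := by
        have h1 : Continuous fun y : Plane => y j := by fun_prop
        exact (hI.preimage h1).inter (isOpen_lt continuous_const h1)
      open_target := by
        have h1 : Continuous fun z : Plane => z 0 + c := by fun_prop
        have h2 : Continuous fun z : Plane => z 0 := by fun_prop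
        exact (hI.preimage h1).inter (isOpen_lt continuous_const h2)
      continuousOn_toFun := hto.continuousOn
      continuousOn_invFun := hinv.continuousOn }
  have hsource : (Φ.restr U).source = Φ.source ∩ U := Φ.restr_source' _ hU
  refine ⟨Φ.restr U, ?_, ?_, ?_, ?_⟩
  · rw [hsource]
    exact ⟨⟨(hS x hx).1, by linarith⟩, hx⟩
  · rw [hsource]
    exact hto.mono inter_subset_left
  · exact hinv.mono fun z hz => hz.1
  · intro y hy
    rw [hsource] at hy
    refine ⟨?_, ?_⟩
    · show 0 < y j - c
      linarith [hy.1.2]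
    · rw [(hS y hy.2).2]
      show _ ↔ y i - g (y j) = 0
      rw [sub_eq_zero]

/-- The tangent is vertical only at (±1, 0). There x is written as a function of y, and at all other
points except the origin y as a function of x. -/
theorem figureEight_isGraph {x : Plane} (hx : x ∈ figureEight) (h0 : x ≠ 0) :
    ∃ (i j : Fin 2) (U : Set Plane) (I : Set ℝ) (g : ℝ → ℝ), i ≠ j ∧ IsOpen U ∧ x ∈ U ∧
      IsOpen I ∧ ContDiffOn ℝ ∞ g I ∧
      ∀ y ∈ U, y j ∈ I ∧ (y ∈ figureEight ↔ y i = g (y j)) := by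
  have hsign : ∀ t : ℝ, t ≠ 0 → ∃ s : ℝ, s * s = 1 ∧ 0 < s * t := by
    intro t ht
    rcases lt_or_gt_of_ne ht with h | h
    · exact ⟨-1, by norm_num, by linarith⟩
    · exact ⟨1, by norm_num, by linarith⟩
  have hroot : ∀ s t a : ℝ, s * s = 1 → 0 < s * t → 0 ≤ a → (t ^ 2 = a ↔ t = s * √a) := by
    intro s t a hs ht ha
    have h1 : t ^ 2 = (s * t) ^ 2 := by rw [mul_pow, sq s, hs, one_mul]
    have h2 : t = s * √a ↔ s * t = √a := by
      constructor
      · intro h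
        rw [h, ← mul_assoc, hs, one_mul]
      · intro h
        rw [← h, ← mul_assoc, hs, one_mul]
    rw [h1, h2, eq_comm (a := s * t), Real.sqrt_eq_iff_eq_sq ha ht.le, eq_comm]
  have hx' : x 1 ^ 2 = x 0 ^ 2 - x 0 ^ 4 := hx
  by_cases h1 : x 1 = 0
  · have h2 : x 0 ≠ 0 := by
      intro h
      exact h0 (plane_ext (i := 0) (j := 1) (by decide) h h1)
    have h3 : x 0 ^ 2 = 1 := by
      rw [h1] at hx'
      have : x 0 ^ 2 * (x 0 ^ 2 - 1) = 0 := by linarith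
      rcases mul_eq_zero.1 this with h | h
      · exact (h2 (pow_eq_zero_iff two_ne_zero |>.1 h)).elim
      · linarith
    obtain ⟨s, hs, hsx⟩ := hsign _ h2
    refine ⟨0, 1, {y | 1 / 2 < y 0 ^ 2} ∩ ({y | 0 < s * y 0} ∩ {y | y 1 ^ 2 < 1 / 4}),
      {t | t ^ 2 < 1 / 4}, fun t => s * √(1 / 2 + √(1 / 4 - t ^ 2)), by decide, ?_, ?_, ?_, ?_, ?_⟩
    · exact (isOpen_lt (by fun_prop) (by fun_prop)).inter
        ((isOpen_lt (by fun_prop) (by fun_prop)).inter (isOpen_lt (by fun_prop) (by fun_prop)))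
    · refine ⟨?_, hsx, ?_⟩
      · show 1 / 2 < x 0 ^ 2
        rw [h3]
        norm_num
      · show x 1 ^ 2 < 1 / 4
        rw [h1]
        norm_num
    · exact isOpen_lt (by fun_prop) (by fun_prop)
    · refine contDiffOn_const.mul (ContDiffOn.sqrt (contDiffOn_const.add
        (ContDiffOn.sqrt (by fun_prop) ?_)) ?_)
      · intro t ht
        have : t ^ 2 < 1 / 4 := ht
        exact (by linarith : (0 : ℝ) < 1 / 4 - t ^ 2).ne'
      · intro t _
        positivity
    · rintro y ⟨hy1, hy2, hy3⟩
      have hy1' : 1 / 2 < y 0 ^ 2 := hy1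
      have hy3' : y 1 ^ 2 < 1 / 4 := hy3
      refine ⟨hy3, ?_⟩
      rw [← hroot s (y 0) _ hs hy2 (by positivity)]
      show y 1 ^ 2 = y 0 ^ 2 - y 0 ^ 4 ↔ _
      constructor
      · intro h
        rw [h, show 1 / 4 - (y 0 ^ 2 - y 0 ^ 4) = (y 0 ^ 2 - 1 / 2) ^ 2 by ring,
          Real.sqrt_sq (by linarith)]
        ring
      · intro h
        have h4 := Real.sq_sqrt (show 0 ≤ 1 / 4 - y 1 ^ 2 by linarith)
        rw [show √(1 / 4 - y 1 ^ 2) = y 0 ^ 2 - 1 / 2 by linarith] at h4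
        linarith
  · obtain ⟨s, hs, hsx⟩ := hsign _ h1
    refine ⟨1, 0, {y | 0 < y 0 ^ 2 - y 0 ^ 4} ∩ {y | 0 < s * y 1},
      {t | 0 < t ^ 2 - t ^ 4}, fun t => s * √(t ^ 2 - t ^ 4), by decide, ?_, ?_, ?_, ?_, ?_⟩
    · exact (isOpen_lt (by fun_prop) (by fun_prop)).inter (isOpen_lt (by fun_prop) (by fun_prop))
    · refine ⟨?_, hsx⟩
      show 0 < x 0 ^ 2 - x 0 ^ 4
      rw [← hx']
      positivity
    · exact isOpen_lt (by fun_prop) (by fun_prop)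
    · refine contDiffOn_const.mul (ContDiffOn.sqrt (by fun_prop) ?_)
      intro t ht
      exact (show (0 : ℝ) < t ^ 2 - t ^ 4 from ht).ne'
    · rintro y ⟨hy1, hy2⟩
      exact ⟨hy1, hroot s (y 1) _ hs hy2 (le_of_lt hy1)⟩

variable {F : Type*} [TopologicalSpace F] [ChartedSpace (EuclideanHalfSpace 2) F]
  [IsManifold (𝓡∂ 2) ∞ F] {o : SurfaceOrientation F}

theorem IsOrientedDisk.mem_target {e : OpenPartialHomeomorph Plane F} (he : IsOrientedDisk o e)
    (x : Plane) : e x ∈ e.target :=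
  e.map_source (he.source_eq ▸ mem_univ _)

theorem IsOrientedDisk.left_inv {e : OpenPartialHomeomorph Plane F} (he : IsOrientedDisk o e)
    (x : Plane) : e.symm (e x) = x :=
  e.left_inv (he.source_eq ▸ mem_univ _)

theorem IsOrientedDisk.injective {e : OpenPartialHomeomorph Plane F} (he : IsOrientedDisk o e) :
    Function.Injective e :=
  Function.LeftInverse.injective he.left_inv

/-- The required chart is the inverse of e, followed by Φ and by the inclusion of the open half
plane into the closed one. -/
theorem IsOrientedDisk.locallyLine_of_straightening {e : OpenPartialHomeomorph Plane F}
    (he : IsOrientedDisk o e) {S : Set F} {x : Plane} {Φ : OpenPartialHomeomorph Plane Plane}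
    (hx : x ∈ Φ.source) (hΦ : ContDiffOn ℝ ∞ Φ Φ.source) (hΦ' : ContDiffOn ℝ ∞ Φ.symm Φ.target)
    (hΦS : ∀ y ∈ Φ.source, 0 < Φ y 0 ∧ (y ∈ e ⁻¹' S ↔ Φ y 1 = 0)) : LocallyLine S (e x) := by
  refine ⟨(e.symm.trans Φ).trans halfPlaneChart, ?_, ?_, ?_⟩
  · apply OpenPartialHomeomorph.mem_maximalAtlas_of_contMDiffOn
    · rw [OpenPartialHomeomorph.coe_trans, OpenPartialHomeomorph.coe_trans]
      refine ContMDiffOn.comp (I' := 𝓡 2) (t := {x | 0 < x 0})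
        ((𝓡∂ 2).contMDiffOn_symm.mono ?_) (ContMDiffOn.comp (I' := 𝓡 2) (t := Φ.source)
          hΦ.contMDiffOn (he.smooth_symm.mono ?_) ?_) ?_
      · intro x hx
        rw [range_modelWithCornersEuclideanHalfSpace]
        exact le_of_lt (α := ℝ) hx
      · intro x hx
        exact hx.1.1
      · intro x hx
        exact hx.1.2
      · intro x hx
        exact hx.2
    · have : (((e.symm.trans Φ).trans halfPlaneChart).symm : EuclideanHalfSpace 2 → F) =
          (e ∘ Φ.symm) ∘ (𝓡∂ 2) := rfl
      rw [this]
      refine ContMDiffOn.comp (I' := 𝓡 2) (t := Φ.target)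
        (he.smooth.comp_contMDiffOn hΦ'.contMDiffOn) (𝓡∂ 2).contMDiff.contMDiffOn ?_
      intro x hx
      exact hx.2.1
  · have h : e.symm (e x) ∈ Φ.source := by rwa [he.left_inv]
    exact ⟨⟨he.mem_target x, h⟩, (hΦS _ h).1⟩
  · rintro y ⟨⟨hy1, hy2⟩, hy3⟩
    have hy2' : e.symm y ∈ Φ.source := hy2
    have hy3' : 0 < Φ (e.symm y) 0 := hy3
    have h := (hΦS _ hy2').2
    rw [mem_preimage, e.right_inv hy1] at h
    rw [h]
    show _ ↔ ((𝓡∂ 2).symm (Φ (e.symm y))).1 1 = 0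
    rw [show ((𝓡∂ 2).symm (Φ (e.symm y))).1 = Φ (e.symm y) from right_inv_halfPlane hy3']

theorem IsOrientedDisk.trans {e : OpenPartialHomeomorph Plane F} (he : IsOrientedDisk o e)
    {g : OpenPartialHomeomorph Plane Plane} (hs : g.source = univ) (hg : ContDiff ℝ ∞ g)
    (hg' : ContDiffOn ℝ ∞ g.symm g.target) (hdet : ∀ x, 0 < (fderiv ℝ g x).det) :
    IsOrientedDisk o (g.trans e) where
  source_eq := by
    rw [OpenPartialHomeomorph.trans_source, hs, he.source_eq]
    simp
  smooth := he.smooth.comp hg.contMDiff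
  smooth_symm := by
    refine ContMDiffOn.comp (I' := 𝓡 2) (t := g.target) hg'.contMDiffOn (he.smooth_symm.mono ?_) ?_
    · exact fun x hx => hx.1
    · exact fun x hx => hx.2
  target_subset := fun x hx => he.target_subset hx.1
  oriented := by
    intro x
    have h1 : MDifferentiableAt (𝓡 2) (𝓡∂ 2) e (g x) :=
      he.smooth.mdifferentiableAt (by simp)
    have h2 : DifferentiableAt ℝ g x := hg.differentiable (by simp) x
    have h3 : mfderiv (𝓡 2) (𝓡∂ 2) (g.trans e) x =
        (mfderiv (𝓡 2) (𝓡∂ 2) e (g x)).comp (mfderiv (𝓡 2) (𝓡 2) g x) :=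
      mfderiv_comp x h1 h2.mdifferentiableAt
    rw [h3, mfderiv_eq_fderiv]
    have h4 : ContinuousLinearMap.det (M := Plane) (R := ℝ)
        ((mfderiv (𝓡 2) (𝓡∂ 2) e (g x) : Plane →L[ℝ] Plane).comp (fderiv ℝ g x)) =
        ContinuousLinearMap.det (M := Plane) (R := ℝ) (mfderiv (𝓡 2) (𝓡∂ 2) e (g x)) *
          (fderiv ℝ g x).det := LinearMap.det_comp _ _
    have h5 := mul_pos (he.oriented (g x)) (hdet x)
    rw [mul_assoc] at h5
    exact lt_of_lt_of_eq h5 (congrArg _ h4.symm)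

theorem IsInessential.of_boundsDisk {e : OpenPartialHomeomorph Plane F}
    (he : IsOrientedDisk o e) {K : Set Plane} (hK : BoundsDisk K) : IsInessential (e '' K) := by
  obtain ⟨f, hf, hf', rfl⟩ := hK
  refine ⟨?_, e ∘ f, he.smooth.continuous.comp_continuousOn hf,
    he.injective.comp_injOn hf', image_comp _ _ _⟩
  refine (ModelWithCorners.disjoint_interior_boundary (I := 𝓡∂ 2) (M := F)).mono_left ?_
  rintro _ ⟨x, -, rfl⟩
  exact he.target_subset (he.mem_target x)

end Straightening

/-! ## Connected components of finite unions -/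

section Components

/-- By finiteness the union of the other pieces is closed too, so a connected set that meets one
piece cannot leave it. -/
theorem components_iUnion {X κ : Type*} [TopologicalSpace X] [Finite κ]
    {C : κ → Set X} (hc : ∀ k, IsClosed (C k)) (hp : ∀ k, IsPreconnected (C k))
    (hn : ∀ k, (C k).Nonempty) (hd : Pairwise (Function.onFun Disjoint C)) :
    {K | ∃ x ∈ ⋃ k, C k, K = connectedComponentIn (⋃ k, C k) x} = range C := by
  have key : ∀ k, ∀ x ∈ C k, connectedComponentIn (⋃ k, C k) x = C k := by
    intro k x hx
    have hxU : x ∈ ⋃ k, C k := mem_iUnion.2 ⟨k, hx⟩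
    apply Subset.antisymm
    · have hcl : IsClosed (⋃ l : {l // l ≠ k}, C l) := isClosed_iUnion_of_finite fun l => hc l
      have hdis : Disjoint (C k) (⋃ l : {l // l ≠ k}, C l) :=
        disjoint_iUnion_right.2 fun l => hd l.2.symm
      have hsub : connectedComponentIn (⋃ k, C k) x ⊆ C k ∪ ⋃ l : {l // l ≠ k}, C l := by
        intro y hy
        obtain ⟨l, hl⟩ := mem_iUnion.1 (connectedComponentIn_subset _ _ hy)
        by_cases h : l = k
        · exact Or.inl (h ▸ hl)
        · exact Or.inr (mem_iUnion.2 ⟨⟨l, h⟩, hl⟩)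
      rcases isPreconnected_iff_subset_of_disjoint_closed.1
        (isPreconnected_connectedComponentIn (F := ⋃ k, C k) (x := x)) _ _ (hc k) hcl hsub
        (by rw [hdis.inter_eq, inter_empty]) with h | h
      · exact h
      · exact (disjoint_left.1 hdis hx (h (mem_connectedComponentIn hxU))).elim
    · exact (hp k).subset_connectedComponentIn hx (subset_iUnion C k)
  ext K
  constructor
  · rintro ⟨x, hx, rfl⟩
    obtain ⟨k, hk⟩ := mem_iUnion.1 hx
    exact ⟨k, (key k x hk).symm⟩
  · rintro ⟨k, rfl⟩
    obtain ⟨x, hx⟩ := hn k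
    exact ⟨x, mem_iUnion.2 ⟨k, hx⟩, (key k x hx).symm⟩

theorem BoundsDisk.isConnected {K : Set Plane} (hK : BoundsDisk K) : IsConnected K := by
  obtain ⟨f, hf, -, rfl⟩ := hK
  refine IsConnected.image (isConnected_sphere ?_ 0 zero_le_one) f
    (hf.mono Metric.sphere_subset_closedBall)
  rw [← Module.finrank_eq_rank, finrank_euclideanSpace_fin]
  norm_num

theorem BoundsDisk.isCompact {K : Set Plane} (hK : BoundsDisk K) : IsCompact K := by
  obtain ⟨f, hf, -, rfl⟩ := hK
  exact (isCompact_sphere 0 1).image_of_continuousOn (hf.mono Metric.sphere_subset_closedBall)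

theorem BoundsDisk.translate {K : Set Plane} (hK : BoundsDisk K) (c : Plane) :
    BoundsDisk ((fun x => x + c) '' K) := by
  obtain ⟨f, hf, hf', rfl⟩ := hK
  exact ⟨fun x => f x + c, hf.add continuousOn_const,
    fun x hx y hy h => hf' hx hy (add_right_cancel h), image_comp (fun x => x + c) f _⟩

end Components

/-! ## Rows of closed curves in the plane -/

section Rows

/-- The center of the `i`-th curve in a row. -/
noncomputable def center (i : ℕ) : Plane := !₂[3 * (i : ℝ), 0]

@[simp] theorem center_zero (i : ℕ) : center i 0 = 3 * (i : ℝ) := rfl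

/-- A row of `c` subsets of the plane. -/
def row (c : ℕ) (A : ℕ → Set Plane) : Set Plane :=
  {y | ∃ i < c, y - center i ∈ A i}

/-- The centers have distance 3, so the open strips of half-width 3/2 are disjoint. The figure
eights and their disks have half-width at most 1 and fit into them. -/
theorem eq_of_abs_sub_center {i j : ℕ} {y : Plane} (hi : |(y - center i) 0| < 3 / 2)
    (hj : |(y - center j) 0| < 3 / 2) : i = j := by
  simp only [PiLp.sub_apply, center_zero] at hi hj
  rw [abs_lt] at hi hj
  have h1 : (i : ℝ) < j + 1 := by linarith
  have h2 : (j : ℝ) < i + 1 := by linarith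
  norm_cast at h1 h2
  omega

theorem mem_row_iff {c : ℕ} {A : ℕ → Set Plane} (hA : ∀ i, ∀ x ∈ A i, |x 0| ≤ 1) {i : ℕ}
    (hi : i < c) {y : Plane} (hy : |(y - center i) 0| < 3 / 2) :
    y ∈ row c A ↔ y - center i ∈ A i := by
  constructor
  · rintro ⟨j, -, hj⟩
    have := eq_of_abs_sub_center hy ((hA j _ hj).trans_lt (by norm_num))
    rwa [this]
  · exact fun h => ⟨i, hi, h⟩

theorem abs_le_one_of_mem_figureEight {x : Plane} (hx : x ∈ figureEight) : |x 0| ≤ 1 := by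
  have hx' : x 1 ^ 2 = x 0 ^ 2 - x 0 ^ 4 := hx
  rw [← sq_le_one_iff_abs_le_one]
  by_contra h
  nlinarith [sq_nonneg (x 1), not_le.1 h]

theorem isCompact_figureEight : IsCompact figureEight := by
  refine Metric.isCompact_of_isClosed_isBounded (isClosed_eq (by fun_prop) (by fun_prop)) ?_
  refine (Metric.isBounded_closedBall (x := (0 : Plane)) (r := 2)).subset ?_
  intro x hx
  have h1 := (sq_le_one_iff_abs_le_one _).2 (abs_le_one_of_mem_figureEight hx)
  have hx' : x 1 ^ 2 = x 0 ^ 2 - x 0 ^ 4 := hx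
  rw [mem_closedBall_zero_iff, ← sq_le_sq₀ (norm_nonneg _) (by norm_num),
    norm_sq_plane (i := 0) (j := 1) (by decide)]
  nlinarith [sq_nonneg (x 0 ^ 2)]

theorem row_eq_iUnion (c : ℕ) (A : ℕ → Set Plane) :
    row c A = ⋃ i : Fin c, (fun x => x + center i) '' A i := by
  ext y
  simp only [row, mem_ofPred_eq, mem_iUnion, mem_image]
  constructor
  · rintro ⟨i, hi, h⟩
    exact ⟨⟨i, hi⟩, _, h, sub_add_cancel _ _⟩
  · rintro ⟨i, x, hx, rfl⟩
    exact ⟨i, i.2, by rwa [add_sub_cancel_right]⟩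

theorem isCompact_row {c : ℕ} {A : ℕ → Set Plane} (hA : ∀ i, IsCompact (A i)) :
    IsCompact (row c A) := by
  rw [row_eq_iUnion]
  exact isCompact_iUnion fun i => (hA i).image (by fun_prop)

theorem row_figureEight_isGraph {c i : ℕ} (hi : i < c) {y : Plane}
    (hy : y - center i ∈ figureEight) (h0 : y ≠ center i) :
    ∃ Φ : OpenPartialHomeomorph Plane Plane, y ∈ Φ.source ∧ ContDiffOn ℝ ∞ Φ Φ.source ∧
      ContDiffOn ℝ ∞ Φ.symm Φ.target ∧
      ∀ z ∈ Φ.source, 0 < Φ z 0 ∧ (z ∈ row c (fun _ => figureEight) ↔ Φ z 1 = 0) := by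
  obtain ⟨k, l, U, I, g, hkl, hU, hyU, hI, hg, h⟩ := figureEight_isGraph hy (sub_ne_zero.2 h0)
  have hcont : Continuous fun z : Plane => z - center i := by fun_prop
  -- Inside this strip no other curve of the row is visible.
  have hV : IsOpen {z : Plane | |(z - center i) 0| < 3 / 2} :=
    isOpen_lt (by fun_prop) continuous_const
  refine exists_straightening_of_graph hkl ((hU.preimage hcont).inter hV)
    ⟨hyU, (abs_le_one_of_mem_figureEight hy).trans_lt (by norm_num)⟩
    (I := (fun t => t - center i l) ⁻¹' I) (hI.preimage (by fun_prop))
    (g := fun t => g (t - center i l) + center i k) ?_ ?_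
  · exact (hg.comp (f := fun t => t - center i l) (by fun_prop) fun t ht => ht).add contDiffOn_const
  · rintro z ⟨hzU, hzV⟩
    have hz := h _ hzU
    refine ⟨hz.1, ?_⟩
    rw [mem_row_iff (fun _ _ => abs_le_one_of_mem_figureEight) hi hzV, hz.2, PiLp.sub_apply,
      PiLp.sub_apply, sub_eq_iff_eq_add]

theorem curlDisk_eq (c x : Plane) : curlDisk c x = curlDisk 0 x + c := by
  refine plane_ext (i := 0) (j := 1) (by decide) ?_ ?_
  · rw [PiLp.add_apply, curlDisk_zero, curlDisk_zero, PiLp.zero_apply]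
    ring
  · rw [PiLp.add_apply, curlDisk_one, curlDisk_one, PiLp.zero_apply]
    ring

theorem abs_curlDisk_sub_center (i : ℕ) (x : Plane) :
    |(curlDisk (center i) x - center i) 0| < 3 / 2 := by
  have h := curlX_sq_lt (x 0)
  rw [PiLp.sub_apply, curlDisk_zero, add_sub_cancel_left]
  exact abs_lt_of_sq_lt_sq (by linarith) (by norm_num)

theorem curlDisk_mem_row_iff {c : ℕ} {A : ℕ → Set Plane} (hA : ∀ i, ∀ x ∈ A i, |x 0| ≤ 1) {i : ℕ}
    (hi : i < c) (x : Plane) : curlDisk (center i) x ∈ row c A ↔ curlDisk 0 x ∈ A i := by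
  rw [mem_row_iff hA hi (abs_curlDisk_sub_center i x), curlDisk_eq (center i),
    add_sub_cancel_right]

theorem curlDisk_mem_smoothedFigureEight_iff (m : Bool) (x : Plane) :
    curlDisk 0 x ∈ smoothedFigureEight m ↔ x ∈ if m then arcs 1 0 else arcs 0 1 := by
  have hs : x ∈ (curlDisk 0).source := by
    rw [curlDisk_source]
    exact mem_univ _
  have ht := (curlDisk 0).map_source hs
  rw [smoothedFigureEight, mem_union, mem_sdiff, mem_curlDisk_image_iff, (curlDisk 0).left_inv hs]
  have ht' := mem_curlDisk_target.1 ht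
  simp only [PiLp.zero_apply, sub_zero] at ht'
  simp only [ht, not_true, and_false, false_or, ht', true_and, and_true]

theorem mem_smoothedFigureEight_iff_of_notMem (m : Bool) {x : Plane}
    (hx : x ∉ (curlDisk 0).target) : x ∈ smoothedFigureEight m ↔ x ∈ figureEight := by
  have h : x ∉ curlDisk 0 '' if m then arcs 1 0 else arcs 0 1 := by
    rintro ⟨y, -, rfl⟩
    exact hx ((curlDisk 0).map_source (by rw [curlDisk_source]; exact mem_univ _))
  rw [smoothedFigureEight, mem_union, mem_sdiff]
  simp [hx, h]

/-- The components of a smoothed figure eight. -/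
noncomputable def loop : (m : Bool) → Fin (bif m then 1 else 2) → Set Plane
  | true, _ => smoothedFigureEight true
  | false, k => sideLoop (if k = (0 : Fin 2) then 1 else -1)

theorem boundsDisk_loop (m : Bool) (k : Fin (bif m then 1 else 2)) : BoundsDisk (loop m k) := by
  cases m with
  | true => exact boundsDisk_smoothedFigureEight_true
  | false =>
    show BoundsDisk (sideLoop (if k = (0 : Fin 2) then 1 else -1))
    split_ifs
    · exact boundsDisk_sideLoop_one
    · exact boundsDisk_sideLoop_neg_one

theorem iUnion_loop (m : Bool) : ⋃ k, loop m k = smoothedFigureEight m := by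
  cases m with
  | true =>
    show ⋃ _ : Fin 1, smoothedFigureEight true = _
    rw [iUnion_const]
  | false =>
    show ⋃ k : Fin 2, sideLoop (if k = (0 : Fin 2) then 1 else -1) = _
    rw [smoothedFigureEight_false]
    ext x
    simp [Fin.exists_fin_two]

theorem pairwise_disjoint_loop (m : Bool) : Pairwise (Function.onFun Disjoint (loop m)) := by
  cases m with
  | true => exact fun k l h => (h (Subsingleton.elim (α := Fin 1) k l)).elim
  | false =>
    intro k l h
    have key : ∀ k l : Fin 2, k ≠ l → Disjoint (sideLoop (if k = (0 : Fin 2) then 1 else -1))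
        (sideLoop (if l = (0 : Fin 2) then 1 else -1)) := by
      intro k l h
      fin_cases k <;> fin_cases l
      · exact (h rfl).elim
      · simpa using disjoint_sideLoop
      · simpa using disjoint_sideLoop.symm
      · exact (h rfl).elim
    exact key k l h

theorem loop_subset (m : Bool) (k : Fin (bif m then 1 else 2)) :
    loop m k ⊆ smoothedFigureEight m := by
  rw [← iUnion_loop m]
  exact subset_iUnion _ k

theorem row_smoothedFigureEight (c : ℕ) (m : ℕ → Bool) :
    row c (fun i => smoothedFigureEight (m i)) =
      ⋃ k : Σ i : Fin c, Fin (bif m i then 1 else 2),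
        (fun x => x + center k.1) '' loop (m k.1) k.2 := by
  rw [row_eq_iUnion, iUnion_sigma]
  refine iUnion_congr fun i => ?_
  show _ = ⋃ k, (fun x => x + center i) '' loop (m i) k
  rw [← image_iUnion, iUnion_loop]

theorem pairwise_disjoint_row_loop (c : ℕ) (m : ℕ → Bool) :
    Pairwise (Function.onFun Disjoint
      (fun k : Σ i : Fin c, Fin (bif m i then 1 else 2) =>
        (fun x => x + center k.1) '' loop (m k.1) k.2)) := by
  rintro ⟨i, k⟩ ⟨j, l⟩ h
  by_cases hij : i = j
  · subst hij
    have hkl : k ≠ l := fun hkl => h (by rw [hkl])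
    exact (disjoint_image_iff (add_left_injective _)).2 (pairwise_disjoint_loop _ hkl)
  · rw [Function.onFun, disjoint_left]
    rintro _ ⟨x, hx, rfl⟩ ⟨y, hy, hxy⟩
    refine hij (Fin.ext (eq_of_abs_sub_center (y := x + center i) ?_ ?_))
    · rw [add_sub_cancel_right]
      exact (abs_le_one_of_mem_smoothedFigureEight (loop_subset _ _ hx)).trans_lt (by norm_num)
    · have hxy' : y + center j = x + center i := hxy
      rw [← hxy', add_sub_cancel_right]
      exact (abs_le_one_of_mem_smoothedFigureEight (loop_subset _ _ hy)).trans_lt (by norm_num)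

end Rows

/-! ## Diagrams that consist of figure eights -/

section Curls

variable {F : Type*} [TopologicalSpace F] [ChartedSpace (EuclideanHalfSpace 2) F]
  [IsManifold (𝓡∂ 2) ∞ F]
  {o : SurfaceOrientation F} {b : BoundaryParametrization F}

theorem IsOrientedDisk.curlDisk_trans {e : OpenPartialHomeomorph Plane F}
    (he : IsOrientedDisk o e) (x : Plane) : IsOrientedDisk o ((curlDisk x).trans e) :=
  he.trans (curlDisk_source x) (contDiff_curlDisk x) (contDiffOn_curlDisk_symm x)
    (det_fderiv_curlDisk_pos x)

/-- The centers of a row of curves in a coordinate disk of the surface. -/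
noncomputable def crossingPoint {e : OpenPartialHomeomorph Plane F} (he : IsOrientedDisk o e) :
    ℕ ↪ F where
  toFun i := e (center i)
  inj' := he.injective.comp fun i j h => by
    have := congrArg (fun x : Plane => x 0) h
    simpa using this

theorem crossingPoint_apply {e : OpenPartialHomeomorph Plane F} (he : IsOrientedDisk o e) (i : ℕ) :
    crossingPoint he i = e (center i) := rfl

variable [T2Space F]

/-- A row of `c` figure eights with prescribed crossings in a coordinate disk of the surface. -/
noncomputable def curls (b : BoundaryParametrization F) {e : OpenPartialHomeomorph Plane F}
    (he : IsOrientedDisk o e) (c : ℕ) (ε : ℕ → Bool) : Diagram o b where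
  carrier := e '' row c fun _ => figureEight
  crossings := (Finset.range c).map (crossingPoint he)
  disk q := (curlDisk (e.symm q)).trans e
  -- The i-th crossing has abscissa 3i in the coordinate disk, from which its index is recovered.
  ovr q := ε ⌊e.symm q 0 / 3⌋₊
  isClosed :=
    ((isCompact_row fun _ => isCompact_figureEight).image he.smooth.continuous).isClosed
  boundaryPattern := by
    -- The diagram is closed and lies in the interior of F, so it has no boundary points.
    refine ⟨fun _ => 0, fun i z => ?_⟩
    constructor
    · rintro ⟨x, -, hx⟩
      refine (disjoint_left.1 (ModelWithCorners.disjoint_interior_boundary (I := 𝓡∂ 2) (M := F))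
        (he.target_subset (he.mem_target x)) ?_).elim
      rw [hx, ← b.range_eq]
      exact mem_iUnion.2 ⟨i, z, rfl⟩
    · rintro ⟨ℓ, hℓ, -⟩
      simp at hℓ
  oriented_disk _ _ := he.curlDisk_trans _
  disk_zero p hp := by
    obtain ⟨i, -, rfl⟩ := Finset.mem_map.1 hp
    have h0 : curlDisk 0 0 = 0 := by
      refine plane_ext (i := 0) (j := 1) (by decide) ?_ ?_
      · rw [curlDisk_zero]
        simp [curlX]
      · rw [curlDisk_one]
        simp [curlY]
    rw [crossingPoint_apply, he.left_inv]
    show e (curlDisk (center i) 0) = _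
    rw [curlDisk_eq, h0, zero_add]
  disk_preimage p hp := by
    obtain ⟨i, hi, rfl⟩ := Finset.mem_map.1 hp
    rw [crossingPoint_apply, he.left_inv]
    ext x
    show e (curlDisk (center i) x) ∈ e '' _ ↔ _
    rw [he.injective.mem_set_image,
      curlDisk_mem_row_iff (fun _ _ => abs_le_one_of_mem_figureEight) (Finset.mem_range.1 hi),
      curlDisk_mem_figureEight_iff]
  disjoint_disks p hp q hq hpq := by
    obtain ⟨i, -, rfl⟩ := Finset.mem_map.1 hp
    obtain ⟨j, -, rfl⟩ := Finset.mem_map.1 hq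
    rw [crossingPoint_apply, crossingPoint_apply, he.left_inv, he.left_inv, disjoint_left]
    rintro y ⟨-, hy⟩ ⟨-, hy'⟩
    rw [mem_preimage, mem_curlDisk_target] at hy hy'
    refine hpq (congrArg _ (eq_of_abs_sub_center (y := e.symm y) ?_ ?_))
    · exact abs_lt_of_sq_lt_sq (hy.1.trans (by norm_num)) (by norm_num)
    · exact abs_lt_of_sq_lt_sq (hy'.1.trans (by norm_num)) (by norm_num)
  locallyLine p hp hp' := by
    obtain ⟨y, ⟨i, hi, hy⟩, rfl⟩ := hp
    obtain ⟨Φ, h1, h2, h3, h4⟩ := row_figureEight_isGraph hi hy fun h =>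
      hp' (Finset.mem_map.2 ⟨i, Finset.mem_range.2 hi, by rw [h]; rfl⟩)
    refine he.locallyLine_of_straightening h1 h2 h3 fun z hz => ?_
    rw [preimage_image_eq _ he.injective]
    exact h4 z hz

variable {e : OpenPartialHomeomorph Plane F} (he : IsOrientedDisk o e)

/-- The value `m i` records whether the i-th crossing is resolved by the arcs that join the left and
right regions. In a figure eight these produce a single circle. -/
theorem carrier_stateCurve_curls (c : ℕ) (ε : ℕ → Bool) (S : Finset F) (m : ℕ → Bool)
    (hm : ∀ i, m i = true ↔ (ε i = true ↔ crossingPoint he i ∈ S)) :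
    ((curls b he c ε).stateCurve S).carrier =
      e '' row c fun i => smoothedFigureEight (m i) := by
  classical
  set D := curls b he c ε with hD
  have hmem : ∀ i, i < c → crossingPoint he i ∈ D.crossings := fun i hi =>
    Finset.mem_map.2 ⟨i, Finset.mem_range.2 hi, rfl⟩
  have hdisk : ∀ i, D.disk (crossingPoint he i) = (curlDisk (center i)).trans e := by
    intro i
    show (curlDisk (e.symm (e (center i)))).trans e = _
    rw [he.left_inv]
  have hovr : ∀ i, D.ovr (crossingPoint he i) = ε i := by
    intro i
    show ε ⌊e.symm (e (center i)) 0 / 3⌋₊ = _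
    rw [he.left_inv, center_zero, mul_div_cancel_left₀ _ (by norm_num), Nat.floor_natCast]
  have hA : ∀ i, ∀ x ∈ smoothedFigureEight (m i), |x 0| ≤ 1 := fun i x hx =>
    abs_le_one_of_mem_smoothedFigureEight hx
  ext q
  by_cases h : ∃ p ∈ D.crossings, q ∈ (D.disk p).target
  · obtain ⟨p, hp, hq⟩ := h
    rw [D.mem_stateCurve_iff S hp hq]
    obtain ⟨i, hi, rfl⟩ := Finset.mem_map.1 hp
    have hi' := Finset.mem_range.1 hi
    rw [hovr]
    rw [hdisk] at hq ⊢
    have hed := he.curlDisk_trans (center i)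
    obtain ⟨x, rfl⟩ : ∃ x, ((curlDisk (center i)).trans e) x = q :=
      ⟨_, OpenPartialHomeomorph.right_inv _ hq⟩
    rw [hed.left_inv]
    show _ ↔ e (curlDisk (center i) x) ∈ _
    rw [he.injective.mem_set_image, curlDisk_mem_row_iff hA hi',
      curlDisk_mem_smoothedFigureEight_iff]
    have hm' : (ε i = decide (crossingPoint he i ∈ S)) ↔ m i = true := by
      rw [hm, Bool.eq_iff_iff, decide_eq_true_iff]
    unfold resolution
    simp only [hm']
  · push Not at h
    rw [D.mem_stateCurve_iff_of_notMem S h]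
    have key : ∀ y, e y = q → ∀ i, i < c → (y - center i ∈ smoothedFigureEight (m i) ↔
        y - center i ∈ figureEight) := by
      rintro y rfl i hi
      apply mem_smoothedFigureEight_iff_of_notMem
      intro hy
      refine h _ (hmem i hi) ?_
      rw [hdisk]
      refine ⟨he.mem_target y, ?_⟩
      rw [mem_preimage, he.left_inv, mem_curlDisk_target]
      simpa [mem_curlDisk_target] using hy
    constructor
    · rintro ⟨y, ⟨i, hi, hy⟩, rfl⟩
      exact ⟨y, ⟨i, hi, (key y rfl i hi).2 hy⟩, rfl⟩
    · rintro ⟨y, ⟨i, hi, hy⟩, rfl⟩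
      exact ⟨y, ⟨i, hi, (key y rfl i hi).1 hy⟩, rfl⟩

/-- The circles are disjoint, compact and connected, hence they are the components; their bounding
disks are carried into F by e. -/
theorem components_stateCurve_curls (c : ℕ) (ε : ℕ → Bool) (S : Finset F) (m : ℕ → Bool)
    (hm : ∀ i, m i = true ↔ (ε i = true ↔ crossingPoint he i ∈ S)) :
    (∀ K ∈ components ((curls b he c ε).stateCurve S).carrier, IsInessential K) ∧
      (components ((curls b he c ε).stateCurve S).carrier).ncard =
        ∑ i ∈ Finset.range c, bif m i then 1 else 2 := by
  rw [carrier_stateCurve_curls he c ε S m hm, row_smoothedFigureEight, image_iUnion]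
  have hK : ∀ k : Σ i : Fin c, Fin (bif m i then 1 else 2),
      BoundsDisk ((fun x => x + center k.1) '' loop (m k.1) k.2) :=
    fun k => (boundsDisk_loop _ _).translate _
  have hcont : Continuous e := he.smooth.continuous
  have hdis : Pairwise (Function.onFun Disjoint
      fun k : Σ i : Fin c, Fin (bif m i then 1 else 2) =>
        e '' ((fun x => x + center k.1) '' loop (m k.1) k.2)) := fun k l h =>
    (disjoint_image_iff he.injective).2 (pairwise_disjoint_row_loop c m h)
  have hne : ∀ k : Σ i : Fin c, Fin (bif m i then 1 else 2),
      (e '' ((fun x => x + center k.1) '' loop (m k.1) k.2)).Nonempty :=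
    fun k => (hK k).isConnected.nonempty.image _
  rw [components, components_iUnion
    (C := fun k : Σ i : Fin c, Fin (bif m i then 1 else 2) =>
        e '' ((fun x => x + center k.1) '' loop (m k.1) k.2))
    (fun k => ((hK k).isCompact.image hcont).isClosed)
    (fun k => (hK k).isConnected.isPreconnected.image _ hcont.continuousOn) hne hdis]
  constructor
  · rintro _ ⟨k, rfl⟩
    exact IsInessential.of_boundsDisk he (hK k)
  -- Disjoint nonempty sets are distinct, so components are counted by indices.
  · have hinj : Function.Injective fun k : Σ i : Fin c, Fin (bif m i then 1 else 2) =>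
        e '' ((fun x => x + center k.1) '' loop (m k.1) k.2) := by
      intro k l h
      by_contra hkl
      have h1 := hdis hkl
      rw [Function.onFun] at h1
      dsimp only at h h1
      rw [h, disjoint_self] at h1
      exact (hne l).ne_empty h1
    rw [← image_univ, ncard_image_of_injective _ hinj, ncard_univ, Nat.card_eq_fintype_card,
      Fintype.card_sigma, Finset.sum_range]
    simp

/-- Every state has empty essential part, hence the same class. A figure eight contributes (-2)^1 or
(-2)^2 according to its number of circles. -/
theorem exists_curls (he : IsOrientedDisk o e) (c : ℕ) (ε : ℕ → Bool) :
    ∃ (D : Diagram o b) (q : CurveClass b) (p : ℕ ↪ F),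
      D.crossings = (Finset.range c).map p ∧ (∀ S, D.stateClass S = q) ∧
      ∀ S : Finset ℕ, (-2 : ℚ) ^ D.mu (S.map p) =
        ∏ i ∈ Finset.range c, if ε i = decide (i ∈ S) then -2 else 4 := by
  classical
  have hm : ∀ S : Finset F, ∀ i, decide (ε i = decide (crossingPoint he i ∈ S)) = true ↔
      (ε i = true ↔ crossingPoint he i ∈ S) := by
    intro S i
    rw [decide_eq_true_iff, Bool.eq_iff_iff, decide_eq_true_iff]
  have hin : ∀ S, inessentialComponents ((curls b he c ε).stateCurve S).carrier =
      components ((curls b he c ε).stateCurve S).carrier := fun S =>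
    sep_eq_self_iff_mem_true.2 (components_stateCurve_curls he c ε S _ (hm S)).1
  have hess : ∀ S, essentialPart ((curls b he c ε).stateCurve S).carrier = ∅ := by
    intro S
    rw [essentialPart, hin, sdiff_eq_empty]
    exact fun x hx => ⟨_, ⟨x, hx, rfl⟩, mem_connectedComponentIn hx⟩
  refine ⟨curls b he c ε, (curls b he c ε).stateClass ∅, crossingPoint he, rfl,
    fun S => Diagram.stateClass_congr (by rw [hess, hess]), fun S => ?_⟩
  rw [Diagram.mu, hin, (components_stateCurve_curls he c ε _ _ (hm _)).2,
    ← Finset.prod_pow_eq_pow_sum]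
  refine Finset.prod_congr rfl fun i _ => ?_
  simp only [Finset.mem_map']
  by_cases h : ε i = decide (i ∈ S)
  · simp [h]
  · simp only [h, decide_false, cond_false, if_false]
    norm_num

end Curls

/-! ## Oriented coordinate disks -/

section OrientedDisks

variable {F : Type*} [TopologicalSpace F] [ChartedSpace (EuclideanHalfSpace 2) F]

/-- The part in the open half plane of the image of an open set `W` under the chart at `p`. -/
def chartImage (p : F) (W : Set F) : Set Plane :=
  {y | 0 < y 0} ∩ (𝓡∂ 2).symm ⁻¹'
    ((chartAt (EuclideanHalfSpace 2) p).target ∩ (chartAt (EuclideanHalfSpace 2) p).symm ⁻¹' W)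

theorem isOpen_chartImage (p : F) {W : Set F} (hW : IsOpen W) : IsOpen (chartImage p W) :=
  (isOpen_lt (by fun_prop) (by fun_prop)).inter
    (((chartAt (EuclideanHalfSpace 2) p).isOpen_inter_preimage_symm hW).preimage
      (𝓡∂ 2).continuous_symm)

/-- The point p may lie on the boundary, so its image is pushed a little into the open half plane.
-/
theorem chartImage_nonempty (p : F) {W : Set F} (hW : IsOpen W) (hp : p ∈ W) :
    (chartImage p W).Nonempty := by
  set φ := chartAt (EuclideanHalfSpace 2) p with hφ
  have hcont : Continuous fun δ : ℝ => (𝓡∂ 2).symm ((φ p).1 + δ • (!₂[1, 0] : Plane)) :=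
    (𝓡∂ 2).continuous_symm.comp (by fun_prop)
  have h0 : (0 : ℝ) ∈ (fun δ : ℝ => (𝓡∂ 2).symm ((φ p).1 + δ • (!₂[1, 0] : Plane))) ⁻¹'
      (φ.target ∩ φ.symm ⁻¹' W) := by
    have h1 : (𝓡∂ 2).symm (φ p).1 = φ p := (𝓡∂ 2).left_inv (φ p)
    rw [mem_preimage, zero_smul, add_zero, h1]
    refine ⟨φ.map_source (mem_chart_source _ p), ?_⟩
    rw [mem_preimage, φ.left_inv (mem_chart_source _ p)]
    exact hp
  obtain ⟨ε, hε, hball⟩ :=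
    Metric.isOpen_iff.1 ((φ.isOpen_inter_preimage_symm hW).preimage hcont) 0 h0
  refine ⟨(φ p).1 + (ε / 2) • (!₂[1, 0] : Plane), ?_, hball ?_⟩
  · have h1 : 0 ≤ (φ p).1 0 := (φ p).2
    show 0 < (φ p).1 0 + ε / 2 * 1
    linarith
  · rw [Metric.mem_ball, dist_zero_right, Real.norm_eq_abs, abs_of_pos (by linarith)]
    linarith

theorem mem_extChartAt_target_of_mem_chartImage {p : F} {W : Set F} {y : Plane}
    (hy : y ∈ chartImage p W) : y ∈ (extChartAt (𝓡∂ 2) p).target := by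
  rw [extChartAt_target]
  refine ⟨hy.2.1, ?_⟩
  rw [range_modelWithCornersEuclideanHalfSpace]
  exact le_of_lt (α := ℝ) hy.1

theorem exists_box_subset {O : Set Plane} (hO : IsOpen O) {x : Plane} (hx : x ∈ O) :
    ∃ r : ℝ, 0 < r ∧ ∀ y : Plane, (y 0 - x 0) ^ 2 < r ^ 2 → (y 1 - x 1) ^ 2 < r ^ 2 → y ∈ O := by
  obtain ⟨ρ, hρ, hball⟩ := Metric.isOpen_iff.1 hO x hx
  refine ⟨ρ / 2, by positivity, fun y h0 h1 => hball ?_⟩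
  rw [Metric.mem_ball, dist_eq_norm, ← sq_lt_sq₀ (norm_nonneg _) hρ.le,
    norm_sq_plane (i := 0) (j := 1) (by decide), PiLp.sub_apply, PiLp.sub_apply]
  nlinarith

variable [IsManifold (𝓡∂ 2) ∞ F]

theorem exists_isOrientedDisk [Nonempty F] (o : SurfaceOrientation F) :
    ∃ e : OpenPartialHomeomorph Plane F, IsOrientedDisk o e := by
  obtain ⟨p⟩ := ‹Nonempty F›
  obtain ⟨W, hW, hWo, hpW⟩ := eventually_nhds_iff.1 (o.locallyConstant p)
  set φ := chartAt (EuclideanHalfSpace 2) p with hφ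
  obtain ⟨x₀, hx₀⟩ := chartImage_nonempty p hWo hpW
  obtain ⟨r, hr, hbox⟩ := exists_box_subset (isOpen_chartImage p hWo) hx₀
  set s : ℝ := ((o.sign p : ℤ) : ℝ) with hs
  have hs2 : s * s = 1 := by
    rcases Int.units_eq_one_or (o.sign p) with h | h <;> simp [hs, h]
  have hs0 : s ≠ 0 := fun h => by simp [h] at hs2
  have hsr : s * r ≠ 0 := mul_ne_zero hs0 hr.ne'
  -- A maps the plane onto a small box. It reflects the first coordinate if s = -1, that is, if the
  -- chart at p reverses the orientation at p.
  set A : OpenPartialHomeomorph Plane Plane :=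
    boxMap (swing (x₀ 0) (s * r) 1 hsr one_pos le_rfl) (swing (x₀ 1) r 1 hr.ne' one_pos le_rfl)
    with hA
  have hAs : ∀ x, x ∈ A.source := fun x => ⟨mem_univ _, mem_univ _⟩
  have hAO : ∀ x, A x ∈ chartImage p W := by
    intro x
    have hx := A.map_source (hAs x)
    rw [hA, mem_boxMap_target, mem_swing_target_of_one, mem_swing_target_of_one, mul_pow, sq s,
      hs2, one_mul] at hx
    exact hbox _ hx.1 hx.2
  have hAsmooth : ContDiff ℝ ∞ A := contDiff_boxMap contDiff_swing contDiff_swing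
  set e : OpenPartialHomeomorph Plane F := (A.trans halfPlaneChart).trans φ.symm with he
  have he_apply : ∀ x, e x = (extChartAt (𝓡∂ 2) p).symm (A x) := fun x => rfl
  have hsource : ∀ x, e x ∈ (extChartAt (𝓡∂ 2) p).source := fun x =>
    (extChartAt (𝓡∂ 2) p).map_target (mem_extChartAt_target_of_mem_chartImage (hAO x))
  have hright : ∀ x, extChartAt (𝓡∂ 2) p (e x) = A x := fun x =>
    (extChartAt (𝓡∂ 2) p).right_inv (mem_extChartAt_target_of_mem_chartImage (hAO x))
  have hes : e.source = univ := by
    refine eq_univ_of_forall fun x => ⟨⟨hAs x, (hAO x).1⟩, (hAO x).2.1⟩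
  have hrange : ∀ q ∈ e.target, ∃ x, e x = q := fun q hq => ⟨e.symm q, e.right_inv hq⟩
  have hsm : ContMDiff (𝓡 2) (𝓡∂ 2) ∞ e := by
    rw [← contMDiffOn_univ]
    exact (contMDiffOn_extChartAt_symm p).comp hAsmooth.contMDiff.contMDiffOn
      fun x _ => mem_extChartAt_target_of_mem_chartImage (hAO x)
  refine ⟨e, hes, hsm, ?_, ?_, ?_⟩
  · refine ContMDiffOn.comp (I' := 𝓡 2) (t := A.target) (g := A.symm) (f := extChartAt (𝓡∂ 2) p)
      (contDiffOn_boxMap_symm contDiffOn_swing_symm contDiffOn_swing_symm).contMDiffOn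
      (contMDiffOn_extChartAt.mono ?_) ?_
    · exact fun q hq => hq.1
    · exact fun q hq => hq.2.2
  · intro q hq
    obtain ⟨x, rfl⟩ := hrange q hq
    have hx : e x ∈ φ.source := by
      have := hsource x
      rwa [extChartAt_source] at this
    refine (ModelWithCorners.isInteriorPoint_iff_of_mem_atlas (I := 𝓡∂ 2) (n := ∞) (by simp)
      (chart_mem_atlas _ p) hx).2 ?_
    have h1 : φ.extend (𝓡∂ 2) (e x) = A x := hright x
    rw [h1]
    exact mem_interior.2 ⟨chartImage p W, fun y hy => mem_extChartAt_target_of_mem_chartImage hy,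
      isOpen_chartImage p hWo, hAO x⟩
  · intro x
    have hq : e x ∈ W := (hAO x).2.2
    obtain ⟨a, ha, ha'⟩ := exists_hasDerivAt_swing (c := x₀ 0) (hr := hsr)
      (hβ := one_pos) (hβ1 := le_rfl) (x 0)
    obtain ⟨d, hd, hd'⟩ := exists_hasDerivAt_swing (c := x₀ 1) (hr := hr.ne')
      (hβ := one_pos) (hβ1 := le_rfl) (x 1)
    have hdet : (fderiv ℝ A x).det = s * r * a * (r * d) := det_fderiv_boxMap ha' hd'
    -- Read in the chart at p the map e is A; passing to the preferred chart at e x adds the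
    -- coordinate change, whose determinant is controlled on W.
    have hM : HasMFDerivAt (𝓡 2) (𝓡∂ 2) e x
        ((tangentCoordChange (𝓡∂ 2) p (e x) (e x)).comp (fderiv ℝ A x)) := by
      refine ⟨hsm.continuous.continuousAt, ?_⟩
      have h1 := hasFDerivWithinAt_tangentCoordChange (I := 𝓡∂ 2) (x := p) (y := e x) (z := e x)
        ⟨hsource x, mem_extChartAt_source (e x)⟩
      rw [hright x] at h1
      -- The box lies in the open half plane, so the derivative within the half plane is a full
      -- derivative.
      have h2 : range (𝓡∂ 2) ∈ 𝓝 (A x) :=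
        Filter.mem_of_superset ((isOpen_chartImage p hWo).mem_nhds (hAO x)) fun y hy =>
          (extChartAt_target_subset_range p) (mem_extChartAt_target_of_mem_chartImage hy)
      have h3 := (h1.hasFDerivAt h2).comp x (hAsmooth.differentiable (by simp) x).hasFDerivAt
      exact h3.hasFDerivWithinAt
    rw [hM.mfderiv]
    have hdet' : ContinuousLinearMap.det (M := Plane) (R := ℝ)
        ((tangentCoordChange (𝓡∂ 2) p (e x) (e x)).comp (fderiv ℝ A x)) =
        LinearMap.det (tangentCoordChange (𝓡∂ 2) p (e x) (e x) : Plane →ₗ[ℝ] Plane) *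
          (s * r * a * (r * d)) := by
      rw [← hdet]
      exact LinearMap.det_comp _ _
    have hpos := hW (e x) hq
    have hpos' : 0 < (s * ((o.sign (e x) : ℤ) : ℝ)) *
        LinearMap.det (tangentCoordChange (𝓡∂ 2) p (e x) (e x) : Plane →ₗ[ℝ] Plane) := by
      rw [hs]
      push_cast at hpos
      exact hpos
    refine lt_of_lt_of_eq ?_ (congrArg _ hdet'.symm)
    have := mul_pos hpos' (show 0 < r * a * (r * d) by positivity)
    linarith

end OrientedDisks

end KauffmanBracket

theorem mainTheorem6 {F : Type*} [TopologicalSpace F] [T2Space F] [CompactSpace F]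
    [ConnectedSpace F] [ChartedSpace (EuclideanHalfSpace 2) F] [IsManifold (𝓡∂ 2) ∞ F]
    (o : KauffmanBracket.SurfaceOrientation F) (b : KauffmanBracket.BoundaryParametrization F)
    (𝕜 : Type*) [CommRing 𝕜] [Nontrivial 𝕜] [Algebra ℚ 𝕜] :
    (∃ P : ℕ → MvPolynomial (Fin 2) ℚ, KauffmanBracket.ExpandsBracket 𝕜 o b P ∧
      ∀ k, (P k).totalDegree = k ∧ (1 < k → ¬ ∃ n, (P k).IsHomogeneous n) ∧
        MvPolynomial.homogeneousComponent k (P k) =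
          ∑ i ∈ Finset.range (k + 1),
            (-1) ^ i * MvPolynomial.X 0 ^ i * MvPolynomial.X 1 ^ (k - i)) ∧
    (∀ P : ℕ → MvPolynomial (Fin 2) ℚ, KauffmanBracket.ExpandsBracket 𝕜 o b P →
      ∀ k, (Even k → MvPolynomial.rename (Equiv.swap 0 1) (P k) = P k) ∧
        (Odd k → MvPolynomial.rename (Equiv.swap 0 1) (P k) = -P k)) ∧
    (∀ (k : ℕ) (D : KauffmanBracket.Diagram o b),
      KauffmanBracket.bracketCoeff 𝕜 k D.crossingChange =
        (-1 : 𝕜) ^ k • KauffmanBracket.bracketCoeff 𝕜 k D) := by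
  refine ⟨⟨KauffmanBracket.bracketPolynomial,
    KauffmanBracket.expandsBracket_bracketPolynomial o b 𝕜, fun k =>
      ⟨KauffmanBracket.totalDegree_bracketPolynomial k,
        KauffmanBracket.not_isHomogeneous_bracketPolynomial,
        KauffmanBracket.homogeneousComponent_bracketPolynomial k⟩⟩, fun P hP k => ?_,
    KauffmanBracket.bracketCoeff_crossingChange⟩
  -- One oriented disk in F carries all test diagrams, so uniqueness reduces the symmetry to the
  -- explicit polynomials.
  obtain ⟨e, he⟩ := KauffmanBracket.exists_isOrientedDisk o
  rw [KauffmanBracket.eq_bracketPolynomial_of_expandsBracket (KauffmanBracket.exists_curls he) hP k,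
    KauffmanBracket.rename_swap_bracketPolynomial]
  exact ⟨fun hk => by rw [hk.neg_one_pow, one_smul],
    fun hk => by rw [hk.neg_one_pow, neg_one_smul]⟩
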